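/- \textbf{Model.} Three users, Alice (1), Bob (2) and Charlie (3), are pairwise connected by private noiseless bidirectional links, and each has private randomness, independent of everything else. For block length $n$, Alice has $X^n$ and Bob has $Y^n$, where the pairs $(X_i,Y_i)\sim p_{XY}$ are i.i.d., and Charlie, who has no input, is to output $Z^n$ with $Z_i=f(X_i,Y_i)$. A protocol proceeds in synchronous rounds; in each round each user sends on each of its two links a (possibly empty) binary string, which is a function of its input, its private randomness, and all the strings exchanged so far on its two links. With probability 1, the string sent in a given direction of a link in a given round is a codeword of a prefix-free code determined by what was exchanged so far on that link, and every link is eventually unused. Charlie's output $\hat Z^n$ is a function of his private randomness and of all the strings exchanged on his two links. Let $M_{ij}$ be the transcript of link $ij$ and $L_{ij}$ the total number of bits exchanged on it. Logarithms and entropies are to the base 2. \textbf{Asymptotic security.} The rates of a protocol of block length $n$ are $R_{ij}=\frac1n\mathbb E[L_{ij}]$ and $\rho=\frac1nH(M_{12},M_{23},M_{31}\mid X^n,Y^n)$. The protocol is \emph{$\epsilon$-secure} if $\Pr[\hat Z^n\ne Z^n]$, $I(M_{12},M_{31};Y^n\mid X^n)$, $I(M_{12},M_{23};X^n\mid Y^n)$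 and $I(M_{23},M_{31};X^n,Y^n\mid Z^n)$ are all at most $\epsilon$. A quadruple in $[0,\infty)^4$ is \emph{achievable with asymptotic security} if there is a sequence of protocols $\Pi_n$ of block length $n$ whose rate quadruples $(R_{12},R_{23},R_{31},\rho)$ converge to it and such that for every $\epsilon>0$ there are arbitrarily large $n$ for which $\Pi_n$ is $\epsilon$-secure. Let $\mathcal R^{\mathrm{AS}}$ be the closure of the set of these quadruples. \textbf{Perfect security.} A quadruple $(R_{12},R_{23},R_{31},\rho)$ in $[0,\infty)^4$ is \emph{achievable with perfect security} if for some $n\ge1$ there is a protocol of block length $n$ with $R_{ij}=\frac1n\mathbb E[L_{ij}]$, $\rho=\frac1nH(M_{12},M_{23},M_{31},\hat Z^n\mid X^n,Y^n)$, $\hat Z^n=Z^n$ almost surely, and $I(M_{12},M_{31};Y^n,\hat Z^n\mid X^n)=I(M_{12},M_{23};X^n,\hat Z^n\mid Y^n)=I(M_{23},M_{31};X^n,Y^n\mid\hat Z^n)=0$. Let $\mathcal R^{\mathrm{PS}}$ be the closure of the set of these quadruples. \textbf{Theorem.} Let $\mathbb F$ be a finite field, let $X\sim p_X$ and $Y\sim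 p_Y$ be independent with full support in $\mathbb F$, let $f(x,y)=x+y$ and $Z=X+Y$. \begin{enumerate} \item Every $(R_{12},R_{23},R_{31},\rho)\in\mathcal R^{\mathrm{AS}}$ satisfies $R_{12},R_{23},R_{31},\rho\ge H(Z)$. \item For every $\epsilon>0$, put $R=H(Z)/\log|\mathbb F|+\epsilon$ and $m_n=\lceil nR\rceil$. There are matrices $A_n\in\mathbb F^{m_n\times n}$ and decoders $D_n:\mathbb F^{m_n}\to\mathbb F^n$ such that the following protocols (elements of $\mathbb F^{m_n}$ being sent as binary strings of fixed length $\lceil\log|\mathbb F|^{m_n}\rceil$) are $\delta$-secure for every $\delta>0$ and all sufficiently large $n$, and each of their four rates $R_{12},R_{23},R_{31},\rho$ tends to $H(Z)+\epsilon\log|\mathbb F|$: Alice draws $K$ uniformly from $\mathbb F^{m_n}$ and sends it to Bob; Alice sends $A_nX^n+K$ to Charlie; Bob sends $A_nY^n-K$ to Charlie; Charlie applies $D_n$ to the sum of the two vectors received. \item Consequently the bound is optimal: $(H(Z),H(Z),H(Z),H(Z))\in\mathcal R^{\mathrm{AS}}$. \item In contrast, every $(R_{12},R_{23},R_{31},\rho)\in\mathcal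 R^{\mathrm{PS}}$ satisfies $R_{12},R_{23},R_{31},\rho\ge\log|\mathbb F|$; and if $Z$ is not uniformly distributed on $\mathbb F$, then $(H(Z),H(Z),H(Z),H(Z))\notin\mathcal R^{\mathrm{PS}}$. \end{enumerate} -/

import Mathlib

open MeasureTheory Filter Topology
open scoped ENNReal NNReal Matrix

namespace SecureComp

noncomputable section

/-! ### Shannon information of discrete random variables (logarithms to base 2)

A random variable is a function on a probability space which takes values, almost surely, in a
countable set. Entropies are valued in `[0, ∞]`, so no convergence convention is involved. -/

section Information

variable {Ω α β γ : Type*} [MeasurableSpace Ω]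

/-- Shannon entropy `H(U) = ∑ᵤ P(u) log₂ (1 / P(u))`. -/
def entropy (μ : Measure Ω) (U : Ω → α) : ℝ≥0∞ :=
  ∑' u, ENNReal.ofReal (Real.negMulLog (μ.real {ω | U ω = u}) / Real.log 2)

/-- Conditional entropy `H(U | V) = ∑ᵤᵥ P(u, v) log₂ (P(v) / P(u, v))`. -/
def condEntropy (μ : Measure Ω) (U : Ω → α) (V : Ω → β) : ℝ≥0∞ :=
  ∑' u, ∑' v, ENNReal.ofReal (μ.real {ω | U ω = u ∧ V ω = v} *
    Real.logb 2 (μ.real {ω | V ω = v} / μ.real {ω | U ω = u ∧ V ω = v}))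

/-- Conditional mutual information `I(U; V | W) = H(V | W) - H(V | U, W)` for a random variable
`V` with finitely many values. (Both terms are then finite and the second is at most the
first, so the subtraction is the one of real numbers.) -/
def condMutualInfo [Finite β] (μ : Measure Ω) (U : Ω → α) (V : Ω → β) (W : Ω → γ) : ℝ≥0∞ :=
  condEntropy μ V W - condEntropy μ V (fun ω => (U ω, W ω))

end Information

/-! ### Three-user protocols

The users are Alice (user 1), Bob (user 2) and Charlie (user 3). In every round each user sends a
(possibly empty) binary string on each of its two links. -/

/-- A message: a finite binary string. -/
abbrev Msg := List Bool

/-- What is sent in one round on a link, as a pair of messages, one for each direction. On the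
links 12, 23, 31 these are (1 to 2, 2 to 1), (2 to 3, 3 to 2), (3 to 1, 1 to 3) respectively. -/
abbrev LinkRound := Msg × Msg

/-- What was sent on a link in the rounds so far, in chronological order. -/
abbrev LinkHist := List LinkRound

/-- What is sent on a link in the entire execution; entry `t` is what is sent in round `t`
(counted from `0`). -/
abbrev LinkTranscript := ℕ → LinkRound

/-- No string of the code is a proper prefix of another one. -/
def PrefixFree (C : Set Msg) : Prop := ∀ u ∈ C, ∀ v ∈ C, u <+: v → u = v

/-- The strategy of a user with input alphabet `I`: a source of private randomness, and the two
messages to be sent next (one on each of the two links of the user), as a function of the input,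
the private randomness, and what was sent so far on these two links. -/
structure Party (I : Type) where
  Ω : Type
  mΩ : MeasurableSpace Ω
  μ : Measure Ω
  prob : IsProbabilityMeasure μ
  next : I → Ω → LinkHist → LinkHist → Msg × Msg
  measurable_next : ∀ i h h' w, MeasurableSet {r | next i r h h' = w}

attribute [instance] Party.mΩ Party.prob

/-- Next message functions of the three users and output function of Charlie; Alice has
inputs in `A`, Bob in `B`, Charlie has no input, and the output is in `C`.
The two links of Alice are 12 and 31, those of Bob 12 and 23, those of Charlie 23 and 31;
the messages and the histories are listed in these orders. -/
structure PreProtocol (A B C : Type) where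
  alice : Party A
  bob : Party B
  charlie : Party Unit
  output : charlie.Ω → LinkTranscript → LinkTranscript → C
  measurable_output : ∀ m₂₃ m₃₁ z, MeasurableSet {r | output r m₂₃ m₃₁ = z}

namespace PreProtocol

variable {A B C : Type} (π : PreProtocol A B C)

/-- The private randomness of the three users. -/
abbrev Rand : Type := π.alice.Ω × π.bob.Ω × π.charlie.Ω

/-- The private randomness is independent between the users. -/
def randMeasure : Measure π.Rand := π.alice.μ.prod (π.bob.μ.prod π.charlie.μ)

/-- What is sent on the links 12, 23, 31 in the round that follows the history `h`. -/
def round (x : A) (y : B) (r : π.Rand) (h : LinkHist × LinkHist × LinkHist) :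
    LinkRound × LinkRound × LinkRound :=
  let a := π.alice.next x r.1 h.1 h.2.2
  let b := π.bob.next y r.2.1 h.1 h.2.1
  let c := π.charlie.next () r.2.2 h.2.1 h.2.2
  ((a.1, b.1), (b.2, c.1), (c.2, a.2))

/-- What was sent on the links 12, 23, 31 in the first `t` rounds. -/
def hist (x : A) (y : B) (r : π.Rand) : ℕ → LinkHist × LinkHist × LinkHist
  | 0 => ([], [], [])
  | t + 1 =>
    let h := hist x y r t
    let m := π.round x y r h
    (h.1 ++ [m.1], h.2.1 ++ [m.2.1], h.2.2 ++ [m.2.2])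

/-- The transcript of link 12. -/
def link12 (x : A) (y : B) (r : π.Rand) : LinkTranscript :=
  fun t => (π.round x y r (π.hist x y r t)).1

/-- The transcript of link 23. -/
def link23 (x : A) (y : B) (r : π.Rand) : LinkTranscript :=
  fun t => (π.round x y r (π.hist x y r t)).2.1

/-- The transcript of link 31. -/
def link31 (x : A) (y : B) (r : π.Rand) : LinkTranscript :=
  fun t => (π.round x y r (π.hist x y r t)).2.2

end PreProtocol

/-- A protocol: on every link and in every round, the message sent in each direction is, with
probability 1, a codeword of a prefix-free code which is determined by what was sent so far on this
link; and, with probability 1, every link remains unused from some round on. -/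
structure Protocol (A B C : Type) extends PreProtocol A B C where
  code12 : LinkHist → Set Msg × Set Msg
  code23 : LinkHist → Set Msg × Set Msg
  code31 : LinkHist → Set Msg × Set Msg
  prefixFree12 : ∀ h, PrefixFree (code12 h).1 ∧ PrefixFree (code12 h).2
  prefixFree23 : ∀ h, PrefixFree (code23 h).1 ∧ PrefixFree (code23 h).2
  prefixFree31 : ∀ h, PrefixFree (code31 h).1 ∧ PrefixFree (code31 h).2
  mem_code12 : ∀ x y, ∀ᵐ r ∂toPreProtocol.randMeasure, ∀ t,
    toPreProtocol.link12 x y r t ∈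
      (code12 (toPreProtocol.hist x y r t).1).1 ×ˢ (code12 (toPreProtocol.hist x y r t).1).2
  mem_code23 : ∀ x y, ∀ᵐ r ∂toPreProtocol.randMeasure, ∀ t,
    toPreProtocol.link23 x y r t ∈
      (code23 (toPreProtocol.hist x y r t).2.1).1 ×ˢ (code23 (toPreProtocol.hist x y r t).2.1).2
  mem_code31 : ∀ x y, ∀ᵐ r ∂toPreProtocol.randMeasure, ∀ t,
    toPreProtocol.link31 x y r t ∈
      (code31 (toPreProtocol.hist x y r t).2.2).1 ×ˢ (code31 (toPreProtocol.hist x y r t).2.2).2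
  terminates : ∀ x y, ∀ᵐ r ∂toPreProtocol.randMeasure, ∀ᶠ t in atTop,
    toPreProtocol.link12 x y r t = ([], []) ∧ toPreProtocol.link23 x y r t = ([], []) ∧
      toPreProtocol.link31 x y r t = ([], [])

/-- The number of bits exchanged on a link. -/
def totalLength (m : LinkTranscript) : ℝ≥0∞ :=
  ∑' t, (((m t).1.length + (m t).2.length : ℕ) : ℝ≥0∞)

/-! ### Block-wise computation -/

/-- A protocol for inputs and outputs of block length `n`. -/
abbrev BlockProtocol (𝒳 𝒴 𝒵 : Type) (n : ℕ) :=
  Protocol (Fin n → 𝒳) (Fin n → 𝒴) (Fin n → 𝒵)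

namespace BlockProtocol

variable {𝒳 𝒴 𝒵 : Type} {n : ℕ} (Q : BlockProtocol 𝒳 𝒴 𝒵 n)

/-- The outcomes: the input pairs `(Xᵢ, Yᵢ)` and the private randomness. -/
abbrev Outcome : Type := (Fin n → 𝒳 × 𝒴) × Q.Rand

/-- The joint law: the pairs `(Xᵢ, Yᵢ)` are i.i.d. with law `P`, independent of the private
randomness. -/
def law [MeasurableSpace 𝒳] [MeasurableSpace 𝒴] (P : Measure (𝒳 × 𝒴)) : Measure Q.Outcome :=
  (Measure.pi fun _ : Fin n => P).prod Q.randMeasure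

/-- Alice's input `Xⁿ`. -/
def X (ω : Q.Outcome) : Fin n → 𝒳 := fun i => (ω.1 i).1

/-- Bob's input `Yⁿ`. -/
def Y (ω : Q.Outcome) : Fin n → 𝒴 := fun i => (ω.1 i).2

/-- The true output `Zⁿ`, where `Zᵢ = f (Xᵢ, Yᵢ)`. -/
def Z (f : 𝒳 → 𝒴 → 𝒵) (ω : Q.Outcome) : Fin n → 𝒵 := fun i => f (ω.1 i).1 (ω.1 i).2

/-- The transcript `M₁₂`. -/
def M12 (ω : Q.Outcome) : LinkTranscript := Q.link12 (Q.X ω) (Q.Y ω) ω.2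

/-- The transcript `M₂₃`. -/
def M23 (ω : Q.Outcome) : LinkTranscript := Q.link23 (Q.X ω) (Q.Y ω) ω.2

/-- The transcript `M₃₁`. -/
def M31 (ω : Q.Outcome) : LinkTranscript := Q.link31 (Q.X ω) (Q.Y ω) ω.2

/-- Charlie's output. -/
def Zhat (ω : Q.Outcome) : Fin n → 𝒵 := Q.output ω.2.2.2 (Q.M23 ω) (Q.M31 ω)

variable [MeasurableSpace 𝒳] [MeasurableSpace 𝒴]

/-- The rate quadruple `(R₁₂, R₂₃, R₃₁, ρ)` with `Rᵢⱼ = E[Lᵢⱼ] / n` and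
`ρ = H(M₁₂, M₂₃, M₃₁ | Xⁿ, Yⁿ) / n`. -/
def rate (P : Measure (𝒳 × 𝒴)) : Fin 4 → ℝ≥0∞ :=
  ![(∫⁻ ω, totalLength (Q.M12 ω) ∂Q.law P) / n,
    (∫⁻ ω, totalLength (Q.M23 ω) ∂Q.law P) / n,
    (∫⁻ ω, totalLength (Q.M31 ω) ∂Q.law P) / n,
    condEntropy (Q.law P) (fun ω => (Q.M12 ω, Q.M23 ω, Q.M31 ω)) (fun ω => (Q.X ω, Q.Y ω)) / n]

/-- The rate quadruple `(R₁₂, R₂₃, R₃₁, ρ)` in the setting of perfect security, where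
`ρ = H(M₁₂, M₂₃, M₃₁, Ẑⁿ | Xⁿ, Yⁿ) / n` takes Charlie's output `Ẑⁿ` into account. -/
def ratePS (P : Measure (𝒳 × 𝒴)) : Fin 4 → ℝ≥0∞ :=
  ![(∫⁻ ω, totalLength (Q.M12 ω) ∂Q.law P) / n,
    (∫⁻ ω, totalLength (Q.M23 ω) ∂Q.law P) / n,
    (∫⁻ ω, totalLength (Q.M31 ω) ∂Q.law P) / n,
    condEntropy (Q.law P) (fun ω => (Q.M12 ω, Q.M23 ω, Q.M31 ω, Q.Zhat ω))
      (fun ω => (Q.X ω, Q.Y ω)) / n]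

/-- Correctness and privacy against Alice, Bob and Charlie, each up to `ε`. -/
def SecureUpTo [Finite 𝒳] [Finite 𝒴] (P : Measure (𝒳 × 𝒴)) (f : 𝒳 → 𝒴 → 𝒵) (ε : ℝ≥0∞) :
    Prop :=
  Q.law P {ω | Q.Zhat ω ≠ Q.Z f ω} ≤ ε ∧
  condMutualInfo (Q.law P) (fun ω => (Q.M12 ω, Q.M31 ω)) Q.Y Q.X ≤ ε ∧
  condMutualInfo (Q.law P) (fun ω => (Q.M12 ω, Q.M23 ω)) Q.X Q.Y ≤ ε ∧
  condMutualInfo (Q.law P) (fun ω => (Q.M23 ω, Q.M31 ω)) (fun ω => (Q.X ω, Q.Y ω)) (Q.Z f) ≤ ε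

/-- Perfect correctness (for inputs of positive probability, Charlie's output is the value of `f`
with probability 1) and perfect privacy against Alice, Bob and Charlie. -/
def PerfectlySecure [Finite 𝒳] [Finite 𝒴] [Finite 𝒵] (P : Measure (𝒳 × 𝒴)) (f : 𝒳 → 𝒴 → 𝒵) :
    Prop :=
  Q.law P {ω | Q.Zhat ω ≠ Q.Z f ω} = 0 ∧
  condMutualInfo (Q.law P) (fun ω => (Q.M12 ω, Q.M31 ω)) (fun ω => (Q.Y ω, Q.Zhat ω)) Q.X = 0 ∧
  condMutualInfo (Q.law P) (fun ω => (Q.M12 ω, Q.M23 ω)) (fun ω => (Q.X ω, Q.Zhat ω)) Q.Y = 0 ∧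
  condMutualInfo (Q.law P) (fun ω => (Q.M23 ω, Q.M31 ω)) (fun ω => (Q.X ω, Q.Y ω)) Q.Zhat = 0

end BlockProtocol

/-! ### Rate regions -/

section Regions

variable {𝒳 𝒴 𝒵 : Type} [Finite 𝒳] [Finite 𝒴] [Finite 𝒵] [MeasurableSpace 𝒳] [MeasurableSpace 𝒴]

/-- The rate quadruple `q` is achievable with asymptotic security for the problem `(f, P)`: there
is a sequence of protocols with rates tending to `q` such that for every `ε > 0` there are
arbitrarily large `n` for which the protocol of block length `n` is secure up to `ε`. -/
def AchievableAS (P : Measure (𝒳 × 𝒴)) (f : 𝒳 → 𝒴 → 𝒵) (q : Fin 4 → ℝ≥0) : Prop :=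
  ∃ Q : ∀ n, BlockProtocol 𝒳 𝒴 𝒵 n,
    (∀ i, Tendsto (fun n => (Q n).rate P i) atTop (𝓝 (q i : ℝ≥0∞))) ∧
    ∀ ε : ℝ≥0∞, 0 < ε → ∃ᶠ n in atTop, (Q n).SecureUpTo P f ε

/-- The rate region for asymptotic security. -/
def regionAS (P : Measure (𝒳 × 𝒴)) (f : 𝒳 → 𝒴 → 𝒵) : Set (Fin 4 → ℝ≥0) :=
  closure {q | AchievableAS P f q}

/-- The rate quadruple `q` is achievable with perfect security for the problem `(f, P)`, for some
block length. -/
def AchievablePS (P : Measure (𝒳 × 𝒴)) (f : 𝒳 → 𝒴 → 𝒵) (q : Fin 4 → ℝ≥0) : Prop :=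
  ∃ n, 1 ≤ n ∧ ∃ Q : BlockProtocol 𝒳 𝒴 𝒵 n,
    (∀ i, Q.ratePS P i = (q i : ℝ≥0∞)) ∧ Q.PerfectlySecure P f

/-- The rate region for perfect security. -/
def regionPS (P : Measure (𝒳 × 𝒴)) (f : 𝒳 → 𝒴 → 𝒵) : Set (Fin 4 → ℝ≥0) :=
  closure {q | AchievablePS P f q}

end Regions

/-! ### The secure Körner–Marton protocol -/

section KornerMarton

/-- The length of the binary representation of the elements of a finite set. -/
def bitLength (V : Type) [Fintype V] : ℕ := Nat.clog 2 (Fintype.card V)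

/-- A binary representation, of fixed length, of the elements of a finite set. -/
def encode {V : Type} [Fintype V] (v : V) : Msg :=
  List.ofFn fun j : Fin (bitLength V) => Nat.testBit (Fintype.equivFin V v) j

/-- The element with a given binary representation. -/
def decode {V : Type} [Fintype V] [Nonempty V] : Msg → V := Function.invFun encode

lemma encode_length {V : Type} [Fintype V] (v : V) : (encode v).length = bitLength V := by
  simp [encode]

lemma encode_injective {V : Type} [Fintype V] : Function.Injective (encode (V := V)) := by
  intro v w h
  have h' := List.ofFn_injective h
  apply (Fintype.equivFin V).injective
  apply Fin.ext
  apply Nat.eq_of_testBit_eq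
  intro j
  by_cases hj : j < bitLength V
  · exact congrFun h' ⟨j, hj⟩
  · have hb : Fintype.card V ≤ 2 ^ j :=
      (Nat.le_pow_clog one_lt_two _).trans
        (Nat.pow_le_pow_right two_pos (not_lt.mp hj))
    rw [Nat.testBit_eq_false_of_lt ((Fintype.equivFin V v).isLt.trans_le hb),
      Nat.testBit_eq_false_of_lt ((Fintype.equivFin V w).isLt.trans_le hb)]

lemma decode_encode {V : Type} [Fintype V] [Nonempty V] (v : V) : decode (encode v) = v :=
  Function.leftInverse_invFun encode_injective v

variable {F : Type} [Field F] [Fintype F] {m n : ℕ}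

/-- Alice draws a uniformly distributed key `K` in `F ^ m` and sends it to Bob (first round); then
she sends `A Xⁿ + K` to Charlie (second round). -/
def kmAlice (A : Matrix (Fin m) (Fin n) F) : Party (Fin n → F) where
  Ω := Fin m → F
  mΩ := ⊤
  μ := @PMF.toMeasure (Fin m → F) ⊤ (PMF.uniformOfFintype (Fin m → F))
  prob := @PMF.toMeasure.isProbabilityMeasure (Fin m → F) ⊤ _
  next x K h₁₂ _ :=
    if h₁₂.length = 0 then (encode K, [])
    else if h₁₂.length = 1 then ([], encode (A *ᵥ x + K))
    else ([], [])
  measurable_next _ _ _ _ := trivial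

/-- Bob reads the key `K` that Alice has sent to him, and sends `A Yⁿ - K` to Charlie (second
round). -/
def kmBob (A : Matrix (Fin m) (Fin n) F) : Party (Fin n → F) where
  Ω := Unit
  mΩ := ⊤
  μ := Measure.dirac ()
  prob := inferInstance
  next y _ h₁₂ _ :=
    if h₁₂.length = 1 then ([], encode (A *ᵥ y - decode (h₁₂.headD ([], [])).1)) else ([], [])
  measurable_next _ _ _ _ := trivial

/-- Charlie sends nothing. -/
def kmCharlie : Party Unit where
  Ω := Unit
  mΩ := ⊤
  μ := Measure.dirac ()
  prob := inferInstance
  next _ _ _ _ := ([], [])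
  measurable_next _ _ _ _ := trivial

/-- Charlie adds the two vectors that he has received, which gives `A (Xⁿ + Yⁿ)`, and applies the
decoder `D` to the sum. -/
def kmPre (A : Matrix (Fin m) (Fin n) F) (D : (Fin m → F) → (Fin n → F)) :
    PreProtocol (Fin n → F) (Fin n → F) (Fin n → F) where
  alice := kmAlice A
  bob := kmBob A
  charlie := kmCharlie
  output _ m₂₃ m₃₁ := D (decode (m₃₁ 1).2 + decode (m₂₃ 1).1)
  measurable_output _ _ _ := trivial

lemma PreProtocol.hist_length {A B C : Type} (π : PreProtocol A B C) (x : A) (y : B) (r : π.Rand)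
    (t : ℕ) : (π.hist x y r t).1.length = t ∧ (π.hist x y r t).2.1.length = t ∧
      (π.hist x y r t).2.2.length = t := by
  induction t with
  | zero => simp [PreProtocol.hist]
  | succ t ih => simp [PreProtocol.hist, ih]

lemma prefixFree_length (k : ℕ) : PrefixFree {w | w.length = k} :=
  fun _ hu _ hv h => h.eq_of_length (hu.trans hv.symm)

lemma prefixFree_nil : PrefixFree {([] : Msg)} := by
  rintro _ rfl _ rfl _; rfl

/-- The secure Körner–Marton protocol with linear encoder `A` and decoder `D`. Strings of fixed
length are sent on the links that are in use in a round. -/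
def kmProtocol (A : Matrix (Fin m) (Fin n) F) (D : (Fin m → F) → (Fin n → F)) :
    BlockProtocol F F F n where
  toPreProtocol := kmPre A D
  code12 h := (if h.length = 0 then {w | w.length = bitLength (Fin m → F)} else {[]}, {[]})
  code23 h := (if h.length = 1 then {w | w.length = bitLength (Fin m → F)} else {[]}, {[]})
  code31 h := ({[]}, if h.length = 1 then {w | w.length = bitLength (Fin m → F)} else {[]})
  prefixFree12 h := by
    refine ⟨?_, prefixFree_nil⟩
    dsimp only
    split_ifs
    exacts [prefixFree_length _, prefixFree_nil]
  prefixFree23 h := by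
    refine ⟨?_, prefixFree_nil⟩
    dsimp only
    split_ifs
    exacts [prefixFree_length _, prefixFree_nil]
  prefixFree31 h := by
    refine ⟨prefixFree_nil, ?_⟩
    dsimp only
    split_ifs
    exacts [prefixFree_length _, prefixFree_nil]
  mem_code12 x y := by
    refine Eventually.of_forall fun r t => ?_
    unfold PreProtocol.link12
    generalize (kmPre A D).hist x y r t = h
    by_cases h0 : h.1.length = 0
    · have h1 : h.1.length ≠ 1 := by omega
      refine ⟨?_, ?_⟩
      · simp only [PreProtocol.round, kmPre, kmAlice, if_pos h0]
        exact encode_length _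
      · simp only [PreProtocol.round, kmPre, kmBob, if_neg h1]
        rfl
    · refine ⟨?_, ?_⟩
      · simp only [PreProtocol.round, kmPre, kmAlice, if_neg h0]
        split_ifs <;> rfl
      · simp only [PreProtocol.round, kmPre, kmBob]
        split_ifs <;> rfl
  mem_code23 x y := by
    refine Eventually.of_forall fun r t => ?_
    obtain ⟨h12, h23, -⟩ := (kmPre A D).hist_length x y r t
    unfold PreProtocol.link23
    generalize (kmPre A D).hist x y r t = h at h12 h23 ⊢
    refine ⟨?_, rfl⟩
    simp only [PreProtocol.round, kmPre, kmBob, h12, h23]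
    split_ifs
    exacts [encode_length _, rfl]
  mem_code31 x y := by
    refine Eventually.of_forall fun r t => ?_
    obtain ⟨h12, -, h31⟩ := (kmPre A D).hist_length x y r t
    unfold PreProtocol.link31
    generalize (kmPre A D).hist x y r t = h at h12 h31 ⊢
    refine ⟨rfl, ?_⟩
    by_cases h1 : t = 1
    · simp only [PreProtocol.round, kmPre, kmAlice, h12, h31, h1, if_true, one_ne_zero, if_false]
      exact encode_length _
    · simp only [PreProtocol.round, kmPre, kmAlice, h12, h31, if_neg h1]
      split_ifs <;> rfl
  terminates x y := by
    refine Eventually.of_forall fun r => ?_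
    filter_upwards [eventually_ge_atTop 2] with t ht
    have h12 := ((kmPre A D).hist_length x y r t).1
    unfold PreProtocol.link12 PreProtocol.link23 PreProtocol.link31
    generalize (kmPre A D).hist x y r t = h at h12 ⊢
    have h0 : h.1.length ≠ 0 := by omega
    have h1 : h.1.length ≠ 1 := by omega
    simp only [PreProtocol.round, kmPre, kmAlice, kmBob, kmCharlie, if_neg h0, if_neg h1,
      and_self]

end KornerMarton

end

end SecureComp

/-! Converse. Write M₁₂, M₂₃, M₃₁ for what is sent on the links; three facts carry the bounds.

(1) Charlie's links are nearly independent of the inputs. Link 23 is seen by Bob and by Charlie, so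
it tells little beyond Y and little beyond Z. With full support every value of Y is compatible with
every value of Z, and a density that is almost a function of Y and almost a function of Z is almost
constant (`divergence_le_of_push`). The constant depends only on the smallest probability of a
single pair of inputs, and the chain rule keeps it for every block length (`mutualInfo_block_le`).
Link 31 is treated in the same way with X in place of Y.

(2) Inputs and private randomness are independent, so the joint probability of inputs and histories
is a product with one factor per user (`PreProtocol.hist_eq_iff`, `BlockProtocol.law_real_rect`).
Hence X is conditionally independent of (Y, M₂₃) given M₁₂ and M₃₁, and similarly for Bob and
Charlie. By Fano's inequality M₂₃ and M₃₁ nearly determine Z; as Z and Y give X, the two links of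
Alice nearly determine X, and likewise the two links of Bob nearly determine Y.

(3) The co-information I(M₁₂;M₂₃) - I(M₁₂;M₂₃|M₃₁) is nonnegative: it vanishes before the first
round and no message decreases it (`coinfo_le_of_factorizes`, `BlockProtocol.coinfo_nonneg`).

Up to small errors, H(M₂₃) ≥ H(M₂₃|M₃₁) ≥ H(Z|M₃₁) = H(Z), and symmetrically for M₃₁. By (3), H(M₁₂)
≥ H(M₁₂|M₂₃) + I(M₁₂;M₂₃|M₃₁) ≥ H(Y) + I(X;Z) = H(Z) (`ent_links_ge`). Kraft's inequality turns
entropies into expected lengths, and the randomness is at least H(M₃₁|X,Y), which is nearly H(M₃₁)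
by (1).

Perfect security. Now every link is exactly independent of the inputs, so the laws of the histories
do not depend on the law of the inputs. The same protocol may be run with X uniform and Y = 0. Then
Z is uniform, and the bound H(Z) becomes log |F| (`BlockProtocol.logb_card_le_ratePS`). Strict
concavity of the entropy separates this from H(Z) when Z is not uniform.

Achievability. A random matrix compresses Z at any rate above its entropy, by a union bound over
typical sequences (`exists_linear_source_code`). By linearity the sum of the compressed inputs is
the compression of Z, and the key acts as a one-time pad. The three leakages are exactly zero, so
the decoding error is the only defect (`kmProtocol_secureUpTo`). -/

namespace SecureComp

noncomputable section

/-! ### Discrete random variables -/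

section Discrete

variable {Ω α β γ : Type*} [MeasurableSpace Ω] {μ : Measure Ω}

/-- A random variable with values, almost surely, in a countable set. -/
structure IsDiscrete (μ : Measure Ω) (U : Ω → α) : Prop where
  fiber : ∀ u, NullMeasurableSet {ω | U ω = u} μ
  countable : ∃ S : Set α, S.Countable ∧ ∀ᵐ ω ∂μ, U ω ∈ S

lemma IsDiscrete.nullMeasurableSet_preimage {U : Ω → α} (hU : IsDiscrete μ U) (s : Set α) :
    NullMeasurableSet {ω | U ω ∈ s} μ := by
  obtain ⟨S, hS, hUS⟩ := hU.countable
  have h : NullMeasurableSet (⋃ u ∈ S ∩ s, {ω | U ω = u}) μ :=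
    NullMeasurableSet.biUnion (hS.mono Set.inter_subset_left) fun u _ => hU.fiber u
  refine h.congr ?_
  filter_upwards [hUS] with ω hω
  apply propext
  change (ω ∈ ⋃ u ∈ S ∩ s, {ω | U ω = u}) ↔ U ω ∈ s
  simp [hω]

lemma IsDiscrete.comp {U : Ω → α} (hU : IsDiscrete μ U) (g : α → β) :
    IsDiscrete μ (fun ω => g (U ω)) where
  fiber v := hU.nullMeasurableSet_preimage {u | g u = v}
  countable := by
    obtain ⟨S, hS, hUS⟩ := hU.countable
    exact ⟨g '' S, hS.image g, hUS.mono fun ω h => Set.mem_image_of_mem g h⟩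

lemma IsDiscrete.prodMk {U : Ω → α} {V : Ω → β} (hU : IsDiscrete μ U) (hV : IsDiscrete μ V) :
    IsDiscrete μ (fun ω => (U ω, V ω)) where
  fiber v := by
    have : {ω | (U ω, V ω) = v} = {ω | U ω = v.1} ∩ {ω | V ω = v.2} := by
      ext ω; simp [Prod.ext_iff]
    rw [this]
    exact (hU.fiber _).inter (hV.fiber _)
  countable := by
    obtain ⟨S, hS, hUS⟩ := hU.countable
    obtain ⟨T, hT, hVT⟩ := hV.countable
    refine ⟨S ×ˢ T, hS.prod hT, ?_⟩
    filter_upwards [hUS, hVT] with ω h1 h2 using ⟨h1, h2⟩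

lemma isDiscrete_of_countable [Countable α] {U : Ω → α}
    (h : ∀ u, NullMeasurableSet {ω | U ω = u} μ) : IsDiscrete μ U :=
  ⟨h, Set.univ, Set.countable_univ, by simp⟩

lemma isDiscrete_const (c : α) : IsDiscrete μ (fun _ : Ω => c) where
  fiber u := by by_cases h : c = u <;> simp [h]
  countable := ⟨{c}, Set.countable_singleton c, by simp⟩

lemma IsDiscrete.measure_eq_tsum {V : Ω → β} (hV : IsDiscrete μ V) {E : Set Ω}
    (hE : NullMeasurableSet E μ) : μ E = ∑' v, μ (E ∩ {ω | V ω = v}) := by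
  obtain ⟨S, hS, hVS⟩ := hV.countable
  have h1 : μ E = μ (⋃ v ∈ S, E ∩ {ω | V ω = v}) := by
    apply measure_congr
    filter_upwards [hVS] with ω hω
    apply propext
    change ω ∈ E ↔ ω ∈ ⋃ v ∈ S, E ∩ {ω | V ω = v}
    simp [hω]
  rw [h1, measure_biUnion₀ hS]
  · refine tsum_subtype_eq_of_support_subset (f := fun v => μ (E ∩ {ω | V ω = v})) ?_
    intro v hv
    by_contra hvS
    apply hv
    refine measure_mono_null (t := {ω | V ω ∉ S}) ?_ hVS
    rintro ω ⟨_, rfl⟩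
    exact hvS
  · intro v _ w _ hvw
    apply Disjoint.aedisjoint
    rw [Set.disjoint_left]
    rintro ω ⟨_, rfl⟩ ⟨_, rfl⟩
    exact hvw rfl
  · exact fun v _ => hE.inter (hV.fiber v)

lemma IsDiscrete.hasSum_real [IsFiniteMeasure μ] {V : Ω → β} (hV : IsDiscrete μ V) {E : Set Ω}
    (hE : NullMeasurableSet E μ) : HasSum (fun v => μ.real (E ∩ {ω | V ω = v})) (μ.real E) := by
  have h := hV.measure_eq_tsum hE
  have h2 := ENNReal.hasSum_toReal (f := fun v => μ (E ∩ {ω | V ω = v}))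
    (by rw [← h]; exact measure_ne_top μ E)
  rwa [← ENNReal.tsum_toReal_eq (fun v => measure_ne_top μ _), ← h] at h2

/-- Marginalization over the values of `V`. The event `q v` is prescribed only up to equivalence, so
that conjunctions in any order can be summed. -/
lemma IsDiscrete.hasSum_setOf [IsFiniteMeasure μ] {V : Ω → β} (hV : IsDiscrete μ V) {p : Ω → Prop}
    {q : β → Ω → Prop} (hp : NullMeasurableSet {ω | p ω} μ) (h : ∀ v ω, q v ω ↔ p ω ∧ V ω = v) :
    HasSum (fun v => μ.real {ω | q v ω}) (μ.real {ω | p ω}) := by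
  simp_rw [h]
  exact hV.hasSum_real hp

end Discrete

/-! ### Inequalities for sums of logarithms -/

section LogSum

/-- The tangent bound `log x ≤ x - 1` at `x = b / a / c`. The constant `c` is free: it becomes the
ratio of the totals in the log-sum inequality and the inverse of a trial probability in Gibbs'
inequality. -/
lemma mul_log_div_le {a b c : ℝ} (ha : 0 ≤ a) (hab : a ≤ b) (hc : 0 < c) :
    a * Real.log (b / a) ≤ a * Real.log c + b / c - a := by
  rcases ha.eq_or_lt with rfl | ha
  · simp; positivity
  · have hb : 0 < b := ha.trans_le hab
    have h := Real.log_le_sub_one_of_pos (show 0 < b / a / c by positivity)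
    rw [Real.log_div (by positivity) hc.ne'] at h
    have h2 := mul_le_mul_of_nonneg_left h ha.le
    have : a * (b / a / c - 1) = b / c - a := by field_simp
    linarith

lemma mul_logb_div_nonneg {a b : ℝ} (ha : 0 ≤ a) (hab : a ≤ b) : 0 ≤ a * Real.logb 2 (b / a) := by
  rcases ha.eq_or_lt with rfl | ha
  · simp
  · exact mul_nonneg ha.le (Real.logb_nonneg one_lt_two ((one_le_div ha).2 hab))

/-- The log-sum inequality. -/
lemma tsum_ofReal_mul_logb_div_le {ι : Type*} {a b : ι → ℝ} {A B : ℝ} (ha : ∀ i, 0 ≤ a i)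
    (hab : ∀ i, a i ≤ b i) (hA : HasSum a A) (hB : HasSum b B) :
    ∑' i, ENNReal.ofReal (a i * Real.logb 2 (b i / a i)) ≤
      ENNReal.ofReal (A * Real.logb 2 (B / A)) := by
  rcases (hA.nonneg ha).eq_or_lt with h0 | hA0
  · subst h0
    have : a = 0 := (hasSum_zero_iff_of_nonneg ha).1 hA
    simp [this]
  · have hAB : A ≤ B := hasSum_le hab hA hB
    have hB0 : 0 < B := hA0.trans_le hAB
    have hc : 0 < B / A := by positivity
    -- The tangent bound with `c = B / A`: the corrections `b i / (B / A) - a i` sum to zero.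
    set t : ι → ℝ := fun i => (a i * Real.log (B / A) + b i / (B / A) - a i) / Real.log 2
    have hl2 : 0 < Real.log 2 := Real.log_pos one_lt_two
    have hle : ∀ i, a i * Real.logb 2 (b i / a i) ≤ t i := fun i => by
      rw [Real.logb, ← mul_div_assoc]
      exact div_le_div_of_nonneg_right (mul_log_div_le (ha i) (hab i) hc) hl2.le
    have ht0 : ∀ i, 0 ≤ t i := fun i => (mul_logb_div_nonneg (ha i) (hab i)).trans (hle i)
    have hsum : HasSum t (A * Real.logb 2 (B / A)) := by
      have := ((((hA.mul_right (Real.log (B / A))).add (hB.div_const (B / A))).sub hA).div_const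
        (Real.log 2))
      have e : A * Real.logb 2 (B / A) =
          (A * Real.log (B / A) + B / (B / A) - A) / Real.log 2 := by
        rw [← Real.log_div_log, div_div_cancel₀ hB0.ne']
        ring
      rwa [e]
    calc ∑' i, ENNReal.ofReal (a i * Real.logb 2 (b i / a i)) ≤ ∑' i, ENNReal.ofReal (t i) :=
          ENNReal.tsum_le_tsum fun i => ENNReal.ofReal_le_ofReal (hle i)
      _ = ENNReal.ofReal (∑' i, t i) := (ENNReal.ofReal_tsum_of_nonneg ht0 hsum.summable).symm
      _ = _ := by rw [hsum.tsum_eq]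

lemma tsum_ofReal_mul_const {ι : Type*} {a : ι → ℝ} {A : ℝ} (ha : ∀ i, 0 ≤ a i) (hA : HasSum a A)
    {c : ℝ} (hc : 0 ≤ c) :
    ∑' i, ENNReal.ofReal (a i * c) = ENNReal.ofReal (A * c) := by
  rw [← ENNReal.ofReal_tsum_of_nonneg (fun i => mul_nonneg (ha i) hc) (hA.mul_right c).summable,
    (hA.mul_right c).tsum_eq]

end LogSum

/-! ### Conditional entropy -/

section CondEntropy

variable {Ω α β γ δ : Type*} [MeasurableSpace Ω] {μ : Measure Ω}

lemma condEntropy_congr {U U' : Ω → α} {V V' : Ω → β} (hU : U =ᵐ[μ] U') (hV : V =ᵐ[μ] V') :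
    condEntropy μ U V = condEntropy μ U' V' := by
  have h1 : ∀ v, μ.real {ω | V ω = v} = μ.real {ω | V' ω = v} := fun v => by
    apply measureReal_congr
    filter_upwards [hV] with ω h
    exact congrArg (· = v) h
  have h2 : ∀ u v, μ.real {ω | U ω = u ∧ V ω = v} = μ.real {ω | U' ω = u ∧ V' ω = v} :=
    fun u v => by
      apply measureReal_congr
      filter_upwards [hU, hV] with ω h h'
      change (U ω = u ∧ V ω = v) = (U' ω = u ∧ V' ω = v)
      rw [h, h']
  simp only [condEntropy, h1, h2]

lemma condEntropy_comp_injective_left {e : α → β} (he : Function.Injective e) (U : Ω → α)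
    (W : Ω → γ) : condEntropy μ (fun ω => e (U ω)) W = condEntropy μ U W := by
  unfold condEntropy
  rw [← he.tsum_eq]
  · simp only [he.eq_iff]
  · intro v hv
    by_contra h
    apply hv
    have : ∀ ω, e (U ω) ≠ v := fun ω h' => h ⟨_, h'⟩
    simp [this]

lemma condEntropy_comp_injective_right {e : α → β} (he : Function.Injective e) (V : Ω → γ)
    (U : Ω → α) : condEntropy μ V (fun ω => e (U ω)) = condEntropy μ V U := by
  unfold condEntropy
  refine tsum_congr fun v => ?_
  rw [← he.tsum_eq]
  · simp only [he.eq_iff]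
  · intro u hu
    by_contra h
    apply hu
    have : ∀ ω, e (U ω) ≠ u := fun ω h' => h ⟨_, h'⟩
    simp [this]

lemma entropy_ne_top_of_finite [Finite α] (U : Ω → α) : entropy μ U ≠ ∞ := by
  have := Fintype.ofFinite α
  rw [entropy, tsum_fintype]
  exact ENNReal.sum_ne_top.2 fun _ _ => ENNReal.ofReal_ne_top

variable [IsProbabilityMeasure μ]

lemma entropy_eq_condEntropy (U : Ω → α) : entropy μ U = condEntropy μ U (fun _ => ()) := by
  unfold entropy condEntropy
  refine tsum_congr fun u => ?_
  simp [Real.negMulLog, Real.logb, neg_div, mul_div_assoc]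

lemma real_inter_le (p q : Ω → Prop) : μ.real {ω | p ω ∧ q ω} ≤ μ.real {ω | q ω} :=
  measureReal_mono fun _ h => h.2

/-- The log-sum inequality over the values of `V`, for fixed values of `U` and `W`. -/
lemma condEntropy_prod_right_le {U : Ω → α} {V : Ω → β} {W : Ω → γ} (hU : IsDiscrete μ U)
    (hV : IsDiscrete μ V) (hW : IsDiscrete μ W) :
    condEntropy μ U (fun ω => (V ω, W ω)) ≤ condEntropy μ U W := by
  unfold condEntropy
  refine ENNReal.tsum_le_tsum fun u => ?_
  rw [ENNReal.tsum_prod', ENNReal.tsum_comm]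
  refine ENNReal.tsum_le_tsum fun w => ?_
  refine tsum_ofReal_mul_logb_div_le (fun _ => measureReal_nonneg)
    (fun _ => real_inter_le _ _) ?_ ?_
  · exact hV.hasSum_setOf ((hU.fiber u).inter (hW.fiber w)) fun _ _ => by grind
  · exact hV.hasSum_setOf (hW.fiber w) fun _ _ => by grind

/-- If `U` and `V` are conditionally independent given `W`, then `V` is irrelevant for the
conditional entropy of `U` given `V` and `W`. -/
lemma condEntropy_prod_right_eq {U : Ω → α} {V : Ω → β} {W : Ω → γ} (hU : IsDiscrete μ U)
    (hV : IsDiscrete μ V) (hW : IsDiscrete μ W)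
    (h : ∀ u v w, μ.real {ω | U ω = u ∧ V ω = v ∧ W ω = w} * μ.real {ω | W ω = w} =
      μ.real {ω | U ω = u ∧ W ω = w} * μ.real {ω | V ω = v ∧ W ω = w}) :
    condEntropy μ U (fun ω => (V ω, W ω)) = condEntropy μ U W := by
  unfold condEntropy
  refine tsum_congr fun u => ?_
  rw [ENNReal.tsum_prod', ENNReal.tsum_comm]
  refine tsum_congr fun w => ?_
  have hA : HasSum (fun v => μ.real {ω | U ω = u ∧ V ω = v ∧ W ω = w})
      (μ.real {ω | U ω = u ∧ W ω = w}) := by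
    exact hV.hasSum_setOf ((hU.fiber u).inter (hW.fiber w)) fun _ _ => by grind
  rcases (measureReal_nonneg (μ := μ) (s := {ω | U ω = u ∧ W ω = w})).eq_or_lt with h0 | h0
  · rw [← h0] at hA ⊢
    have := (hasSum_zero_iff_of_nonneg (fun _ => measureReal_nonneg)).1 hA
    have h1 : ∀ v, μ.real {ω | U ω = u ∧ V ω = v ∧ W ω = w} = 0 := fun v => congrFun this v
    simp [Prod.ext_iff, h1]
  · have hle := real_inter_le (μ := μ) (fun ω => U ω = u) (fun ω => W ω = w)
    rw [← tsum_ofReal_mul_const (fun _ => measureReal_nonneg) hA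
      (Real.logb_nonneg one_lt_two ((one_le_div h0).2 hle))]
    refine tsum_congr fun v => ?_
    congr 1
    simp only [Prod.mk.injEq]
    rcases (measureReal_nonneg (μ := μ) (s := {ω | U ω = u ∧ V ω = v ∧ W ω = w})).eq_or_lt
      with h1 | h1
    · simp [← h1]
    · congr 2
      rw [div_eq_div_iff h1.ne' h0.ne']
      linarith [h u v w]

lemma condEntropy_prod_left {U : Ω → α} {V : Ω → β} {W : Ω → γ} (hU : IsDiscrete μ U)
    (hV : IsDiscrete μ V) (hW : IsDiscrete μ W) :
    condEntropy μ (fun ω => (U ω, V ω)) W =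
      condEntropy μ V W + condEntropy μ U (fun ω => (V ω, W ω)) := by
  unfold condEntropy
  -- The terms of `H(V | W)` do not involve `u`. Spreading each of them over the values of `U`
  -- reduces the chain rule to a termwise identity in which logarithms add.
  have e1 : ∀ v w, ENNReal.ofReal (μ.real {ω | V ω = v ∧ W ω = w} *
      Real.logb 2 (μ.real {ω | W ω = w} / μ.real {ω | V ω = v ∧ W ω = w})) =
      ∑' u, ENNReal.ofReal (μ.real {ω | U ω = u ∧ V ω = v ∧ W ω = w} *
      Real.logb 2 (μ.real {ω | W ω = w} / μ.real {ω | V ω = v ∧ W ω = w})) := by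
    intro v w
    have hle := real_inter_le (μ := μ) (fun ω => V ω = v) (fun ω => W ω = w)
    have hA : HasSum (fun u => μ.real {ω | U ω = u ∧ V ω = v ∧ W ω = w})
      (μ.real {ω | V ω = v ∧ W ω = w}) := by
      exact hU.hasSum_setOf ((hV.fiber v).inter (hW.fiber w)) fun _ _ => by grind
    rcases (measureReal_nonneg (μ := μ) (s := {ω | V ω = v ∧ W ω = w})).eq_or_lt with h0 | h0
    · rw [← h0]; simp
    · rw [tsum_ofReal_mul_const (fun _ => measureReal_nonneg) hA
        (Real.logb_nonneg one_lt_two ((one_le_div h0).2 hle))]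
  simp_rw [e1]
  rw [ENNReal.tsum_prod']
  have e2 : ∀ f : β → γ → α → ℝ≥0∞, ∑' v, ∑' w, ∑' u, f v w u = ∑' u, ∑' v, ∑' w, f v w u := by
    intro f
    rw [ENNReal.tsum_comm]
    conv_rhs => rw [ENNReal.tsum_comm]
    rw [ENNReal.tsum_comm]
    refine tsum_congr fun v => ?_
    rw [ENNReal.tsum_comm]
  rw [e2]
  simp_rw [ENNReal.tsum_prod']
  rw [← ENNReal.tsum_add]
  refine tsum_congr fun u => ?_
  rw [← ENNReal.tsum_add]
  refine tsum_congr fun v => ?_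
  rw [← ENNReal.tsum_add]
  refine tsum_congr fun w => ?_
  have h12 := real_inter_le (μ := μ) (fun ω => U ω = u) (fun ω => V ω = v ∧ W ω = w)
  have h23 := real_inter_le (μ := μ) (fun ω => V ω = v) (fun ω => W ω = w)
  simp only [Prod.mk.injEq, and_assoc]
  rcases (measureReal_nonneg (μ := μ) (s := {ω | U ω = u ∧ V ω = v ∧ W ω = w})).eq_or_lt with h0 | h0
  · simp [← h0]
  · have h1 := h0.trans_le h12
    have h2 := h1.trans_le h23
    rw [← ENNReal.ofReal_add]
    · rw [← mul_add, ← Real.logb_mul (by positivity) (by positivity)]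
      congr 3
      field_simp
    · exact mul_nonneg h0.le (Real.logb_nonneg one_lt_two ((one_le_div h1).2 h23))
    · exact mul_logb_div_nonneg h0.le h12

lemma entropy_prod {U : Ω → α} {V : Ω → β} (hU : IsDiscrete μ U) (hV : IsDiscrete μ V) :
    entropy μ (fun ω => (U ω, V ω)) = entropy μ V + condEntropy μ U V := by
  rw [entropy_eq_condEntropy, entropy_eq_condEntropy,
    condEntropy_prod_left hU hV (isDiscrete_const ())]
  congr 1
  exact condEntropy_comp_injective_right (e := fun v : β => (v, ())) (fun _ _ h => by simpa using h) U V

/-- Conditioning on `V` amounts to conditioning on the pair of `V` and `g V`, from which `V` may be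
dropped. -/
lemma condEntropy_le_comp_right {U : Ω → α} {V : Ω → β} (hU : IsDiscrete μ U)
    (hV : IsDiscrete μ V) (g : β → γ) :
    condEntropy μ U V ≤ condEntropy μ U (fun ω => g (V ω)) := by
  rw [← condEntropy_comp_injective_right (e := fun v => (v, g v)) (fun _ _ h => (Prod.ext_iff.1 h).1)]
  exact condEntropy_prod_right_le hU hV (hV.comp g)

lemma condEntropy_comp_left_le {U : Ω → α} {W : Ω → β} (hU : IsDiscrete μ U)
    (hW : IsDiscrete μ W) (g : α → γ) :
    condEntropy μ (fun ω => g (U ω)) W ≤ condEntropy μ U W := by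
  rw [← condEntropy_comp_injective_left (e := fun v => (v, g v)) (fun _ _ h => (Prod.ext_iff.1 h).1) U]
  rw [condEntropy_prod_left hU (hU.comp g) hW]
  exact le_self_add

lemma condEntropy_le_entropy {U : Ω → α} {V : Ω → β} (hU : IsDiscrete μ U)
    (hV : IsDiscrete μ V) : condEntropy μ U V ≤ entropy μ U := by
  rw [entropy_eq_condEntropy]
  exact condEntropy_le_comp_right hU hV fun _ => ()

lemma entropy_comp_le {U : Ω → α} (hU : IsDiscrete μ U) (g : α → β) :
    entropy μ (fun ω => g (U ω)) ≤ entropy μ U := by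
  rw [entropy_eq_condEntropy, entropy_eq_condEntropy]
  exact condEntropy_comp_left_le hU (isDiscrete_const ()) g

end CondEntropy

/-! ### Real-valued entropy -/

section RealEntropy

variable {Ω α β γ δ : Type*} [MeasurableSpace Ω] {μ : Measure Ω}

/-- The entropy of a random variable of finite entropy, as a real number. -/
def ent (μ : Measure Ω) (U : Ω → α) : ℝ := (entropy μ U).toReal

/-- A discrete random variable of finite entropy. -/
structure FiniteEntropy (μ : Measure Ω) (U : Ω → α) : Prop where
  isDiscrete : IsDiscrete μ U
  ne_top : entropy μ U ≠ ∞

lemma IsDiscrete.finiteEntropy [Finite α] {U : Ω → α} (hU : IsDiscrete μ U) : FiniteEntropy μ U :=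
  ⟨hU, entropy_ne_top_of_finite U⟩

variable [IsProbabilityMeasure μ] {U : Ω → α} {V : Ω → β} {W : Ω → γ}

lemma FiniteEntropy.comp (hU : FiniteEntropy μ U) (g : α → β) :
    FiniteEntropy μ (fun ω => g (U ω)) :=
  ⟨hU.1.comp g, ((entropy_comp_le hU.1 g).trans_lt hU.2.lt_top).ne⟩

lemma FiniteEntropy.prodMk (hU : FiniteEntropy μ U) (hV : FiniteEntropy μ V) :
    FiniteEntropy μ (fun ω => (U ω, V ω)) := by
  refine ⟨hU.1.prodMk hV.1, ?_⟩
  rw [entropy_prod hU.1 hV.1]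
  exact ENNReal.add_ne_top.2 ⟨hV.2, ((condEntropy_le_entropy hU.1 hV.1).trans_lt hU.2.lt_top).ne⟩

lemma FiniteEntropy.condEntropy_ne_top (hU : FiniteEntropy μ U) (hV : IsDiscrete μ V) :
    condEntropy μ U V ≠ ∞ :=
  ((condEntropy_le_entropy hU.1 hV).trans_lt hU.2.lt_top).ne

lemma toReal_condEntropy (hU : FiniteEntropy μ U) (hV : FiniteEntropy μ V) :
    (condEntropy μ U V).toReal = ent μ (fun ω => (U ω, V ω)) - ent μ V := by
  rw [ent, entropy_prod hU.1 hV.1, ENNReal.toReal_add hV.2 (hU.condEntropy_ne_top hV.1), ent]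
  ring

lemma ent_comp_le (hU : FiniteEntropy μ U) (g : α → β) :
    ent μ (fun ω => g (U ω)) ≤ ent μ U :=
  ENNReal.toReal_mono hU.2 (entropy_comp_le hU.1 g)

lemma ent_le_of_comp (hU : FiniteEntropy μ U) (g : α → β) (h : ∀ ω, V ω = g (U ω)) :
    ent μ V ≤ ent μ U := by
  obtain rfl : V = fun ω => g (U ω) := funext h
  exact ent_comp_le hU g

/-- Two random variables which determine each other have the same entropy. -/
lemma ent_congr (hU : FiniteEntropy μ U) (g : α → β) (g' : β → α) (h : ∀ ω, V ω = g (U ω))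
    (h' : ∀ ω, U ω = g' (V ω)) : ent μ U = ent μ V := by
  obtain rfl : V = fun ω => g (U ω) := funext h
  exact (ent_le_of_comp (hU.comp g) g' h').antisymm (ent_comp_le hU g)

lemma ent_submodular (hU : FiniteEntropy μ U) (hV : FiniteEntropy μ V) (hW : FiniteEntropy μ W) :
    ent μ (fun ω => (U ω, V ω, W ω)) + ent μ W ≤
      ent μ (fun ω => (U ω, W ω)) + ent μ (fun ω => (V ω, W ω)) := by
  have h := ENNReal.toReal_mono (hU.condEntropy_ne_top hW.1)
    (condEntropy_prod_right_le hU.1 hV.1 hW.1)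
  rw [toReal_condEntropy hU (hV.prodMk hW), toReal_condEntropy hU hW] at h
  linarith

/-- Conditioning on a function of a random variable instead of the random variable itself does not
decrease the conditional entropy. -/
lemma ent_sub_le_of_comp (hU : FiniteEntropy μ U) (hV : FiniteEntropy μ V) (g : β → γ)
    (h : ∀ ω, W ω = g (V ω)) :
    ent μ (fun ω => (U ω, V ω)) - ent μ V ≤ ent μ (fun ω => (U ω, W ω)) - ent μ W := by
  obtain rfl : W = fun ω => g (V ω) := funext h
  rw [← toReal_condEntropy hU hV, ← toReal_condEntropy hU (hV.comp g)]
  exact ENNReal.toReal_mono (hU.condEntropy_ne_top (hV.comp g).1)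
    (condEntropy_le_comp_right hU.1 hV.1 g)

lemma ent_prod_le (hU : FiniteEntropy μ U) (hV : FiniteEntropy μ V) :
    ent μ (fun ω => (U ω, V ω)) ≤ ent μ U + ent μ V := by
  have h := ENNReal.toReal_mono hU.2 (condEntropy_le_entropy hU.1 hV.1)
  rw [toReal_condEntropy hU hV] at h
  change _ ≤ ent μ U at h
  linarith

/-- The joint law of `U`, `V`, `W` factorizes into a function of `U` and `W` and a function of `V`
and `W`. -/
def Factorizes (μ : Measure Ω) (U : Ω → α) (V : Ω → β) (W : Ω → γ) : Prop :=
  ∃ a : α → γ → ℝ, ∃ b : β → γ → ℝ,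
    ∀ u v w, μ.real {ω | U ω = u ∧ V ω = v ∧ W ω = w} = a u w * b v w

lemma Factorizes.condIndep (h : Factorizes μ U V W) (hU : IsDiscrete μ U) (hV : IsDiscrete μ V)
    (hW : IsDiscrete μ W) (u : α) (v : β) (w : γ) :
    μ.real {ω | U ω = u ∧ V ω = v ∧ W ω = w} * μ.real {ω | W ω = w} =
      μ.real {ω | U ω = u ∧ W ω = w} * μ.real {ω | V ω = v ∧ W ω = w} := by
  obtain ⟨a, b, hab⟩ := h
  have hUW : ∀ u, HasSum (fun v => a u w * b v w) (μ.real {ω | U ω = u ∧ W ω = w}) := fun u => by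
    simp_rw [← hab]
    exact hV.hasSum_setOf ((hU.fiber u).inter (hW.fiber w)) fun _ _ => by grind
  have hVW : ∀ v, HasSum (fun u => a u w * b v w) (μ.real {ω | V ω = v ∧ W ω = w}) := fun v => by
    simp_rw [← hab]
    exact hU.hasSum_setOf ((hV.fiber v).inter (hW.fiber w)) fun _ _ => by grind
  have hWW : HasSum (fun u => μ.real {ω | U ω = u ∧ W ω = w}) (μ.real {ω | W ω = w}) := by
    exact hU.hasSum_setOf (hW.fiber w) fun _ _ => by grind
  rw [hab]
  -- Nothing is known about the summability of `a` and `b`. A nonzero `a u w` forces `b · w` to be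
  -- summable; if `a u w = 0`, both sides vanish whatever the value of the series.
  have h1 : ∀ u, μ.real {ω | U ω = u ∧ W ω = w} * b v w = a u w * b v w * ∑' v, b v w := by
    intro u
    have hu := hUW u
    by_cases ha : a u w = 0
    · simp only [ha, zero_mul] at hu
      simp [hu.unique hasSum_zero, ha]
    · have h2 : Summable fun v => b v w := (summable_mul_left_iff ha).1 hu.summable
      rw [hu.unique (h2.hasSum.mul_left _)]
      ring
  have hv := hVW v
  by_cases hb : b v w = 0
  · simp only [hb, mul_zero] at hv
    simp [hv.unique hasSum_zero, hb]
  · have h2 : Summable fun u => a u w := (summable_mul_right_iff hb).1 hv.summable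
    rw [hv.unique (h2.hasSum.mul_right _)]
    have h3 : HasSum (fun u => μ.real {ω | U ω = u ∧ W ω = w} * b v w)
        (μ.real {ω | W ω = w} * b v w) := hWW.mul_right _
    simp_rw [h1] at h3
    have h5 := h3.unique ((h2.hasSum.mul_right (b v w)).mul_right (∑' v, b v w))
    calc a u w * b v w * μ.real {ω | W ω = w} = a u w * (μ.real {ω | W ω = w} * b v w) := by ring
      _ = (a u w * b v w * ∑' v, b v w) * ∑' u, a u w := by rw [h5]; ring
      _ = (μ.real {ω | U ω = u ∧ W ω = w} * b v w) * ∑' u, a u w := by rw [h1]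
      _ = _ := by ring

lemma Factorizes.condEntropy_eq (h : Factorizes μ U V W) (hU : IsDiscrete μ U)
    (hV : IsDiscrete μ V) (hW : IsDiscrete μ W) :
    condEntropy μ U (fun ω => (V ω, W ω)) = condEntropy μ U W :=
  condEntropy_prod_right_eq hU hV hW (h.condIndep hU hV hW)

lemma Factorizes.ent_eq (h : Factorizes μ U V W) (hU : FiniteEntropy μ U)
    (hV : FiniteEntropy μ V) (hW : FiniteEntropy μ W) :
    ent μ (fun ω => (U ω, V ω, W ω)) + ent μ W =
      ent μ (fun ω => (U ω, W ω)) + ent μ (fun ω => (V ω, W ω)) := by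
  have h := congrArg ENNReal.toReal (h.condEntropy_eq hU.1 hV.1 hW.1)
  rw [toReal_condEntropy hU (hV.prodMk hW), toReal_condEntropy hU hW] at h
  linarith

end RealEntropy

end

end SecureComp

namespace SecureComp

noncomputable section

/-! ### Cross entropy, Fano's inequality, and the length of prefix-free codes -/

section CrossEntropy

/-- Gibbs' inequality. -/
lemma tsum_ofReal_mul_logb_div_le_cross {ι : Type*} {a q : ι → ℝ} {B : ℝ} (ha : ∀ i, 0 ≤ a i)
    (hB : HasSum a B) (hq : ∀ i, 0 ≤ q i) (hq1 : ∀ i, q i ≤ 1) (haq : ∀ i, 0 < a i → 0 < q i)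
    (hsum : ∑' i, ENNReal.ofReal (q i) ≤ 1) :
    ∑' i, ENNReal.ofReal (a i * Real.logb 2 (B / a i)) ≤
      ∑' i, ENNReal.ofReal (a i * Real.logb 2 (1 / q i)) := by
  have hl2 : 0 < Real.log 2 := Real.log_pos one_lt_two
  have hB0 : 0 ≤ B := hB.nonneg ha
  have haB : ∀ i, a i ≤ B := fun i => le_hasSum hB i fun j _ => ha j
  -- The tangent bound with `c = 1 / q i`. The term `a i / log 2` is carried on the left and
  -- cancelled after summation, since the right-hand side may be infinite and subtraction is
  -- truncated.
  have key : ∀ i, ENNReal.ofReal (a i * Real.logb 2 (B / a i)) +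
      ENNReal.ofReal (a i * (1 / Real.log 2)) ≤
      ENNReal.ofReal (a i * Real.logb 2 (1 / q i)) +
        ENNReal.ofReal (q i) * ENNReal.ofReal (B / Real.log 2) := by
    intro i
    have hlog : 0 ≤ a i * Real.logb 2 (1 / q i) := by
      rcases (ha i).eq_or_lt with h | h
      · simp [← h]
      · exact mul_nonneg h.le
          (Real.logb_nonneg one_lt_two ((one_le_div (haq i h)).2 (hq1 i)))
    rw [← ENNReal.ofReal_add (mul_logb_div_nonneg (ha i) (haB i)) (mul_nonneg (ha i) (by positivity)),
      ← ENNReal.ofReal_mul (hq i), ← ENNReal.ofReal_add hlog (mul_nonneg (hq i) (by positivity))]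
    apply ENNReal.ofReal_le_ofReal
    rcases (ha i).eq_or_lt with h | h
    · rw [← h]
      have := hq i
      simp only [zero_mul, zero_add]
      positivity
    · have h1 := mul_log_div_le (ha i) (haB i) (c := 1 / q i) (one_div_pos.2 (haq i h))
      rw [← Real.log_div_log, ← Real.log_div_log, ← sub_nonneg]
      have e : a i * (Real.log (1 / q i) / Real.log 2) + q i * (B / Real.log 2) -
          (a i * (Real.log (B / a i) / Real.log 2) + a i * (1 / Real.log 2)) =
          (a i * Real.log (1 / q i) + B / (1 / q i) - a i - a i * Real.log (B / a i)) /
            Real.log 2 := by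
        have := (haq i h).ne'
        field_simp
        ring
      rw [e]
      exact div_nonneg (by linarith) hl2.le
  have h := ENNReal.tsum_le_tsum key
  rw [ENNReal.tsum_add, ENNReal.tsum_add, ENNReal.tsum_mul_right,
    tsum_ofReal_mul_const ha hB (by positivity), mul_one_div] at h
  have h2 := h.trans (add_le_add_right (mul_le_of_le_one_left zero_le hsum) _)
  exact (ENNReal.add_le_add_iff_right ENNReal.ofReal_ne_top).1 h2

variable {Ω α β ζ : Type*} [MeasurableSpace Ω] {μ : Measure Ω} [IsProbabilityMeasure μ]

/-- Gibbs' inequality for each value of `W`: `q · w` is a guess, possibly of mass less than 1, for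
the conditional law of `U`. Both Fano's inequality and the bound for code lengths come from a choice
of `q`. -/
lemma condEntropy_le_cross {U : Ω → α} {W : Ω → β} (hU : IsDiscrete μ U) (hW : IsDiscrete μ W)
    (q : α → β → ℝ) (hq : ∀ u w, 0 ≤ q u w) (hq1 : ∀ u w, q u w ≤ 1)
    (hpos : ∀ u w, 0 < μ.real {ω | U ω = u ∧ W ω = w} → 0 < q u w)
    (hsum : ∀ w, ∑' u, ENNReal.ofReal (q u w) ≤ 1) :
    condEntropy μ U W ≤ ∑' u, ∑' w,
      ENNReal.ofReal (μ.real {ω | U ω = u ∧ W ω = w} * Real.logb 2 (1 / q u w)) := by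
  unfold condEntropy
  rw [ENNReal.tsum_comm]
  conv_rhs => rw [ENNReal.tsum_comm]
  refine ENNReal.tsum_le_tsum fun w => ?_
  exact tsum_ofReal_mul_logb_div_le_cross (fun _ => measureReal_nonneg)
    (hU.hasSum_setOf (hW.fiber w) fun _ _ => by grind) (fun u => hq u w) (fun u => hq1 u w)
    (fun u => hpos u w) (hsum w)

/-- Fano's inequality, with a free parameter `s` in place of the probability of error. -/
lemma fano [Fintype ζ] {Z Z' : Ω → ζ} (hZ : IsDiscrete μ Z) (hZ' : IsDiscrete μ Z') {s : ℝ}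
    (hs0 : 0 < s) (hs1 : s < 1) :
    condEntropy μ Z Z' ≤ ENNReal.ofReal (Real.logb 2 (1 / (1 - s)) +
      μ.real {ω | Z' ω ≠ Z ω} * Real.logb 2 (Fintype.card ζ / s)) := by
  classical
  rcases isEmpty_or_nonempty ζ with hζ | hζ
  · simp [condEntropy]
  have hN : (1 : ℝ) ≤ Fintype.card ζ := by exact_mod_cast Fintype.card_pos
  -- The guess for `Z` given `Z'`: the value `Z'` with weight `1 - s`, every other value with weight
  -- `s / |ζ|`.
  set q : ζ → ζ → ℝ := fun z z' => if z = z' then 1 - s else s / Fintype.card ζ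
  have hq : ∀ z z', 0 < q z z' := fun z z' => by
    simp only [q]; split_ifs
    · linarith
    · positivity
  have h := condEntropy_le_cross hZ hZ' q (fun z z' => (hq z z').le)
    (fun z z' => by
      simp only [q]; split_ifs
      · linarith
      · rw [div_le_one (by positivity)]; linarith)
    (fun z z' _ => hq z z')
    (fun z' => by
      rw [tsum_fintype, ← ENNReal.ofReal_sum_of_nonneg fun z _ => (hq z z').le]
      rw [← ENNReal.ofReal_one]
      apply ENNReal.ofReal_le_ofReal
      calc ∑ z, q z z' ≤ ∑ z, ((if z = z' then 1 - s else 0) + s / Fintype.card ζ) := by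
            apply Finset.sum_le_sum
            intro z _
            simp only [q]; split_ifs
            · have : 0 ≤ s / Fintype.card ζ := by positivity
              linarith
            · simp
        _ = 1 := by
            rw [Finset.sum_add_distrib]
            simp
            field_simp
            ring)
  refine h.trans ?_
  have e1 : ∑' z, ∑' z', ENNReal.ofReal (μ.real {ω | Z ω = z ∧ Z' ω = z'} *
      Real.logb 2 (1 / q z z')) = ENNReal.ofReal (∑ z, ∑ z', μ.real {ω | Z ω = z ∧ Z' ω = z'} *
      Real.logb 2 (1 / q z z')) := by
    have hnn : ∀ z z', 0 ≤ μ.real {ω | Z ω = z ∧ Z' ω = z'} * Real.logb 2 (1 / q z z') := by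
      intro z z'
      refine mul_nonneg measureReal_nonneg (Real.logb_nonneg one_lt_two ((one_le_div (hq _ _)).2 ?_))
      simp only [q]; split_ifs
      · linarith
      · rw [div_le_one (by positivity)]; linarith
    rw [tsum_fintype, ENNReal.ofReal_sum_of_nonneg fun z _ => Finset.sum_nonneg fun z' _ => hnn z z']
    refine Finset.sum_congr rfl fun z _ => ?_
    rw [tsum_fintype, ENNReal.ofReal_sum_of_nonneg fun z' _ => hnn z z']
  rw [e1]
  apply ENNReal.ofReal_le_ofReal
  -- Each atom lies entirely in the event of correctness, with cost `log (1 / (1 - s))`, or entirely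
  -- in the event of error, with cost `log (|ζ| / s)`.
  have e2 : ∀ z z', μ.real {ω | Z ω = z ∧ Z' ω = z'} * Real.logb 2 (1 / q z z') =
      μ.real {ω | (Z ω = z ∧ Z' ω = z') ∧ Z' ω = Z ω} * Real.logb 2 (1 / (1 - s)) +
      μ.real {ω | (Z ω = z ∧ Z' ω = z') ∧ Z' ω ≠ Z ω} * Real.logb 2 (Fintype.card ζ / s) := by
    intro z z'
    by_cases hzz : z = z'
    · subst hzz
      have a1 : {ω | (Z ω = z ∧ Z' ω = z) ∧ Z' ω = Z ω} = {ω | Z ω = z ∧ Z' ω = z} := by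
        ext ω; simp; grind
      have a2 : {ω | (Z ω = z ∧ Z' ω = z) ∧ Z' ω ≠ Z ω} = ∅ := by
        ext ω; simp; grind
      rw [a1, a2]; simp [q]
    · have a1 : {ω | (Z ω = z ∧ Z' ω = z') ∧ Z' ω ≠ Z ω} = {ω | Z ω = z ∧ Z' ω = z'} := by
        ext ω; simp; grind
      have a2 : {ω | (Z ω = z ∧ Z' ω = z') ∧ Z' ω = Z ω} = ∅ := by
        ext ω; simp; grind
      rw [a1, a2]; simp [q, hzz]
  have e3 : ∀ p : ζ → ζ → Prop, ∑ z, ∑ z', μ.real {ω | (Z ω = z ∧ Z' ω = z') ∧ p (Z ω) (Z' ω)} =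
      μ.real {ω | p (Z ω) (Z' ω)} := by
    intro p
    have hd := hZ.prodMk hZ'
    have hp : NullMeasurableSet {ω | p (Z ω) (Z' ω)} μ :=
      hd.nullMeasurableSet_preimage {x | p x.1 x.2}
    have := hd.hasSum_setOf (q := fun x ω => (Z ω = x.1 ∧ Z' ω = x.2) ∧ p (Z ω) (Z' ω)) hp
      (fun v ω => by simp [Prod.ext_iff]; tauto)
    rw [← Fintype.sum_prod_type']
    exact (hasSum_fintype _).unique this
  simp_rw [e2, Finset.sum_add_distrib, ← Finset.sum_mul]
  rw [e3 (fun z z' => z' = z), e3 (fun z z' => z' ≠ z)]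
  have h1 : 0 ≤ Real.logb 2 (1 / (1 - s)) :=
    Real.logb_nonneg one_lt_two ((one_le_div (by linarith)).2 (by linarith))
  have h2 : μ.real {ω | Z' ω = Z ω} ≤ 1 := measureReal_le_one
  have := mul_le_mul_of_nonneg_right h2 h1
  linarith

end CrossEntropy

/-! ### Prefix-free codes: Kraft's inequality and expected length -/

section Kraft

/-- The first words of two equal concatenations are prefixes of one string, so one is a prefix of
the other and they agree. The empty word has to be excluded because it can be inserted anywhere. -/
lemma PrefixFree.uniquelyDecodable {C : Set Msg} (hC : PrefixFree C) (h0 : [] ∉ C) :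
    InformationTheory.UniquelyDecodable C := by
  intro L₁
  induction L₁ with
  | nil =>
    intro L₂ _ h2 h
    cases L₂ with
    | nil => rfl
    | cons w L =>
      exfalso
      have hw := h2 w (by simp)
      simp only [List.flatten_nil, List.flatten_cons] at h
      have := (List.append_eq_nil_iff.1 h.symm).1
      exact h0 (this ▸ hw)
  | cons w L ih =>
    intro L₂ h1 h2 h
    cases L₂ with
    | nil =>
      exfalso
      simp only [List.flatten_nil, List.flatten_cons] at h
      exact h0 ((List.append_eq_nil_iff.1 h).1 ▸ h1 w (by simp))
    | cons w' L' =>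
      simp only [List.flatten_cons] at h
      have hw : w = w' := by
        rcases List.prefix_or_prefix_of_prefix (List.prefix_append w L.flatten)
          (h ▸ List.prefix_append w' L'.flatten) with hp | hp
        · exact hC _ (h1 w (by simp)) _ (h2 w' (by simp)) hp
        · exact (hC _ (h2 w' (by simp)) _ (h1 w (by simp)) hp).symm
      subst hw
      rw [ih L' (fun x hx => h1 x (by simp [hx])) (fun x hx => h2 x (by simp [hx]))
        (List.append_cancel_left h)]

/-- Kraft's inequality. -/
lemma PrefixFree.kraft {C : Set Msg} (hC : PrefixFree C) :
    ∑' w, C.indicator (fun w => (2⁻¹ : ℝ≥0∞) ^ w.length) w ≤ 1 := by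
  classical
  -- A prefix-free code that contains the empty word contains nothing else; the other codes are
  -- uniquely decodable and obey McMillan's inequality.
  by_cases h0 : [] ∈ C
  · have hC' : ∀ w ∈ C, w = [] := fun w hw => (hC _ h0 _ hw (List.nil_prefix)).symm
    rw [tsum_eq_single []]
    · simp [h0]
    · intro w hw
      exact Set.indicator_of_notMem (fun h => hw (hC' w h)) _
  · rw [ENNReal.tsum_eq_iSup_sum]
    refine iSup_le fun S => ?_
    have hud : InformationTheory.UniquelyDecodable ((S.filter (· ∈ C) : Finset Msg) : Set Msg) := by
      have := hC.uniquelyDecodable h0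
      intro L₁ L₂ h1 h2
      exact this L₁ L₂ (fun w hw => (Finset.mem_filter.1 (h1 w hw)).2)
        (fun w hw => (Finset.mem_filter.1 (h2 w hw)).2)
    have hk := InformationTheory.kraft_mcmillan_inequality hud
    have e : ∑ w ∈ S, C.indicator (fun w => (2⁻¹ : ℝ≥0∞) ^ w.length) w =
        ENNReal.ofReal (∑ w ∈ S.filter (· ∈ C), (1 / Fintype.card Bool : ℝ) ^ w.length) := by
      rw [ENNReal.ofReal_sum_of_nonneg (fun _ _ => by positivity), Finset.sum_filter]
      refine Finset.sum_congr rfl fun w _ => ?_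
      rw [Set.indicator_apply]
      refine if_congr Iff.rfl ?_ rfl
      rw [ENNReal.ofReal_pow (by positivity)]
      simp [ENNReal.ofReal_inv_of_pos]
    rw [e, ← ENNReal.ofReal_one]
    exact ENNReal.ofReal_le_ofReal hk

variable {Ω α β : Type*} [MeasurableSpace Ω] {μ : Measure Ω}

lemma lintegral_comp_eq_tsum [Countable α] {U : Ω → α} (hU : IsDiscrete μ U) (f : α → ℝ≥0∞) :
    ∫⁻ ω, f (U ω) ∂μ = ∑' u, f u * μ {ω | U ω = u} := by
  have e : ∀ ω, f (U ω) = ∑' u, {ω | U ω = u}.indicator (fun _ => f u) ω := by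
    intro ω
    rw [tsum_eq_single (U ω)]
    · simp
    · intro u hu
      exact Set.indicator_of_notMem (fun h => hu h.symm) _
  simp_rw [e]
  rw [lintegral_tsum fun u => aemeasurable_const.indicator₀ (hU.fiber u)]
  refine tsum_congr fun u => ?_
  rw [lintegral_indicator_const₀ (hU.fiber u)]

lemma IsDiscrete.aemeasurable_comp [Countable α] {U : Ω → α} (hU : IsDiscrete μ U)
    (f : α → ℝ≥0∞) : AEMeasurable (fun ω => f (U ω)) μ := by
  have e : (fun ω => f (U ω)) = fun ω => ∑' u, {ω | U ω = u}.indicator (fun _ => f u) ω := by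
    funext ω
    rw [tsum_eq_single (U ω)]
    · simp
    · intro u hu
      exact Set.indicator_of_notMem (fun h => hu h.symm) _
  rw [e]
  exact AEMeasurable.tsum fun u => aemeasurable_const.indicator₀ (hU.fiber u)

variable [IsProbabilityMeasure μ]

/-- The expected length of a pair of codewords, taken from prefix-free codes determined by `W`, is
at least the conditional entropy given `W`. -/
lemma condEntropy_le_lintegral_length {U : Ω → LinkRound} {W : Ω → β} (hU : IsDiscrete μ U)
    (hW : IsDiscrete μ W) (C : β → Set Msg × Set Msg)
    (hC : ∀ w, PrefixFree (C w).1 ∧ PrefixFree (C w).2)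
    (hmem : ∀ᵐ ω ∂μ, U ω ∈ (C (W ω)).1 ×ˢ (C (W ω)).2) :
    condEntropy μ U W ≤ ∫⁻ ω, (((U ω).1.length + (U ω).2.length : ℕ) : ℝ≥0∞) ∂μ := by
  classical
  set k : LinkRound → ℕ := fun u => u.1.length + u.2.length
  -- The guess `2 ^ (-length)` on the pairs of codewords: its mass is a product of two Kraft sums,
  -- and its cost is the number of bits.
  set q : LinkRound → β → ℝ := fun u w =>
    if u ∈ (C w).1 ×ˢ (C w).2 then (2⁻¹ : ℝ) ^ k u else 0
  have hqp : ∀ u w, 0 < μ.real {ω | U ω = u ∧ W ω = w} → u ∈ (C w).1 ×ˢ (C w).2 := by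
    intro u w h
    by_contra hu
    refine h.ne' ?_
    rw [measureReal_eq_zero_iff]
    refine measure_mono_null ?_ hmem
    rintro ω ⟨rfl, rfl⟩
    exact hu
  have h := condEntropy_le_cross hU hW q (fun u w => by simp only [q]; split_ifs <;> positivity)
    (fun u w => by
      simp only [q]; split_ifs
      · exact pow_le_one₀ (by positivity) (by norm_num)
      · norm_num)
    (fun u w h => by
      simp only [q, if_pos (hqp u w h)]; positivity)
    (fun w => by
      have e : ∀ u, ENNReal.ofReal (q u w) =
          (C w).1.indicator (fun w => (2⁻¹ : ℝ≥0∞) ^ w.length) u.1 *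
          (C w).2.indicator (fun w => (2⁻¹ : ℝ≥0∞) ^ w.length) u.2 := by
        intro u
        by_cases h1 : u.1 ∈ (C w).1
        · by_cases h2 : u.2 ∈ (C w).2
          · have h3 : u ∈ (C w).1 ×ˢ (C w).2 := ⟨h1, h2⟩
            simp only [q, if_pos h3, Set.indicator_of_mem h1, Set.indicator_of_mem h2, k]
            rw [ENNReal.ofReal_pow (by positivity), ENNReal.ofReal_inv_of_pos two_pos, pow_add]
            simp
          · simp [q, h2, Set.mem_prod]
        · simp [q, h1, Set.mem_prod]
      simp_rw [e]
      rw [ENNReal.tsum_prod']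
      simp only [ENNReal.tsum_mul_left]
      rw [ENNReal.tsum_mul_right]
      exact mul_le_one' (hC w).1.kraft (hC w).2.kraft)
  refine h.trans ?_
  rw [lintegral_comp_eq_tsum hU (fun u => ((u.1.length + u.2.length : ℕ) : ℝ≥0∞))]
  refine ENNReal.tsum_le_tsum fun u => ?_
  rw [hW.measure_eq_tsum (hU.fiber u), ← ENNReal.tsum_mul_left]
  refine ENNReal.tsum_le_tsum fun w => ?_
  by_cases h0 : 0 < μ.real {ω | U ω = u ∧ W ω = w}
  · simp only [q, if_pos (hqp u w h0)]
    rw [inv_pow, one_div, inv_inv, Real.logb_pow, Real.logb_self_eq_one one_lt_two, mul_one,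
      mul_comm, ENNReal.ofReal_mul (by positivity), ENNReal.ofReal_natCast, ofReal_measureReal]
    rfl
  · have : μ.real {ω | U ω = u ∧ W ω = w} = 0 :=
      le_antisymm (not_lt.1 h0) measureReal_nonneg
    simp [this]

end Kraft

end

end SecureComp

namespace SecureComp

noncomputable section

/-! ### A random variable which is nearly independent of `s` given `f s` and given `g s` -/

section Divergence

/-- From `log t ≤ t - 1` at `t = √y / √x`. Summed over two measures of equal mass, it bounds the
squared Hellinger distance by the divergence, which yields pointwise control of densities. -/
lemma sq_sqrt_sub_sqrt_le {x y : ℝ} (hx : 0 ≤ x) (hy : 0 ≤ y) (h : y = 0 → x = 0) :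
    (√x - √y) ^ 2 ≤ x * Real.log (x / y) - x + y := by
  rcases hx.eq_or_lt with rfl | hx
  · simp [Real.sq_sqrt hy]
  have hy : 0 < y := lt_of_le_of_ne hy fun h' => hx.ne' (h h'.symm)
  have hsx := Real.sqrt_pos.2 hx
  have hsy := Real.sqrt_pos.2 hy
  have h1 := Real.log_le_sub_one_of_pos (div_pos hsy hsx)
  have h2 : Real.log (x / y) = -2 * Real.log (√y / √x) := by
    rw [Real.log_div hsy.ne' hsx.ne', Real.log_sqrt hy.le, Real.log_sqrt hx.le,
      Real.log_div hx.ne' hy.ne']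
    ring
  rw [h2]
  have ex := Real.sq_sqrt hx.le
  have ey := Real.sq_sqrt hy.le
  have h3 : x * (√y / √x) = √x * √y := by
    nth_rewrite 1 [← ex]
    field_simp
  have h4 := mul_le_mul_of_nonneg_left h1 hx.le
  nlinarith

variable {ι κ : Type*} [Fintype ι] [DecidableEq κ]

/-- The divergence of the measure `r` from `p`, for unnormalized `r`. -/
def divergence (p r : ι → ℝ) : ℝ := ∑ i, r i * Real.log (r i / ((∑ j, r j) * p i))

/-- The image of a measure on a finite set. -/
def push (f : ι → κ) (r : ι → ℝ) (k : κ) : ℝ := ∑ i with f i = k, r i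

lemma push_nonneg {f : ι → κ} {r : ι → ℝ} (hr : ∀ i, 0 ≤ r i) (k : κ) : 0 ≤ push f r k :=
  Finset.sum_nonneg fun i _ => hr i

lemma le_push {f : ι → κ} {r : ι → ℝ} (hr : ∀ i, 0 ≤ r i) (i : ι) : r i ≤ push f r (f i) :=
  Finset.single_le_sum (f := r) (fun i _ => hr i) (by simp)

lemma sum_push_mul [Fintype κ] (f : ι → κ) (r : ι → ℝ) (c : κ → ℝ) :
    ∑ k, push f r k * c k = ∑ i, r i * c (f i) := by
  rw [← Finset.sum_fiberwise Finset.univ f]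
  refine Finset.sum_congr rfl fun k _ => ?_
  rw [push, Finset.sum_mul]
  refine Finset.sum_congr rfl fun i hi => ?_
  rw [(Finset.mem_filter.1 hi).2]

lemma sum_push [Fintype κ] (f : ι → κ) (r : ι → ℝ) : ∑ k, push f r k = ∑ i, r i := by
  simpa using sum_push_mul f r fun _ => 1

/-- The density of the image of `r` with respect to the image of `p`. -/
def density (f : ι → κ) (p r : ι → ℝ) (i : ι) : ℝ := push f r (f i) / push f p (f i)

lemma density_nonneg {f : ι → κ} {p r : ι → ℝ} (hp : ∀ i, 0 < p i) (hr : ∀ i, 0 ≤ r i) (i : ι) :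
    0 ≤ density f p r i :=
  div_nonneg (push_nonneg hr _) (push_nonneg (fun i => (hp i).le) _)

lemma push_pos {f : ι → κ} {p : ι → ℝ} (hp : ∀ i, 0 < p i) (i : ι) : 0 < push f p (f i) :=
  (hp i).trans_le (le_push (fun i => (hp i).le) i)

/-- The measure `p * density f p r` has the same image under `f` as `r`, while inside each fibre it
is proportional to `p`. -/
lemma sum_mul_density [Fintype κ] {f : ι → κ} {p r : ι → ℝ} (hp : ∀ i, 0 < p i) (c : κ → ℝ) :
    ∑ i, p i * density f p r i * c (f i) = ∑ i, r i * c (f i) := by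
  rw [← sum_push_mul f r c]
  have := sum_push_mul f p fun k => push f r k / push f p k * c k
  simp only [density, mul_assoc] at this ⊢
  rw [← this]
  refine Finset.sum_congr rfl fun k _ => ?_
  by_cases hk : push f p k = 0
  · have : push f r k = 0 := by
      unfold push
      refine Finset.sum_eq_zero fun i hi => ?_
      have hki := (Finset.mem_filter.1 hi).2
      exact absurd hk (hki ▸ (push_pos hp i).ne')
    simp [hk, this]
  · field_simp

lemma divergence_push [Fintype κ] (f : ι → κ) (p r : ι → ℝ) :
    divergence (push f p) (push f r) = ∑ i, r i * Real.log (density f p r i / ∑ j, r j) := by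
  rw [divergence, sum_push_mul f r fun k => Real.log (push f r k / ((∑ j, push f r j) * push f p k)),
    sum_push]
  refine Finset.sum_congr rfl fun i _ => ?_
  rw [density, div_div, mul_comm (∑ j, r j)]

/-- By the chain rule the loss of divergence under `f` is `∑ r log (r / (p * density))`. The two
measures have equal mass, so this dominates their squared Hellinger distance. -/
lemma divergence_sub_push [Fintype κ] {f : ι → κ} {p r : ι → ℝ} (hp : ∀ i, 0 < p i)
    (hr : ∀ i, 0 ≤ r i) :
    ∑ i, (√(r i) - √(p i * density f p r i)) ^ 2 ≤
      divergence p r - divergence (push f p) (push f r) := by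
  have h1 : ∀ i, (√(r i) - √(p i * density f p r i)) ^ 2 ≤
      r i * Real.log (r i / (p i * density f p r i)) - r i + p i * density f p r i := fun i => by
    refine sq_sqrt_sub_sqrt_le (hr i) (mul_nonneg (hp i).le (density_nonneg hp hr i)) fun h => ?_
    rcases mul_eq_zero.1 h with h | h
    · exact absurd h (hp i).ne'
    · rw [density, div_eq_zero_iff] at h
      rcases h with h | h
      · exact le_antisymm (h ▸ le_push hr i) (hr i)
      · exact absurd h (push_pos hp i).ne'
  refine (Finset.sum_le_sum fun i _ => h1 i).trans_eq ?_
  rw [divergence_push, divergence, Finset.sum_add_distrib, Finset.sum_sub_distrib]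
  have h2 := sum_mul_density (f := f) (r := r) hp fun _ => 1
  simp only [mul_one] at h2
  rw [h2, sub_add_cancel, ← Finset.sum_sub_distrib]
  refine Finset.sum_congr rfl fun i _ => ?_
  rcases (hr i).eq_or_lt with h0 | h0
  · simp [← h0]
  · have hd : 0 < density f p r i := div_pos (h0.trans_le (le_push hr i)) (push_pos hp i)
    have hs : 0 < ∑ j, r j := h0.trans_le (Finset.single_le_sum (fun j _ => hr j) (Finset.mem_univ i))
    rw [← mul_sub, ← Real.log_div (by have := hp i; positivity) (by positivity)]
    congr 2
    have := hp i
    field_simp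

lemma sq_sqrt_sub_le_divergence {p r : ι → ℝ} (hp : ∀ i, 0 < p i) (hp1 : ∑ i, p i = 1)
    (hr : ∀ i, 0 ≤ r i) : ∑ i, (√(r i) - √(p i * ∑ j, r j)) ^ 2 ≤ divergence p r := by
  have h1 : ∀ i, (√(r i) - √(p i * ∑ j, r j)) ^ 2 ≤
      r i * Real.log (r i / (p i * ∑ j, r j)) - r i + p i * ∑ j, r j := fun i => by
    have hle := Finset.single_le_sum (f := r) (fun j _ => hr j) (Finset.mem_univ i)
    refine sq_sqrt_sub_sqrt_le (hr i) (mul_nonneg (hp i).le (Finset.sum_nonneg fun j _ => hr j))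
      fun h => ?_
    rcases mul_eq_zero.1 h with h | h
    · exact absurd h (hp i).ne'
    · exact le_antisymm (h ▸ hle) (hr i)
  refine (Finset.sum_le_sum fun i _ => h1 i).trans_eq ?_
  rw [Finset.sum_add_distrib, Finset.sum_sub_distrib, ← Finset.sum_mul, hp1, one_mul,
    sub_add_cancel]
  simp only [divergence, mul_comm]

/-- `log t ≤ t - 1` bounds the divergence by the χ² distance, which is the variance of the density
divided by its mean. -/
lemma divergence_push_le [Fintype κ] {f : ι → κ} {p r : ι → ℝ} (hp : ∀ i, 0 < p i)
    (hp1 : ∑ i, p i = 1) (hr : ∀ i, 0 ≤ r i) (h0 : 0 < ∑ j, r j) {M : ℝ}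
    (hM : ∀ i, (density f p r i - ∑ j, r j) ^ 2 ≤ M) :
    divergence (push f p) (push f r) ≤ M / ∑ j, r j := by
  set ρ := ∑ j, r j
  rw [divergence_push]
  have e1 : ∑ i, r i * Real.log (density f p r i / ρ) =
      ∑ i, p i * density f p r i * Real.log (density f p r i / ρ) :=
    (sum_mul_density (f := f) (r := r) hp
      fun k => Real.log (push f r k / push f p k / ρ)).symm
  have hs := sum_mul_density (f := f) (r := r) hp fun _ => 1
  simp only [mul_one] at hs
  have e2 : ∑ i, p i * ((density f p r i - ρ) ^ 2 / ρ) =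
      ∑ i, p i * density f p r i * (density f p r i / ρ - 1) := by
    have : ∀ i, p i * ((density f p r i - ρ) ^ 2 / ρ) =
        p i * density f p r i * (density f p r i / ρ - 1) - p i * density f p r i + p i * ρ := by
      intro i; field_simp; ring
    simp_rw [this]
    rw [Finset.sum_add_distrib, Finset.sum_sub_distrib, hs, ← Finset.sum_mul, hp1]
    change _ - ρ + 1 * ρ = _
    ring
  rw [e1]
  calc ∑ i, p i * density f p r i * Real.log (density f p r i / ρ)
      ≤ ∑ i, p i * density f p r i * (density f p r i / ρ - 1) := by
        refine Finset.sum_le_sum fun i _ => ?_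
        have hd := density_nonneg (f := f) hp hr i
        rcases hd.eq_or_lt with h | h
        · simp [← h]
        · exact mul_le_mul_of_nonneg_left (Real.log_le_sub_one_of_pos (by positivity))
            (mul_nonneg (hp i).le hd)
    _ = ∑ i, p i * ((density f p r i - ρ) ^ 2 / ρ) := e2.symm
    _ ≤ ∑ i, p i * (M / ρ) := by
        refine Finset.sum_le_sum fun i _ => ?_
        have := hp i
        have := hM i
        gcongr
    _ = M / ρ := by rw [← Finset.sum_mul, hp1, one_mul]

lemma divergence_zero (p : ι → ℝ) : divergence p 0 = 0 := by simp [divergence]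

variable {κ' : Type*} [DecidableEq κ']

/-- If any two values of `f` and `g` are compatible, then the divergence is controlled by the
losses of divergence under `f` and under `g`. -/
lemma divergence_le_of_push [Fintype κ] [Fintype κ'] {f : ι → κ} {g : ι → κ'}
    (hfg : ∀ i j, ∃ k, f k = f i ∧ g k = g j) {p r : ι → ℝ} {δ : ℝ} (hδ : 0 < δ)
    (hp : ∀ i, δ ≤ p i) (hp1 : ∑ i, p i = 1) (hr : ∀ i, 0 ≤ r i) :
    divergence p r ≤ (1 + 32 / δ ^ 2) * ((divergence p r - divergence (push f p) (push f r)) +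
      (divergence p r - divergence (push g p) (push g r))) := by
  have hp0 : ∀ i, 0 < p i := fun i => hδ.trans_le (hp i)
  set ρ := ∑ j, r j with hρ
  have hρ0 : 0 ≤ ρ := Finset.sum_nonneg fun i _ => hr i
  rcases hρ0.eq_or_lt with h0 | h0
  · have hr0 : r = 0 := by
      funext i
      exact (Finset.sum_eq_zero_iff_of_nonneg fun i _ => hr i).1 h0.symm i (Finset.mem_univ i)
    have e1 : push f (0 : ι → ℝ) = 0 := by funext k; simp [push]
    have e2 : push g (0 : ι → ℝ) = 0 := by funext k; simp [push]
    rw [hr0, e1, e2, divergence_zero, divergence_zero, divergence_zero]; simp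
  have hf := divergence_sub_push (f := f) hp0 hr
  have hg := divergence_sub_push (f := g) hp0 hr
  set Δf := divergence p r - divergence (push f p) (push f r)
  set Δg := divergence p r - divergence (push g p) (push g r)
  have hf0 : 0 ≤ Δf := (Finset.sum_nonneg fun i _ => sq_nonneg _).trans hf
  have hg0 : 0 ≤ Δg := (Finset.sum_nonneg fun i _ => sq_nonneg _).trans hg
  set u := density f p r
  set w := density g p r
  have hu0 : ∀ i, 0 ≤ u i := density_nonneg hp0 hr
  have hw0 : ∀ i, 0 ≤ w i := density_nonneg hp0 hr
  have huf : ∀ i j, f i = f j → u i = u j := fun i j h => by simp only [u, density, h]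
  have hwg : ∀ i j, g i = g j → w i = w j := fun i j h => by simp only [w, density, h]
  set η2 := 2 * (Δf + Δg) / δ with hη2
  have hη0 : 0 ≤ η2 := by positivity
  -- At the point `k`, both `√(p * u)` and `√(p * w)` are close to `√r`; dividing by `p k ≥ δ` makes
  -- `√u` and `√w` close to each other.
  have huw : ∀ k, (√(u k) - √(w k)) ^ 2 ≤ η2 := by
    intro k
    have h1 : (√(r k) - √(p k * u k)) ^ 2 ≤ Δf :=
      (Finset.single_le_sum (f := fun i => (√(r i) - √(p i * u i)) ^ 2)
        (fun i _ => sq_nonneg _) (Finset.mem_univ k)).trans hf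
    have h2 : (√(r k) - √(p k * w k)) ^ 2 ≤ Δg :=
      (Finset.single_le_sum (f := fun i => (√(r i) - √(p i * w i)) ^ 2)
        (fun i _ => sq_nonneg _) (Finset.mem_univ k)).trans hg
    rw [Real.sqrt_mul (hp0 k).le] at h1 h2
    rw [hη2, le_div_iff₀ hδ]
    have h3 : (√(p k)) ^ 2 = p k := Real.sq_sqrt (hp0 k).le
    have h4 : (√(u k) - √(w k)) ^ 2 * p k ≤ 2 * (Δf + Δg) := by
      have : (√(u k) - √(w k)) ^ 2 * p k =
        ((√(r k) - √(p k) * √(w k)) - (√(r k) - √(p k) * √(u k))) ^ 2 := by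
        linear_combination -(√(u k) - √(w k)) ^ 2 * h3
      rw [this]
      nlinarith [sq_nonneg ((√(r k) - √(p k) * √(w k)) + (√(r k) - √(p k) * √(u k)))]
    exact (mul_le_mul_of_nonneg_left (hp k) (sq_nonneg _)).trans h4
  -- The only use of compatibility: `u` factors through `f` and `w` through `g`, so a point `k` with
  -- `f k = f i` and `g k = g j` transfers the bound to arbitrary `i` and `j`. Two such comparisons
  -- show that `√u` is nearly constant.
  have habs : ∀ i j, |√(u i) - √(w j)| ≤ √η2 := by
    intro i j
    obtain ⟨k, h1, h2⟩ := hfg i j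
    rw [huf i k h1.symm, hwg j k h2.symm]
    exact Real.abs_le_sqrt (huw k)
  have huu : ∀ i j, |√(u i) - √(u j)| ≤ 2 * √η2 := by
    intro i j
    have h1 := abs_le.1 (habs i j)
    have h2 := abs_le.1 (habs j j)
    rw [abs_le]; constructor <;> linarith
  have hsum : ∑ i, p i * u i = ρ := by
    simpa using sum_mul_density (f := f) (r := r) hp0 fun _ => 1
  have hub : ∀ i, √(u i) ≤ √(ρ / δ) := by
    intro i
    apply Real.sqrt_le_sqrt
    rw [le_div_iff₀ hδ]
    have h1 : p i * u i ≤ ρ := hsum ▸ Finset.single_le_sum (f := fun i => p i * u i)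
      (fun i _ => mul_nonneg (hp0 i).le (hu0 i)) (Finset.mem_univ i)
    nlinarith [mul_le_mul_of_nonneg_right (hp i) (hu0 i)]
  have hdiff : ∀ i j, |u i - u j| ≤ 4 * √η2 * √(ρ / δ) := by
    intro i j
    have : u i - u j = (√(u i) - √(u j)) * (√(u i) + √(u j)) := by
      nlinarith [Real.sq_sqrt (hu0 i), Real.sq_sqrt (hu0 j)]
    rw [this, abs_mul, abs_of_nonneg (add_nonneg (Real.sqrt_nonneg _) (Real.sqrt_nonneg _))]
    calc _ ≤ (2 * √η2) * (√(ρ / δ) + √(ρ / δ)) := by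
          apply mul_le_mul (huu i j) (add_le_add (hub i) (hub j)) (by positivity) (by positivity)
      _ = _ := by ring
  have hM : ∀ i, (u i - ρ) ^ 2 ≤ 16 * η2 * (ρ / δ) := by
    intro i
    have h1 : |u i - ρ| ≤ 4 * √η2 * √(ρ / δ) := by
      -- The total mass `ρ` is the `p`-average of `u`.
      have e : u i - ρ = ∑ j, p j * (u i - u j) := by
        simp_rw [mul_sub]
        rw [Finset.sum_sub_distrib, hsum, ← Finset.sum_mul, hp1, one_mul]
      rw [e]
      calc |∑ j, p j * (u i - u j)| ≤ ∑ j, |p j * (u i - u j)| := Finset.abs_sum_le_sum_abs _ _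
        _ ≤ ∑ j, p j * (4 * √η2 * √(ρ / δ)) := by
          refine Finset.sum_le_sum fun j _ => ?_
          rw [abs_mul, abs_of_pos (hp0 j)]
          exact mul_le_mul_of_nonneg_left (hdiff i j) (hp0 j).le
        _ = _ := by rw [← Finset.sum_mul, hp1, one_mul]
    have h2 := sq_le_sq' (by linarith [abs_nonneg (u i - ρ)]) h1
    rw [sq_abs] at h2
    refine h2.trans_eq ?_
    rw [mul_pow, mul_pow, Real.sq_sqrt hη0, Real.sq_sqrt (by positivity)]
    norm_num
  have hpush := divergence_push_le hp0 hp1 hr h0 hM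
  -- The constant is `32 = 16 * 2`; one factor `1 / δ` comes from `η2`, the other from the bound `u
  -- ≤ ρ / δ`.
  have e3 : 16 * η2 * (ρ / δ) / ρ = 32 / δ ^ 2 * (Δf + Δg) := by
    rw [hη2]; field_simp; ring
  rw [← hρ, e3] at hpush
  have : divergence p r = Δf + divergence (push f p) (push f r) := by simp [Δf]
  rw [this]
  nlinarith

end Divergence

/-! ### Mutual information as an average divergence -/

section MutualInfo

variable {Ω α β γ : Type*} [MeasurableSpace Ω] {μ : Measure Ω} [IsProbabilityMeasure μ]

lemma ent_eq_sum [Fintype α] (U : Ω → α) :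
    ent μ U = (∑ u, Real.negMulLog (μ.real {ω | U ω = u})) / Real.log 2 := by
  rw [ent, entropy, tsum_fintype, ENNReal.toReal_sum fun _ _ => ENNReal.ofReal_ne_top,
    Finset.sum_div]
  refine Finset.sum_congr rfl fun u _ => ENNReal.toReal_ofReal ?_
  exact div_nonneg (Real.negMulLog_nonneg measureReal_nonneg measureReal_le_one)
    (Real.log_nonneg one_le_two)

/-- The mutual information of `U` and `V` is the average of the divergence of the conditional law of
`U` given `V` from the law of `U`. -/
lemma hasSum_divergence [Fintype α] {U : Ω → α} {V : Ω → β} (hU : IsDiscrete μ U)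
    (hV : FiniteEntropy μ V) :
    HasSum (fun v => divergence (fun u => μ.real {ω | U ω = u})
        (fun u => μ.real {ω | U ω = u ∧ V ω = v}))
      (Real.log 2 * (ent μ U + ent μ V - ent μ (fun ω => (U ω, V ω)))) := by
  have hl2 : 0 < Real.log 2 := Real.log_pos one_lt_two
  have hUV : ∀ u, HasSum (fun v => μ.real {ω | U ω = u ∧ V ω = v}) (μ.real {ω | U ω = u}) :=
    fun u => hV.1.hasSum_setOf (hU.fiber u) fun _ _ => Iff.rfl
  have hVU : ∀ v, ∑ u, μ.real {ω | U ω = u ∧ V ω = v} = μ.real {ω | V ω = v} := fun v =>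
    (hasSum_fintype _).unique (hU.hasSum_setOf (hV.1.fiber v) fun _ _ => by grind)
  have hfin := hU.finiteEntropy.condEntropy_ne_top hV.1
  have hc := toReal_condEntropy hU.finiteEntropy hV
  unfold condEntropy at hfin hc
  rw [tsum_fintype] at hfin hc
  have hfin' := fun u => ENNReal.sum_ne_top.1 hfin u (Finset.mem_univ u)
  rw [ENNReal.toReal_sum fun u _ => hfin' u] at hc
  have h1 : HasSum (fun v => ∑ u, μ.real {ω | U ω = u ∧ V ω = v} *
      Real.logb 2 (μ.real {ω | V ω = v} / μ.real {ω | U ω = u ∧ V ω = v}))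
      (ent μ (fun ω => (U ω, V ω)) - ent μ V) := by
    rw [← hc]
    refine hasSum_sum fun u _ => ?_
    have := ENNReal.hasSum_toReal (hfin' u)
    rw [← ENNReal.tsum_toReal_eq (ENNReal.ne_top_of_tsum_ne_top (hfin' u))] at this
    convert this using 2 with v
    rw [ENNReal.toReal_ofReal]
    exact mul_logb_div_nonneg measureReal_nonneg (real_inter_le _ _)
  have h2 : HasSum (fun v => ∑ u, μ.real {ω | U ω = u ∧ V ω = v} *
      Real.log (μ.real {ω | U ω = u})) (∑ u, μ.real {ω | U ω = u} * Real.log (μ.real {ω | U ω = u})) :=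
    hasSum_sum fun u _ => (hUV u).mul_right _
  have h3 := ((h1.mul_left (Real.log 2)).add h2).neg
  have e : ∑ u, μ.real {ω | U ω = u} * Real.log (μ.real {ω | U ω = u}) =
      - (Real.log 2 * ent μ U) := by
    rw [ent_eq_sum, mul_div_cancel₀ _ hl2.ne', ← Finset.sum_neg_distrib]
    simp [Real.negMulLog]
  rw [e] at h3
  have e2 : Real.log 2 * (ent μ U + ent μ V - ent μ (fun ω => (U ω, V ω))) =
      -(Real.log 2 * (ent μ (fun ω => (U ω, V ω)) - ent μ V) + -(Real.log 2 * ent μ U)) := by ring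
  rw [e2]
  have key : ∀ v, divergence (fun u => μ.real {ω | U ω = u})
      (fun u => μ.real {ω | U ω = u ∧ V ω = v}) = -(Real.log 2 * (∑ u,
        μ.real {ω | U ω = u ∧ V ω = v} *
          Real.logb 2 (μ.real {ω | V ω = v} / μ.real {ω | U ω = u ∧ V ω = v})) +
      ∑ u, μ.real {ω | U ω = u ∧ V ω = v} * Real.log (μ.real {ω | U ω = u})) := ?_
  · rwa [funext key]
  intro v
  rw [divergence, hVU, Finset.mul_sum, ← Finset.sum_add_distrib, ← Finset.sum_neg_distrib]
  refine Finset.sum_congr rfl fun u _ => ?_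
  have h01 := real_inter_le (μ := μ) (fun ω => U ω = u) (fun ω => V ω = v)
  have h02 : μ.real {ω | U ω = u ∧ V ω = v} ≤ μ.real {ω | U ω = u} :=
    measureReal_mono fun _ h => h.1
  rcases (measureReal_nonneg (μ := μ) (s := {ω | U ω = u ∧ V ω = v})).eq_or_lt with h0 | h0
  · simp [← h0]
  · have h1 := h0.trans_le h01
    have h2 := h0.trans_le h02
    rw [← Real.log_div_log, Real.log_div h0.ne' (mul_pos h1 h2).ne',
      Real.log_mul h1.ne' h2.ne', Real.log_div h1.ne' h0.ne']
    field_simp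
    ring

/-- If the mutual information of `U` and `V` vanishes, then `U` and `V` are independent. -/
lemma indep_of_ent_eq [Fintype α] {U : Ω → α} {V : Ω → β} (hU : IsDiscrete μ U)
    (hV : FiniteEntropy μ V) (hpos : ∀ u, 0 < μ.real {ω | U ω = u})
    (h : ent μ U + ent μ V ≤ ent μ (fun ω => (U ω, V ω))) (u : α) (v : β) :
    μ.real {ω | U ω = u ∧ V ω = v} = μ.real {ω | U ω = u} * μ.real {ω | V ω = v} := by
  have hVU : ∀ v, ∑ u, μ.real {ω | U ω = u ∧ V ω = v} = μ.real {ω | V ω = v} := fun v =>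
    (hasSum_fintype _).unique (hU.hasSum_setOf (hV.1.fiber v) fun _ _ => by grind)
  have hU1 : ∑ u, μ.real {ω | U ω = u} = 1 := by
    have := hU.hasSum_setOf (p := fun _ => True) (q := fun u ω => U ω = u) (μ := μ) (by simp)
      fun _ _ => by simp
    simpa using (hasSum_fintype _).unique this
  have hs := hasSum_divergence hU hV
  have hle := fun v => sq_sqrt_sub_le_divergence hpos hU1 (r := fun u => μ.real {ω | U ω = u ∧ V ω = v})
    fun _ => measureReal_nonneg
  have hnn := fun v => (Finset.sum_nonneg fun i _ => sq_nonneg _).trans (hle v)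
  have h0 : Real.log 2 * (ent μ U + ent μ V - ent μ (fun ω => (U ω, V ω))) = 0 :=
    le_antisymm (mul_nonpos_of_nonneg_of_nonpos (Real.log_nonneg one_le_two) (by linarith))
      (hs.nonneg hnn)
  rw [h0] at hs
  have hz := congrFun ((hasSum_zero_iff_of_nonneg hnn).1 hs) v
  have h1 := hle v
  rw [hz] at h1
  have h2 := (Finset.sum_eq_zero_iff_of_nonneg fun i _ => sq_nonneg _).1
    (le_antisymm h1 (Finset.sum_nonneg fun i _ => sq_nonneg _)) u (Finset.mem_univ u)
  rw [hVU] at h2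
  have h3 := sub_eq_zero.1 (pow_eq_zero_iff two_ne_zero |>.1 h2)
  exact (Real.sqrt_inj measureReal_nonneg (mul_nonneg measureReal_nonneg measureReal_nonneg)).1 h3

lemma real_comp_eq_push [Fintype α] [DecidableEq γ] {U : Ω → α} (hU : IsDiscrete μ U) (f : α → γ)
    {p : Ω → Prop} (hp : NullMeasurableSet {ω | p ω} μ) (c : γ) :
    μ.real {ω | f (U ω) = c ∧ p ω} = push f (fun u => μ.real {ω | U ω = u ∧ p ω}) c := by
  have h := hU.hasSum_setOf (p := fun ω => f (U ω) = c ∧ p ω)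
    (q := fun u ω => f (U ω) = c ∧ p ω ∧ U ω = u) (((hU.comp f).fiber c).inter hp)
    fun _ _ => by tauto
  rw [← (hasSum_fintype _).unique h, push, Finset.sum_filter]
  refine Finset.sum_congr rfl fun u _ => ?_
  split_ifs with hu
  · congr 1; ext ω; simp; grind
  · rw [show {ω | f (U ω) = c ∧ p ω ∧ U ω = u} = ∅ by ext ω; simp; grind]
    simp

/-- If any two values of `f` and `g` are compatible, then the information about `U` is controlled by
the information about `U` given `f U` and given `g U`. -/
lemma mutualInfo_le_of_comp [Fintype α] [Fintype β] [Fintype γ] [DecidableEq β] [DecidableEq γ]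
    {f : α → β} {g : α → γ}
    (hfg : ∀ i j, ∃ k, f k = f i ∧ g k = g j) {δ' : Type*} {U : Ω → α} {V : Ω → δ'}
    (hU : IsDiscrete μ U) (hV : FiniteEntropy μ V) {δ : ℝ} (hδ : 0 < δ)
    (hp : ∀ u, δ ≤ μ.real {ω | U ω = u}) :
    ent μ U + ent μ V - ent μ (fun ω => (U ω, V ω)) ≤ (1 + 32 / δ ^ 2) *
      ((ent μ U - ent μ (fun ω => (U ω, V ω)) - ent μ (fun ω => f (U ω)) +
          ent μ (fun ω => (f (U ω), V ω))) +
        (ent μ U - ent μ (fun ω => (U ω, V ω)) - ent μ (fun ω => g (U ω)) +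
          ent μ (fun ω => (g (U ω), V ω)))) := by
  have hU1 : ∑ u, μ.real {ω | U ω = u} = 1 := by
    have := hU.hasSum_setOf (p := fun _ => True) (q := fun u ω => U ω = u) (μ := μ) (by simp)
      fun _ _ => by simp
    simpa using (hasSum_fintype _).unique this
  have h := hasSum_divergence hU hV
  have hf := hasSum_divergence (hU.comp f) hV
  have hg := hasSum_divergence (hU.comp g) hV
  have ef := funext fun c => real_comp_eq_push hU f (p := fun _ => True) (by simp) c
  have eg := funext fun c => real_comp_eq_push hU g (p := fun _ => True) (by simp) c
  have ef' := fun v => funext fun c => real_comp_eq_push hU f (hV.1.fiber v) c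
  have eg' := fun v => funext fun c => real_comp_eq_push hU g (hV.1.fiber v) c
  simp only [and_true] at ef eg
  simp_rw [ef, ef'] at hf
  simp_rw [eg, eg'] at hg
  -- The divergence inequality holds for unnormalized `r`, so it can be applied to the joint weights
  -- with each value of `V` and summed directly.
  have hle := hasSum_le (fun v => divergence_le_of_push hfg hδ hp hU1
    (r := fun u => μ.real {ω | U ω = u ∧ V ω = v}) fun _ => measureReal_nonneg) h
    (((h.sub hf).add (h.sub hg)).mul_left _)
  have hl2 : 0 < Real.log 2 := Real.log_pos one_lt_two
  refine le_of_mul_le_mul_left (hle.trans_eq ?_) hl2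
  ring

end MutualInfo

end

end SecureComp

namespace SecureComp

noncomputable section

/-! ### Blocks -/

section Block

variable {Ω α β γ : Type*} [MeasurableSpace Ω] {μ : Measure Ω} [IsProbabilityMeasure μ] {n : ℕ}

lemma sum_real_mul_comp [Fintype α] [Fintype β] {S : Ω → α} (hS : IsDiscrete μ S) (f : α → β)
    (c : β → ℝ) : ∑ s, μ.real {ω | S ω = s} * c (f s) = ∑ b, μ.real {ω | f (S ω) = b} * c b := by
  classical
  rw [← sum_push_mul]
  refine Finset.sum_congr rfl fun b _ => ?_
  have := real_comp_eq_push hS f (p := fun _ => True) (by simp) b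
  simp only [and_true] at this
  rw [this]

/-- The entropy of independent random variables is the sum of their entropies. -/
lemma ent_pi [Fintype α] {S : Ω → Fin n → α} (hS : IsDiscrete μ S)
    (h : ∀ s, μ.real {ω | S ω = s} = ∏ i, μ.real {ω | S ω i = s i}) :
    ent μ S = ∑ i, ent μ (fun ω => S ω i) := by
  simp_rw [ent_eq_sum]
  rw [← Finset.sum_div]
  congr 1
  have e : ∀ s, Real.negMulLog (μ.real {ω | S ω = s}) =
      ∑ i, μ.real {ω | S ω = s} * -Real.log (μ.real {ω | S ω i = s i}) := by
    intro s
    by_cases h0 : μ.real {ω | S ω = s} = 0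
    · simp [h0]
    · rw [Real.negMulLog, ← Finset.mul_sum, Finset.sum_neg_distrib]
      rw [h] at h0
      nth_rewrite 2 [h]
      rw [Real.log_prod fun i _ => (Finset.prod_ne_zero_iff.1 h0) i (Finset.mem_univ i)]
      ring
  simp_rw [e]
  rw [Finset.sum_comm]
  refine Finset.sum_congr rfl fun i _ => ?_
  rw [sum_real_mul_comp hS (fun s => s i) fun a => -Real.log (μ.real {ω | S ω i = a})]
  simp [Real.negMulLog]

/-- The first `k` entries of a block. -/
def firstEntries (k : ℕ) (s : Fin n → α) (i : Fin n) : Option α := if i < k then some (s i) else none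

lemma firstEntries_eq_of_succ (k : Fin n) (s : Fin n → α) :
    firstEntries k s = fun i => if i < k then firstEntries (k + 1) s i else none := by
  funext i
  unfold firstEntries
  by_cases h : i < k
  · have h' : (i : ℕ) < k := h
    simp [h, h', h.le]
  · have h' : ¬ (i : ℕ) < k := h
    simp [h, h']

lemma eq_firstEntries_succ (k : Fin n) (s : Fin n → α) :
    some (s k) = firstEntries (k + 1) s k := by
  simp [firstEntries]

lemma firstEntries_succ (k : Fin n) (s : Fin n → α) :
    firstEntries (k + 1) s = fun i => if i = k then some (s k) else firstEntries k s i := by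
  funext i
  unfold firstEntries
  by_cases h : i = k
  · subst h; simp
  · have h' : (i : ℕ) < k + 1 ↔ (i : ℕ) < k := by
      have : (i : ℕ) ≠ k := fun h' => h (Fin.ext h')
      omega
    simp [h, h']

lemma firstEntries_self (s : Fin n → α) : firstEntries n s = fun i => some (s i) := by
  funext i; simp [firstEntries]

lemma firstEntries_zero (s : Fin n → α) : firstEntries 0 s = fun _ => none := by
  funext i; simp [firstEntries]

lemma ent_firstEntries_succ [Finite α] {S : Ω → Fin n → α} (hS : IsDiscrete μ S)
    {W : Ω → β} (hW : FiniteEntropy μ W) (k : Fin n) :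
    ent μ (fun ω => (firstEntries (k + 1) (S ω), W ω)) =
      ent μ (fun ω => (S ω k, firstEntries k (S ω), W ω)) := by
  have hS' := hS.finiteEntropy
  -- A default value, needed only to invert `some`.
  have a : α := (μ.nonempty_of_neZero.map fun ω => S ω k).some
  exact ent_congr ((hS'.comp (firstEntries (k + 1))).prodMk hW)
    (fun x => ((x.1 k).getD a, fun i => if i < k then x.1 i else none, x.2))
    (fun x => (fun i => if i = k then some x.1 else x.2.1 i, x.2.2))
    (fun ω => by dsimp only; rw [← firstEntries_eq_of_succ, ← eq_firstEntries_succ]; rfl)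
    (fun ω => by rw [firstEntries_succ])

/-- The chain rule as a telescoping sum. Padding with `none` gives all initial segments the same
type. -/
lemma sum_firstEntries_sub [Finite α] {S : Ω → Fin n → α} (hS : IsDiscrete μ S)
    {W : Ω → β} (hW : FiniteEntropy μ W) :
    ∑ k : Fin n, (ent μ (fun ω => (S ω k, firstEntries k (S ω), W ω)) -
      ent μ (fun ω => (firstEntries k (S ω), W ω))) = ent μ (fun ω => (S ω, W ω)) - ent μ W := by
  have hS' := hS.finiteEntropy
  simp_rw [← ent_firstEntries_succ hS hW]
  rw [Fin.sum_univ_eq_sum_range (fun k => ent μ (fun ω => (firstEntries (k + 1) (S ω), W ω)) -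
      ent μ (fun ω => (firstEntries k (S ω), W ω))) n,
    Finset.sum_range_sub (fun k => ent μ (fun ω => (firstEntries k (S ω), W ω)))]
  simp_rw [firstEntries_self, firstEntries_zero]
  congr 1
  · obtain ⟨ω₀⟩ := μ.nonempty_of_neZero
    exact (ent_congr (hS'.prodMk hW) (fun x => (fun i => some (x.1 i), x.2))
      (fun x => (fun i => (x.1 i).getD (S ω₀ i), x.2)) (fun _ => rfl) fun ω => by simp).symm
  · exact (ent_congr hW (fun x => (fun _ => none, x)) (fun x => x.2) (fun _ => rfl)
      fun ω => rfl).symm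

/-- Each summand is the information on the entry `k` in the past entries and `W`, given `f` of this
entry. Conditioning on `f` of all the entries instead only lowers the conditional entropy of the
entry `k`, and by the chain rule these conditional entropies add up to that of `S` given `f S` and
`W`. The unconditional entropies are additive by `h` and `hf`. -/
lemma sum_ent_sub_comp_le [Finite α] [Finite γ] {S : Ω → Fin n → α} (hS : IsDiscrete μ S)
    {W : Ω → β} (hW : FiniteEntropy μ W) (f : α → γ)
    (h : ent μ S = ∑ i, ent μ (fun ω => S ω i))
    (hf : ent μ (fun ω i => f (S ω i)) = ∑ i, ent μ (fun ω => f (S ω i))) :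
    ∑ k : Fin n, (ent μ (fun ω => S ω k) - ent μ (fun ω => (S ω k, firstEntries k (S ω), W ω)) -
        ent μ (fun ω => f (S ω k)) + ent μ (fun ω => (f (S ω k), firstEntries k (S ω), W ω))) ≤
      ent μ S - ent μ (fun ω => (S ω, W ω)) - ent μ (fun ω i => f (S ω i)) +
          ent μ (fun ω => ((fun i => f (S ω i)), W ω)) := by
  have hS' := hS.finiteEntropy
  have hfW : FiniteEntropy μ (fun ω => ((fun i => f (S ω i)), W ω)) :=
    (hS'.comp fun s i => f (s i)).prodMk hW
  have h1 := sum_firstEntries_sub hS hfW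
  have h2 : ent μ (fun ω => (S ω, (fun i => f (S ω i)), W ω)) = ent μ (fun ω => (S ω, W ω)) :=
    (ent_congr (hS'.prodMk hW) (fun x => (x.1, (fun i => f (x.1 i)), x.2))
      (fun x => (x.1, x.2.2)) (fun _ => rfl) fun _ => rfl).symm
  rw [h2] at h1
  have h3 : ∀ k : Fin n, ent μ (fun ω => (S ω k, firstEntries k (S ω), (fun i => f (S ω i)), W ω)) -
      ent μ (fun ω => (firstEntries k (S ω), (fun i => f (S ω i)), W ω)) ≤
      ent μ (fun ω => (S ω k, firstEntries k (S ω), W ω)) -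
        ent μ (fun ω => (f (S ω k), firstEntries k (S ω), W ω)) := by
    intro k
    have h4 := ent_sub_le_of_comp (hS'.comp fun s => s k)
      ((hS'.comp (firstEntries k)).prodMk hfW)
      (W := fun ω => (f (S ω k), firstEntries k (S ω), W ω))
      (fun x => (x.2.1 k, x.1, x.2.2)) fun _ => rfl
    refine h4.trans_eq ?_
    congr 1
    exact (ent_congr ((hS'.comp fun s => s k).prodMk ((hS'.comp (firstEntries k)).prodMk hW))
      (fun x => (x.1, f x.1, x.2)) (fun x => (x.1, x.2.2)) (fun _ => rfl) fun _ => rfl).symm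
  have h5 := Finset.sum_le_sum fun (k : Fin n) (_ : k ∈ Finset.univ) => h3 k
  rw [h1] at h5
  simp only [Finset.sum_add_distrib, Finset.sum_sub_distrib] at h5 ⊢
  rw [h, hf]
  linarith

/-- The block version of `mutualInfo_le_of_comp`. -/
lemma mutualInfo_block_le [Fintype α] [Fintype β] [Fintype γ] [DecidableEq β] [DecidableEq γ]
    {f : α → β} {g : α → γ} (hfg : ∀ i j, ∃ k, f k = f i ∧ g k = g j) {δ' : Type*}
    {S : Ω → Fin n → α} {W : Ω → δ'} (hS : IsDiscrete μ S) (hW : FiniteEntropy μ W)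
    {δ : ℝ} (hδ : 0 < δ) (hp : ∀ i u, δ ≤ μ.real {ω | S ω i = u})
    (h : ent μ S = ∑ i, ent μ (fun ω => S ω i))
    (hf : ent μ (fun ω i => f (S ω i)) = ∑ i, ent μ (fun ω => f (S ω i)))
    (hg : ent μ (fun ω i => g (S ω i)) = ∑ i, ent μ (fun ω => g (S ω i))) :
    ent μ S + ent μ W - ent μ (fun ω => (S ω, W ω)) ≤ (1 + 32 / δ ^ 2) *
      ((ent μ S - ent μ (fun ω => (S ω, W ω)) - ent μ (fun ω i => f (S ω i)) +
          ent μ (fun ω => ((fun i => f (S ω i)), W ω))) +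
        (ent μ S - ent μ (fun ω => (S ω, W ω)) - ent μ (fun ω i => g (S ω i)) +
          ent μ (fun ω => ((fun i => g (S ω i)), W ω)))) := by
  have hS' := hS.finiteEntropy
  have hV : ∀ k : Fin n, FiniteEntropy μ (fun ω => (firstEntries k (S ω), W ω)) :=
    fun k => (hS'.comp (firstEntries k)).prodMk hW
  have hC : 0 ≤ 1 + 32 / δ ^ 2 := by positivity
  -- The one-letter bound for the entry `k`, with the past entries and `W` as the observation. Its
  -- constant involves the law of a single entry only and so does not grow with `n`.
  have h1 := Finset.sum_le_sum fun (k : Fin n) (_ : k ∈ Finset.univ) =>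
    mutualInfo_le_of_comp hfg (hS.comp fun s => s k) (hV k) hδ (hp k)
  rw [← Finset.mul_sum] at h1
  have h2 := sum_ent_sub_comp_le hS hW f h hf
  have h3 := sum_ent_sub_comp_le hS hW g h hg
  have h4 := sum_firstEntries_sub hS hW
  rw [Finset.sum_add_distrib] at h1
  have h5 := mul_le_mul_of_nonneg_left (add_le_add h2 h3) hC
  have h6 := h1.trans h5
  refine le_trans (le_of_eq ?_) h6
  simp only [Finset.sum_add_distrib, Finset.sum_sub_distrib] at h4 ⊢
  linarith

end Block

end

end SecureComp

namespace SecureComp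

set_option linter.unusedSectionVars false

noncomputable section

/-! ### Transcripts and the private randomness -/

section Transcripts

lemma concat_eq_iff {α : Type*} (d : α) (l h : List α) (m : α) :
    l ++ [m] = h ↔ h ≠ [] ∧ l = h.dropLast ∧ m = h.getLastD d := by
  constructor
  · rintro rfl
    simp
  · rintro ⟨h0, rfl, rfl⟩
    rw [List.getLastD_eq_getLast?, List.getLast?_eq_some_getLast h0, Option.getD_some,
      List.dropLast_append_getLast]

/-- The private randomness for which the messages of a party in the first `t` rounds are those of
the histories of the two links; `s` and `s'` select the messages which are sent by this party. -/
def Party.follows {I : Type} (p : Party I) (i : I) (s s' : LinkRound → Msg) :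
    ℕ → LinkHist → LinkHist → Set p.Ω
  | 0, h, h' => {_r | h = [] ∧ h' = []}
  | t + 1, h, h' => {r | h ≠ [] ∧ h' ≠ [] ∧ r ∈ p.follows i s s' t h.dropLast h'.dropLast ∧
      p.next i r h.dropLast h'.dropLast = (s (h.getLastD ([], [])), s' (h'.getLastD ([], [])))}

lemma Party.measurableSet_follows {I : Type} (p : Party I) (i : I) (s s' : LinkRound → Msg)
    (t : ℕ) (h h' : LinkHist) : MeasurableSet (p.follows i s s' t h h') := by
  induction t generalizing h h' with
  | zero => exact MeasurableSet.const _
  | succ t ih =>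
    exact (MeasurableSet.const _).inter ((MeasurableSet.const _).inter
      ((ih _ _).inter (p.measurable_next _ _ _ _)))

namespace PreProtocol

variable {A B C : Type} (π : PreProtocol A B C)

/-- The histories after `t` rounds impose separate conditions on the randomness of the users. -/
lemma hist_eq_iff (x : A) (y : B) (r : π.Rand) (t : ℕ) (h₁₂ h₂₃ h₃₁ : LinkHist) :
    π.hist x y r t = (h₁₂, h₂₃, h₃₁) ↔
      r.1 ∈ π.alice.follows x Prod.fst Prod.snd t h₁₂ h₃₁ ∧
      r.2.1 ∈ π.bob.follows y Prod.snd Prod.fst t h₁₂ h₂₃ ∧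
      r.2.2 ∈ π.charlie.follows () Prod.snd Prod.fst t h₂₃ h₃₁ := by
  induction t generalizing h₁₂ h₂₃ h₃₁ with
  | zero =>
    simp only [hist, Party.follows, Prod.mk.injEq, Set.mem_ofPred_eq, eq_comm (a := [])]
    tauto
  | succ t ih =>
    have e : π.hist x y r (t + 1) = ((π.hist x y r t).1 ++ [(π.round x y r (π.hist x y r t)).1],
      (π.hist x y r t).2.1 ++ [(π.round x y r (π.hist x y r t)).2.1],
      (π.hist x y r t).2.2 ++ [(π.round x y r (π.hist x y r t)).2.2]) := rfl
    have ih' := ih h₁₂.dropLast h₂₃.dropLast h₃₁.dropLast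
    rw [e, Prod.mk.injEq, Prod.mk.injEq, concat_eq_iff ([], []), concat_eq_iff ([], []),
      concat_eq_iff ([], [])]
    simp only [Party.follows, Set.mem_ofPred_eq]
    constructor
    · rintro ⟨⟨n1, d1, m1⟩, ⟨n2, d2, m2⟩, ⟨n3, d3, m3⟩⟩
      have hh : π.hist x y r t = (h₁₂.dropLast, h₂₃.dropLast, h₃₁.dropLast) := by
        rw [← d1, ← d2, ← d3]
      obtain ⟨ia, ib, ic⟩ := ih'.1 hh
      rw [hh] at m1 m2 m3
      rw [← m1, ← m2, ← m3]
      exact ⟨⟨n1, n3, ia, rfl⟩, ⟨n1, n2, ib, rfl⟩, ⟨n2, n3, ic, rfl⟩⟩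
    · rintro ⟨⟨n1, n3, ia, ea⟩, ⟨-, n2, ib, eb⟩, ⟨-, -, ic, ec⟩⟩
      have hh := ih'.2 ⟨ia, ib, ic⟩
      rw [hh]
      refine ⟨⟨n1, rfl, ?_⟩, ⟨n2, rfl, ?_⟩, ⟨n3, rfl, ?_⟩⟩ <;>
        simp only [round, ea, eb, ec]

lemma hist_succ (x : A) (y : B) (r : π.Rand) (t : ℕ) :
    π.hist x y r (t + 1) = ((π.hist x y r t).1 ++ [π.link12 x y r t],
      (π.hist x y r t).2.1 ++ [π.link23 x y r t],
      (π.hist x y r t).2.2 ++ [π.link31 x y r t]) := rfl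

/-- What was sent on a link in the first `t` rounds. -/
def _root_.SecureComp.LinkTranscript.take (m : LinkTranscript) (t : ℕ) : LinkHist :=
  (List.range t).map m

/-- The transcript of a link which is unused after the rounds of `h`. -/
def _root_.SecureComp.LinkHist.extend (h : LinkHist) : LinkTranscript := fun t => h.getD t ([], [])

lemma hist_eq_take (x : A) (y : B) (r : π.Rand) (t : ℕ) :
    π.hist x y r t = ((π.link12 x y r).take t, (π.link23 x y r).take t,
      (π.link31 x y r).take t) := by
  induction t with
  | zero => rfl
  | succ t ih =>
    rw [hist_succ, ih]
    simp [LinkTranscript.take, List.range_succ]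

end PreProtocol

lemma LinkTranscript.extend_take {m : LinkTranscript} {t : ℕ} (h : ∀ s, t ≤ s → m s = ([], [])) :
    (m.take t).extend = m := by
  funext s
  unfold LinkHist.extend LinkTranscript.take
  by_cases hs : s < t
  · simp [List.getD_eq_getElem?_getD, hs]
  · rw [h s (not_lt.1 hs)]
    simp [List.getD_eq_getElem?_getD, hs]

lemma LinkTranscript.take_injective {m m' : LinkTranscript} (h : ∀ t, m.take t = m'.take t) :
    m = m' := by
  funext s
  have := h (s + 1)
  simp only [LinkTranscript.take, List.range_succ, List.map_append, List.map_cons, List.map_nil] at this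
  exact List.singleton_inj.1 (List.append_inj' this rfl).2

end Transcripts

/-! ### The law of the outcome -/

section Law

variable {Ω α β : Type*} [MeasurableSpace Ω] {μ : Measure Ω}

/-- Charlie's output function is measurable only for fixed transcripts; this permits the
substitution of random ones. -/
lemma IsDiscrete.nullMeasurableSet_of_forall {V : Ω → β} (hV : IsDiscrete μ V) {p : Ω → β → Prop}
    (hp : ∀ v, NullMeasurableSet {ω | p ω v} μ) : NullMeasurableSet {ω | p ω (V ω)} μ := by
  obtain ⟨S, hS, hVS⟩ := hV.countable
  have h : NullMeasurableSet (⋃ v ∈ S, {ω | V ω = v} ∩ {ω | p ω v}) μ :=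
    NullMeasurableSet.biUnion hS fun v _ => (hV.fiber v).inter (hp v)
  refine h.congr ?_
  filter_upwards [hVS] with ω hω
  apply propext
  change (ω ∈ ⋃ v ∈ S, {ω | V ω = v} ∩ {ω | p ω v}) ↔ p ω (V ω)
  simp [hω]

instance {A B C : Type} (π : PreProtocol A B C) : IsProbabilityMeasure π.randMeasure :=
  inferInstanceAs (IsProbabilityMeasure (π.alice.μ.prod (π.bob.μ.prod π.charlie.μ)))

namespace BlockProtocol

variable {𝒳 𝒴 𝒵 : Type} {n : ℕ} (Q : BlockProtocol 𝒳 𝒴 𝒵 n)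
  [MeasurableSpace 𝒳] [MeasurableSpace 𝒴]

instance (P : Measure (𝒳 × 𝒴)) [IsProbabilityMeasure P] : IsProbabilityMeasure (Q.law P) :=
  inferInstanceAs (IsProbabilityMeasure ((Measure.pi fun _ : Fin n => P).prod Q.randMeasure))

variable [Fintype 𝒳] [Fintype 𝒴] [MeasurableSingletonClass 𝒳] [MeasurableSingletonClass 𝒴]
  (P : Measure (𝒳 × 𝒴)) [IsProbabilityMeasure P]

lemma measurableSet_of_section {E : Set Q.Outcome}
    (hE : ∀ v, MeasurableSet {r | (v, r) ∈ E}) : MeasurableSet E := by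
  have : E = ⋃ v, {v} ×ˢ {r | (v, r) ∈ E} := by
    ext ⟨v, r⟩; simp
  rw [this]
  exact MeasurableSet.iUnion fun v => (measurableSet_singleton v).prod (hE v)

lemma law_real_eq_sum {E : Set Q.Outcome} (hE : ∀ v, MeasurableSet {r | (v, r) ∈ E}) :
    (Q.law P).real E = ∑ v, (Measure.pi fun _ : Fin n => P).real {v} *
      Q.randMeasure.real {r | (v, r) ∈ E} := by
  have h : (Q.law P) E = ∑ v, (Measure.pi fun _ : Fin n => P) {v} *
      Q.randMeasure {r | (v, r) ∈ E} := by
    rw [law, Measure.prod_apply (Q.measurableSet_of_section hE), lintegral_fintype]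
    exact Finset.sum_congr rfl fun v _ => mul_comm _ _
  rw [measureReal_def, h, ENNReal.toReal_sum fun v _ =>
    ENNReal.mul_ne_top (measure_ne_top _ _) (measure_ne_top _ _)]
  simp [measureReal_def, ENNReal.toReal_mul]

lemma ae_law_of_forall {p : Q.Outcome → Prop} (h : ∀ v, ∀ᵐ r ∂Q.randMeasure, p (v, r)) :
    ∀ᵐ ω ∂Q.law P, p ω := by
  rw [ae_iff]
  have : {ω | ¬ p ω} = ⋃ v, {v} ×ˢ {r | ¬ p (v, r)} := by
    ext ⟨v, r⟩; simp
  rw [this, measure_iUnion_null_iff]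
  intro v
  rw [law, Measure.prod_prod, (ae_iff.1 (h v)), mul_zero]

variable (pX : Measure 𝒳) (pY : Measure 𝒴) [IsProbabilityMeasure pX] [IsProbabilityMeasure pY]

/-- The probability of an event which concerns the input and the private randomness of Alice. -/
def aliceProb (E : (Fin n → 𝒳) → Q.alice.Ω → Prop) : ℝ :=
  ∑ x, (Measure.pi fun _ : Fin n => pX).real {x} * Q.alice.μ.real {r | E x r}

/-- The probability of an event which concerns the input and the private randomness of Bob. -/
def bobProb (E : (Fin n → 𝒴) → Q.bob.Ω → Prop) : ℝ :=
  ∑ y, (Measure.pi fun _ : Fin n => pY).real {y} * Q.bob.μ.real {r | E y r}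

lemma pi_real_singleton {ι : Type*} [Fintype ι] {α : Type*} [MeasurableSpace α] (p : Measure α)
    [IsProbabilityMeasure p] (v : ι → α) :
    (Measure.pi fun _ : ι => p).real {v} = ∏ i, p.real {v i} := by
  rw [measureReal_def, Measure.pi_singleton, ENNReal.toReal_prod]
  rfl

/-- The inputs and the private randomness of the three users are independent. -/
lemma law_real_rect {EA : (Fin n → 𝒳) → Q.alice.Ω → Prop} {EB : (Fin n → 𝒴) → Q.bob.Ω → Prop}
    {EC : Q.charlie.Ω → Prop} (hA : ∀ x, MeasurableSet {r | EA x r})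
    (hB : ∀ y, MeasurableSet {r | EB y r}) (hC : MeasurableSet {r | EC r}) :
    (Q.law (pX.prod pY)).real
        {ω | EA (Q.X ω) ω.2.1 ∧ EB (Q.Y ω) ω.2.2.1 ∧ EC ω.2.2.2} =
      Q.aliceProb pX EA * Q.bobProb pY EB * Q.charlie.μ.real {r | EC r} := by
  rw [law_real_eq_sum]
  · rw [aliceProb, bobProb, Finset.sum_mul_sum, Finset.sum_mul]
    simp_rw [Finset.sum_mul]
    rw [← Fintype.sum_prod_type', ← (Equiv.arrowProdEquivProdArrow (Fin n) (fun _ => 𝒳) (fun _ => 𝒴)).sum_comp]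
    refine Finset.sum_congr rfl fun v _ => ?_
    have e : {r : Q.Rand | (v, r) ∈
        {ω : Q.Outcome | EA (Q.X ω) ω.2.1 ∧ EB (Q.Y ω) ω.2.2.1 ∧ EC ω.2.2.2}} =
        {r | EA (fun i => (v i).1) r} ×ˢ ({r | EB (fun i => (v i).2) r} ×ˢ {r | EC r}) := rfl
    rw [e, PreProtocol.randMeasure, measureReal_prod_prod, measureReal_prod_prod,
      pi_real_singleton, pi_real_singleton, pi_real_singleton]
    have e2 : ∀ i, (pX.prod pY).real {v i} = pX.real {(v i).1} * pY.real {(v i).2} := fun i => by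
      rw [← measureReal_prod_prod, Set.singleton_prod_singleton]
    simp_rw [e2, Finset.prod_mul_distrib]
    simp only [Equiv.arrowProdEquivProdArrow_apply]
    ring
  · intro v
    exact (hA fun i => (v i).1).prod ((hB fun i => (v i).2).prod hC)

/-- The history of link 12 after `t` rounds. -/
def H12 (t : ℕ) (ω : Q.Outcome) : LinkHist := (Q.hist (Q.X ω) (Q.Y ω) ω.2 t).1

/-- The history of link 23 after `t` rounds. -/
def H23 (t : ℕ) (ω : Q.Outcome) : LinkHist := (Q.hist (Q.X ω) (Q.Y ω) ω.2 t).2.1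

/-- The history of link 31 after `t` rounds. -/
def H31 (t : ℕ) (ω : Q.Outcome) : LinkHist := (Q.hist (Q.X ω) (Q.Y ω) ω.2 t).2.2

lemma H12_eq (t : ℕ) (ω : Q.Outcome) : Q.H12 t ω = (Q.M12 ω).take t := by
  rw [H12, PreProtocol.hist_eq_take]; rfl

lemma H23_eq (t : ℕ) (ω : Q.Outcome) : Q.H23 t ω = (Q.M23 ω).take t := by
  rw [H23, PreProtocol.hist_eq_take]; rfl

lemma H31_eq (t : ℕ) (ω : Q.Outcome) : Q.H31 t ω = (Q.M31 ω).take t := by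
  rw [H31, PreProtocol.hist_eq_take]; rfl

lemma isDiscrete_input : IsDiscrete (Q.law P) (fun ω => ω.1) :=
  isDiscrete_of_countable fun v => by
    refine (Q.measurableSet_of_section fun v' => ?_).nullMeasurableSet
    exact MeasurableSet.const (v' = v)

lemma isDiscrete_X : IsDiscrete (Q.law P) Q.X := (Q.isDiscrete_input P).comp fun v i => (v i).1

lemma isDiscrete_Y : IsDiscrete (Q.law P) Q.Y := (Q.isDiscrete_input P).comp fun v i => (v i).2

lemma isDiscrete_Z (f : 𝒳 → 𝒴 → 𝒵) : IsDiscrete (Q.law P) (Q.Z f) :=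
  (Q.isDiscrete_input P).comp fun v i => f (v i).1 (v i).2

lemma measurableSet_hist (t : ℕ) (h : LinkHist × LinkHist × LinkHist) (x : Fin n → 𝒳)
    (y : Fin n → 𝒴) : MeasurableSet {r | Q.hist x y r t = h} := by
  obtain ⟨h₁₂, h₂₃, h₃₁⟩ := h
  simp_rw [PreProtocol.hist_eq_iff]
  exact (Q.alice.measurableSet_follows _ _ _ _ _ _).prod
    ((Q.bob.measurableSet_follows _ _ _ _ _ _).prod (Q.charlie.measurableSet_follows _ _ _ _ _ _))

lemma isDiscrete_hist (t : ℕ) : IsDiscrete (Q.law P) (fun ω => (Q.H12 t ω, Q.H23 t ω, Q.H31 t ω)) :=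
  isDiscrete_of_countable fun h => (Q.measurableSet_of_section fun v =>
    Q.measurableSet_hist t h (fun i => (v i).1) (fun i => (v i).2)).nullMeasurableSet

lemma isDiscrete_H12 (t : ℕ) : IsDiscrete (Q.law P) (Q.H12 t) :=
  (Q.isDiscrete_hist P t).comp fun h => h.1

lemma isDiscrete_H23 (t : ℕ) : IsDiscrete (Q.law P) (Q.H23 t) :=
  (Q.isDiscrete_hist P t).comp fun h => h.2.1

lemma isDiscrete_H31 (t : ℕ) : IsDiscrete (Q.law P) (Q.H31 t) :=
  (Q.isDiscrete_hist P t).comp fun h => h.2.2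

/-- Transcripts are infinite sequences, but by termination they lie almost surely among the
countably many extensions of finite histories, and a fibre is a countable intersection of fibres of
histories. -/
lemma isDiscrete_transcript {M : Q.Outcome → LinkTranscript}
    (h : ∀ t, IsDiscrete (Q.law P) (fun ω => (M ω).take t))
    (h' : ∀ᵐ ω ∂Q.law P, ∀ᶠ t in atTop, M ω t = ([], [])) : IsDiscrete (Q.law P) M where
  fiber m := by
    have : {ω | M ω = m} = ⋂ t, {ω | (M ω).take t = m.take t} := by
      ext ω
      simp only [Set.mem_ofPred_eq, Set.mem_iInter]
      exact ⟨fun h => by simp [h], LinkTranscript.take_injective⟩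
    rw [this]
    exact NullMeasurableSet.iInter fun t => (h t).fiber _
  countable := by
    refine ⟨Set.range LinkHist.extend, Set.countable_range _, ?_⟩
    filter_upwards [h'] with ω hω
    obtain ⟨T, hT⟩ := eventually_atTop.1 hω
    exact ⟨_, LinkTranscript.extend_take hT⟩

lemma ae_terminates : ∀ᵐ ω ∂Q.law P, ∀ᶠ t in atTop,
    Q.M12 ω t = ([], []) ∧ Q.M23 ω t = ([], []) ∧ Q.M31 ω t = ([], []) :=
  Q.ae_law_of_forall P fun v => Q.terminates (fun i => (v i).1) (fun i => (v i).2)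

lemma isDiscrete_M12 : IsDiscrete (Q.law P) Q.M12 :=
  Q.isDiscrete_transcript P (fun t => by simpa only [← H12_eq] using Q.isDiscrete_H12 P t)
    ((Q.ae_terminates P).mono fun _ h => h.mono fun _ h => h.1)

lemma isDiscrete_M23 : IsDiscrete (Q.law P) Q.M23 :=
  Q.isDiscrete_transcript P (fun t => by simpa only [← H23_eq] using Q.isDiscrete_H23 P t)
    ((Q.ae_terminates P).mono fun _ h => h.mono fun _ h => h.2.1)

lemma isDiscrete_M31 : IsDiscrete (Q.law P) Q.M31 :=
  Q.isDiscrete_transcript P (fun t => by simpa only [← H31_eq] using Q.isDiscrete_H31 P t)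
    ((Q.ae_terminates P).mono fun _ h => h.mono fun _ h => h.2.2)

lemma nullMeasurableSet_output (m m' : LinkTranscript) (z : Fin n → 𝒵) :
    NullMeasurableSet {ω : Q.Outcome | Q.output ω.2.2.2 m m' = z} (Q.law P) :=
  (Q.measurableSet_of_section (E := {ω : Q.Outcome | Q.output ω.2.2.2 m m' = z}) fun _ =>
    (measurable_snd.comp measurable_snd) (Q.measurable_output m m' z)).nullMeasurableSet

/-- Charlie's output if only the first `t` rounds are taken into account. -/
def ZhatT (t : ℕ) (ω : Q.Outcome) : Fin n → 𝒵 :=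
  Q.output ω.2.2.2 (Q.H23 t ω).extend (Q.H31 t ω).extend

variable [Finite 𝒵]

lemma isDiscrete_Zhat : IsDiscrete (Q.law P) Q.Zhat :=
  isDiscrete_of_countable fun z =>
    ((Q.isDiscrete_M23 P).prodMk (Q.isDiscrete_M31 P)).nullMeasurableSet_of_forall
      (p := fun ω m => Q.output ω.2.2.2 m.1 m.2 = z) fun m => Q.nullMeasurableSet_output P m.1 m.2 z

lemma isDiscrete_ZhatT (t : ℕ) : IsDiscrete (Q.law P) (Q.ZhatT t) :=
  isDiscrete_of_countable fun z =>
    ((Q.isDiscrete_H23 P t).prodMk (Q.isDiscrete_H31 P t)).nullMeasurableSet_of_forall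
      (p := fun ω m => Q.output ω.2.2.2 m.1.extend m.2.extend = z)
      fun m => Q.nullMeasurableSet_output P m.1.extend m.2.extend z

/-- Sufficiently many rounds determine Charlie's output with high probability. -/
lemma exists_ZhatT_ne_lt (f : 𝒳 → 𝒴 → 𝒵) {e : ℝ}
    (he : (Q.law P).real {ω | Q.Zhat ω ≠ Q.Z f ω} < e) :
    ∃ t, (Q.law P).real {ω | Q.ZhatT t ω ≠ Q.Z f ω} < e := by
  -- The event that a link of Charlie is used in round `t` or later. These events decrease to a null
  -- set, and outside of them the truncated output is the true one.
  set s : ℕ → Set Q.Outcome := fun t => ⋃ u, ⋃ (_ : t ≤ u),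
    ({ω | Q.M23 ω u ≠ ([], [])} ∪ {ω | Q.M31 ω u ≠ ([], [])})
  have hs : ∀ t, NullMeasurableSet (s t) (Q.law P) := fun t =>
    NullMeasurableSet.iUnion fun u => NullMeasurableSet.iUnion fun _ =>
      (((Q.isDiscrete_M23 P).comp fun m => m u).nullMeasurableSet_preimage {([], [])}ᶜ).union
      (((Q.isDiscrete_M31 P).comp fun m => m u).nullMeasurableSet_preimage {([], [])}ᶜ)
  have hanti : Antitone s := fun t t' h =>
    Set.iUnion_mono fun u => Set.iUnion_mono' fun h' => ⟨h.trans h', le_rfl⟩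
  have h0 : (Q.law P) (⋂ t, s t) = 0 := by
    refine measure_mono_null ?_ (ae_iff.1 (Q.ae_terminates P))
    intro ω hω hev
    obtain ⟨T, hT⟩ := eventually_atTop.1 hev
    have := Set.mem_iInter.1 hω T
    simp only [s, Set.mem_iUnion, Set.mem_union, Set.mem_ofPred_eq] at this
    obtain ⟨u, hu, h | h⟩ := this
    · exact h (hT u hu).2.1
    · exact h (hT u hu).2.2
  have hlim := tendsto_measure_iInter_atTop hs hanti ⟨0, measure_ne_top _ _⟩
  rw [h0] at hlim
  have hlim' := (ENNReal.tendsto_toReal ENNReal.zero_ne_top).comp hlim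
  have hev := hlim'.eventually (gt_mem_nhds (sub_pos.2 he))
  obtain ⟨t, ht⟩ := hev.exists
  refine ⟨t, ?_⟩
  have hsub : {ω | Q.ZhatT t ω ≠ Q.Z f ω} ⊆ {ω | Q.Zhat ω ≠ Q.Z f ω} ∪ s t := by
    intro ω hω
    by_contra hc
    rw [Set.mem_union, not_or] at hc
    obtain ⟨h1, h2⟩ := hc
    have hM : ∀ u, t ≤ u → Q.M23 ω u = ([], []) ∧ Q.M31 ω u = ([], []) := by
      intro u hu
      by_contra h3
      apply h2
      simp only [s, Set.mem_iUnion, Set.mem_union, Set.mem_ofPred_eq]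
      exact ⟨u, hu, by tauto⟩
    apply h1
    intro h4
    apply hω
    have : Q.ZhatT t ω = Q.Zhat ω := by
      rw [ZhatT, H23_eq, H31_eq, LinkTranscript.extend_take fun u hu => (hM u hu).1,
        LinkTranscript.extend_take fun u hu => (hM u hu).2]
      rfl
    rw [this, Classical.not_not.1 (fun h => h h4)]
  have h1 := (measureReal_mono hsub).trans (measureReal_union_le (μ := Q.law P) _ _)
  have h2 : (Q.law P).real (s t) < e - (Q.law P).real {ω | Q.Zhat ω ≠ Q.Z f ω} := ht
  linarith

end BlockProtocol

end Law

end

end SecureComp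

namespace SecureComp

set_option linter.unusedSectionVars false

noncomputable section

/-! ### Co-information and its monotonicity under messages -/

section Coinformation

variable {Ω α β γ δ ε α' β' γ' δ' : Type*} [MeasurableSpace Ω] {μ : Measure Ω}
  [IsProbabilityMeasure μ]

/-- Submodularity of the entropy, where `S` is determined by `P` and by `Q`, and `R` is determined by
the pair of them. -/
lemma ent_submodular_of {P : Ω → α} {Q : Ω → β} {R : Ω → γ} {S : Ω → δ} (hP : FiniteEntropy μ P)
    (hQ : FiniteEntropy μ Q) (f : α → δ) (g : β → δ) (h : α → β → γ) (hf : ∀ ω, S ω = f (P ω))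
    (hg : ∀ ω, S ω = g (Q ω)) (hR : ∀ ω, R ω = h (P ω) (Q ω)) :
    ent μ R + ent μ S ≤ ent μ P + ent μ Q := by
  have hS : FiniteEntropy μ S := by
    rw [show S = fun ω => f (P ω) from funext hf]; exact hP.comp f
  have h1 := ent_submodular hP hQ hS
  have h2 : ent μ P = ent μ (fun ω => (P ω, S ω)) :=
    ent_congr hP (fun p => (p, f p)) Prod.fst (fun ω => by rw [← hf]) fun _ => rfl
  have h3 : ent μ Q = ent μ (fun ω => (Q ω, S ω)) :=
    ent_congr hQ (fun q => (q, g q)) Prod.fst (fun ω => by rw [← hg]) fun _ => rfl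
  have h4 := ent_le_of_comp (hP.prodMk (hQ.prodMk hS)) (V := R) (fun x => h x.1 x.2.1) hR
  linarith

/-- The co-information of three random variables. -/
def coinfo (μ : Measure Ω) (P : Ω → α) (Q : Ω → β) (R : Ω → γ) : ℝ :=
  ent μ P + ent μ Q + ent μ R - ent μ (fun ω => (P ω, Q ω)) - ent μ (fun ω => (Q ω, R ω)) -
    ent μ (fun ω => (R ω, P ω)) + ent μ (fun ω => (P ω, Q ω, R ω))

lemma coinfo_congr {P : Ω → α} {Q : Ω → β} {R : Ω → γ} {P' : Ω → α'} {Q' : Ω → β'} {R' : Ω → γ'}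
    (hP : FiniteEntropy μ P) (hQ : FiniteEntropy μ Q) (hR : FiniteEntropy μ R)
    (f : α → α') (f' : α' → α) (g : β → β') (g' : β' → β) (h : γ → γ') (h' : γ' → γ)
    (hf : ∀ ω, P' ω = f (P ω)) (hf' : ∀ ω, P ω = f' (P' ω)) (hg : ∀ ω, Q' ω = g (Q ω))
    (hg' : ∀ ω, Q ω = g' (Q' ω)) (hh : ∀ ω, R' ω = h (R ω)) (hh' : ∀ ω, R ω = h' (R' ω)) :
    coinfo μ P Q R = coinfo μ P' Q' R' := by
  unfold coinfo
  rw [ent_congr hP f f' hf hf', ent_congr hQ g g' hg hg', ent_congr hR h h' hh hh',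
    ent_congr (hP.prodMk hQ) (V := fun ω => (P' ω, Q' ω)) (Prod.map f g) (Prod.map f' g')
      (fun ω => by simp [hf, hg]) (fun ω => by simp [← hf', ← hg']),
    ent_congr (hQ.prodMk hR) (V := fun ω => (Q' ω, R' ω)) (Prod.map g h) (Prod.map g' h')
      (fun ω => by simp [hg, hh]) (fun ω => by simp [← hg', ← hh']),
    ent_congr (hR.prodMk hP) (V := fun ω => (R' ω, P' ω)) (Prod.map h f) (Prod.map h' f')
      (fun ω => by simp [hh, hf]) (fun ω => by simp [← hh', ← hf']),
    ent_congr (hP.prodMk (hQ.prodMk hR)) (V := fun ω => (P' ω, Q' ω, R' ω))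
      (Prod.map f (Prod.map g h)) (Prod.map f' (Prod.map g' h'))
      (fun ω => by simp [hf, hg, hh]) (fun ω => by simp [← hf', ← hg', ← hh'])]

lemma ent_swap {P : Ω → α} {Q : Ω → β} (hP : FiniteEntropy μ P) (hQ : FiniteEntropy μ Q) :
    ent μ (fun ω => (P ω, Q ω)) = ent μ (fun ω => (Q ω, P ω)) :=
  ent_congr (hP.prodMk hQ) Prod.swap Prod.swap (fun _ => rfl) fun _ => rfl

lemma coinfo_swap_right {P : Ω → α} {Q : Ω → β} {R : Ω → γ} (hP : FiniteEntropy μ P)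
    (hQ : FiniteEntropy μ Q) (hR : FiniteEntropy μ R) : coinfo μ P Q R = coinfo μ P R Q := by
  unfold coinfo
  rw [ent_swap hP hQ, ent_swap hQ hR, ent_swap hR hP,
    ent_congr (hP.prodMk (hQ.prodMk hR)) (V := fun ω => (P ω, R ω, Q ω))
      (fun x => (x.1, x.2.2, x.2.1)) (fun x => (x.1, x.2.2, x.2.1)) (fun _ => rfl) fun _ => rfl]
  ring

lemma coinfo_rotate {P : Ω → α} {Q : Ω → β} {R : Ω → γ} (hP : FiniteEntropy μ P)
    (hQ : FiniteEntropy μ Q) (hR : FiniteEntropy μ R) : coinfo μ P Q R = coinfo μ Q R P := by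
  unfold coinfo
  rw [ent_congr (hP.prodMk (hQ.prodMk hR)) (V := fun ω => (Q ω, R ω, P ω))
      (fun x => (x.2.1, x.2.2, x.1)) (fun x => (x.2.2, x.1, x.2.1)) (fun _ => rfl) fun _ => rfl]
  ring

/-- The co-information of the links does not decrease if a user, who knows `P` and `R` but not `Q`,
sends a message on each of the links `P` and `R`. -/
lemma coinfo_le_of_factorizes {P : Ω → α} {Q : Ω → β} {R : Ω → γ} {U : Ω → δ} {U' : Ω → ε}
    (hP : FiniteEntropy μ P) (hQ : FiniteEntropy μ Q) (hR : FiniteEntropy μ R)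
    (hU : FiniteEntropy μ U) (hU' : FiniteEntropy μ U')
    (h : Factorizes μ (fun ω => (U ω, U' ω)) Q (fun ω => (P ω, R ω))) :
    coinfo μ P Q R ≤ coinfo μ (fun ω => (P ω, U ω)) Q (fun ω => (R ω, U' ω)) := by
  -- The co-information is `I(P;Q) + I(Q;R) - I(Q;P,R)`. The factorization leaves the last term
  -- unchanged when the messages are added, while `s1` and `s2` say that the first two do not
  -- decrease.
  have h1 := h.ent_eq (hU.prodMk hU') hQ (hP.prodMk hR)
  have e1 := ent_congr ((hU.prodMk hU').prodMk (hQ.prodMk (hP.prodMk hR)))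
    (V := fun ω => ((P ω, U ω), Q ω, (R ω, U' ω)))
    (fun x => ((x.2.2.1, x.1.1), x.2.1, (x.2.2.2, x.1.2)))
    (fun x => ((x.1.2, x.2.2.2), x.2.1, (x.1.1, x.2.2.1))) (fun _ => rfl) fun _ => rfl
  have e2 := ent_congr ((hU.prodMk hU').prodMk (hP.prodMk hR))
    (V := fun ω => ((R ω, U' ω), (P ω, U ω)))
    (fun x => ((x.2.2, x.1.2), (x.2.1, x.1.1)))
    (fun x => ((x.2.2, x.1.2), (x.2.1, x.1.1))) (fun _ => rfl) fun _ => rfl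
  have e3 := ent_congr (hQ.prodMk (hP.prodMk hR)) (V := fun ω => (P ω, Q ω, R ω))
    (fun x => (x.2.1, x.1, x.2.2)) (fun x => (x.2.1, x.1, x.2.2)) (fun _ => rfl) fun _ => rfl
  have e4 := ent_swap hP hR
  have s1 := ent_submodular_of (hP.prodMk hU) (hP.prodMk hQ) (S := P)
    (R := fun ω => ((P ω, U ω), Q ω)) Prod.fst Prod.fst (fun x y => (x, y.2))
    (fun _ => rfl) (fun _ => rfl) fun _ => rfl
  have s2 := ent_submodular_of (hR.prodMk hU') (hQ.prodMk hR) (S := R)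
    (R := fun ω => (Q ω, (R ω, U' ω))) Prod.fst Prod.snd (fun x y => (y.1, x))
    (fun _ => rfl) (fun _ => rfl) fun _ => rfl
  unfold coinfo
  linarith

end Coinformation

/-! ### Lower bounds for the entropies of the links -/

section Core

variable {Ω α β γ 𝒳 𝒴 𝒵 : Type*} [MeasurableSpace Ω] {μ : Measure Ω}
  [IsProbabilityMeasure μ]

/-- If `Z` is a function of `S`, and `S` and `M` are nearly independent, then so are `Z` and `M`. -/
lemma ent_add_le_of_comp {S : Ω → α} {Z : Ω → β} {M : Ω → γ} (hS : FiniteEntropy μ S)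
    (hM : FiniteEntropy μ M) (z : α → β) (hz : ∀ ω, Z ω = z (S ω)) {d : ℝ}
    (h : ent μ S + ent μ M - ent μ (fun ω => (S ω, M ω)) ≤ d) :
    ent μ Z + ent μ M ≤ ent μ (fun ω => (Z ω, M ω)) + d := by
  have hZ : FiniteEntropy μ Z := by
    rw [show Z = fun ω => z (S ω) from funext hz]; exact hS.comp z
  have := ent_submodular_of (hZ.prodMk hM) hS (S := Z) (R := fun ω => (S ω, M ω)) Prod.fst z
    (fun x s => (s, x.2)) (fun _ => rfl) hz fun _ => rfl
  linarith

/-- Abstract form of the lower bounds: `M₁₂`, `M₂₃`, `M₃₁` are the transcripts, `S` is the pair of the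
inputs `X` and `Y`, and `Z'` is an estimate of `Z` obtained from `M₂₃` and `M₃₁`. -/
lemma ent_links_ge {M₁₂ : Ω → α} {M₂₃ : Ω → β} {M₃₁ : Ω → γ} {X : Ω → 𝒳} {Y : Ω → 𝒴} {Z Z' : Ω → 𝒵}
    (h₁₂ : FiniteEntropy μ M₁₂) (h₂₃ : FiniteEntropy μ M₂₃) (h₃₁ : FiniteEntropy μ M₃₁)
    (hX : FiniteEntropy μ X) (hY : FiniteEntropy μ Y) (hZ' : FiniteEntropy μ Z')
    (z : 𝒳 × 𝒴 → 𝒵) (x : 𝒵 → 𝒴 → 𝒳) (y : 𝒵 → 𝒳 → 𝒴) (hz : ∀ ω, Z ω = z (X ω, Y ω))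
    (hx : ∀ ω, X ω = x (Z ω) (Y ω)) (hy : ∀ ω, Y ω = y (Z ω) (X ω))
    (fA : Factorizes μ X (fun ω => (Y ω, M₂₃ ω)) (fun ω => (M₁₂ ω, M₃₁ ω)))
    (fB : Factorizes μ Y (fun ω => (X ω, M₃₁ ω)) (fun ω => (M₁₂ ω, M₂₃ ω)))
    (fC : Factorizes μ Z' (fun ω => ((X ω, Y ω), M₁₂ ω)) (fun ω => (M₂₃ ω, M₃₁ ω)))
    (hJ : 0 ≤ coinfo μ M₁₂ M₂₃ M₃₁) {d φ : ℝ}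
    (hφ : ent μ (fun ω => (Z ω, Z' ω)) - ent μ Z' ≤ φ)
    (hd₂₃ : ent μ (fun ω => (X ω, Y ω)) + ent μ M₂₃ - ent μ (fun ω => ((X ω, Y ω), M₂₃ ω)) ≤ d)
    (hd₃₁ : ent μ (fun ω => (X ω, Y ω)) + ent μ M₃₁ - ent μ (fun ω => ((X ω, Y ω), M₃₁ ω)) ≤ d) :
    ent μ Z - 2 * d - 3 * φ ≤ ent μ M₁₂ ∧ ent μ Z - d - φ ≤ ent μ M₂₃ ∧
      ent μ Z - d - φ ≤ ent μ M₃₁ := by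
  have hS := hX.prodMk hY
  have hZ : FiniteEntropy μ Z := by
    rw [show Z = fun ω => z (X ω, Y ω) from funext hz]; exact hS.comp z
  have h2331 := h₂₃.prodMk h₃₁
  have h1231 := h₁₂.prodMk h₃₁
  have h1223 := h₁₂.prodMk h₂₃
  -- Charlie's transcripts determine `Z`.
  have c1 := fC.ent_eq hZ' (hS.prodMk h₁₂) h2331
  have c2 := ent_submodular_of (hZ.prodMk (hZ'.prodMk h2331)) ((hS.prodMk h₁₂).prodMk h2331)
    (S := fun ω => (Z ω, M₂₃ ω, M₃₁ ω))
    (R := fun ω => (Z' ω, ((X ω, Y ω), M₁₂ ω), (M₂₃ ω, M₃₁ ω)))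
    (fun p => (p.1, p.2.2)) (fun q => (z q.1.1, q.2)) (fun p q => (p.2.1, q))
    (fun _ => rfl) (fun ω => by simp [hz]) fun _ => rfl
  have c3 := ent_submodular_of (hZ.prodMk hZ') (hZ'.prodMk h2331) (S := Z')
    (R := fun ω => (Z ω, Z' ω, M₂₃ ω, M₃₁ ω)) Prod.snd Prod.fst (fun p q => (p.1, q))
    (fun _ => rfl) (fun _ => rfl) fun _ => rfl
  have F1 : ent μ (fun ω => (Z ω, M₂₃ ω, M₃₁ ω)) ≤ ent μ (fun ω => (M₂₃ ω, M₃₁ ω)) + φ := by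
    linarith
  -- Alice's transcripts determine `X`.
  have a1 := fA.ent_eq hX (hY.prodMk h₂₃) h1231
  have a2 := ent_submodular_of (hZ.prodMk h2331) ((hY.prodMk h₂₃).prodMk h1231)
    (S := fun ω => (M₂₃ ω, M₃₁ ω))
    (R := fun ω => (X ω, (Y ω, M₂₃ ω), (M₁₂ ω, M₃₁ ω)))
    Prod.snd (fun q => (q.1.2, q.2.2)) (fun p q => (x p.1 q.1.1, q))
    (fun _ => rfl) (fun _ => rfl) fun ω => by simp [← hx]
  have F2 : ent μ (fun ω => (X ω, M₁₂ ω, M₃₁ ω)) ≤ ent μ (fun ω => (M₁₂ ω, M₃₁ ω)) + φ := by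
    linarith
  -- Bob's transcripts determine `Y`.
  have b1 := fB.ent_eq hY (hX.prodMk h₃₁) h1223
  have b2 := ent_submodular_of (hZ.prodMk h2331) ((hX.prodMk h₃₁).prodMk h1223)
    (S := fun ω => (M₂₃ ω, M₃₁ ω))
    (R := fun ω => (Y ω, (X ω, M₃₁ ω), (M₁₂ ω, M₂₃ ω)))
    Prod.snd (fun q => (q.2.2, q.1.2)) (fun p q => (y p.1 q.1.1, q))
    (fun _ => rfl) (fun _ => rfl) fun ω => by simp [← hy]
  have F3 : ent μ (fun ω => (Y ω, M₁₂ ω, M₂₃ ω)) ≤ ent μ (fun ω => (M₁₂ ω, M₂₃ ω)) + φ := by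
    linarith
  have i23 := ent_add_le_of_comp hS h₂₃ z hz hd₂₃
  have i31 := ent_add_le_of_comp hS h₃₁ z hz hd₃₁
  have j23 := ent_add_le_of_comp hS h₂₃ (Z := Y) Prod.snd (fun _ => rfl) hd₂₃
  have m23 := ent_le_of_comp (hZ.prodMk h2331) (V := fun ω => (Z ω, M₂₃ ω))
    (fun q => (q.1, q.2.1)) fun _ => rfl
  have m31 := ent_le_of_comp (hZ.prodMk h2331) (V := fun ω => (Z ω, M₃₁ ω))
    (fun q => (q.1, q.2.2)) fun _ => rfl
  have p := ent_prod_le h₂₃ h₃₁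
  refine ⟨?_, by linarith, by linarith⟩
  -- `hJ` reads `H(M₁₂) ≥ H(M₁₂|M₂₃) + I(M₁₂;M₂₃|M₃₁)`. The first term is nearly at least `H(Y)`:
  -- `Y` is determined by `M₁₂` and `M₂₃` but independent of `M₂₃` (`F3`, `s7`, `j23`). Given `M₃₁`,
  -- `M₁₂` determines `X` and `M₂₃` determines `Z`, so the second term is nearly at least
  -- `I(X;Z|M₃₁)` (`s3`, `s4`), hence at least `H(Z) - H(Y)` (`s5`, `s6`, `i31`).
  have s3 := ent_submodular_of (hX.prodMk h1231) (hX.prodMk (hZ.prodMk h₃₁))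
    (S := fun ω => (X ω, M₃₁ ω)) (R := fun ω => (X ω, Z ω, M₁₂ ω, M₃₁ ω))
    (fun q => (q.1, q.2.2)) (fun q => (q.1, q.2.2)) (fun p q => (p.1, q.2.1, p.2))
    (fun _ => rfl) (fun _ => rfl) fun _ => rfl
  have s4 := ent_submodular_of (hX.prodMk (hZ.prodMk h1231)) (hZ.prodMk h2331)
    (S := fun ω => (Z ω, M₃₁ ω)) (R := fun ω => (M₁₂ ω, M₂₃ ω, M₃₁ ω))
    (fun q => (q.2.1, q.2.2.2)) (fun q => (q.1, q.2.2)) (fun p q => (p.2.2.1, q.2))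
    (fun _ => rfl) (fun _ => rfl) fun _ => rfl
  have s5 := ent_le_of_comp ((hX.prodMk h₃₁).prodMk hY) (V := fun ω => (X ω, Z ω, M₃₁ ω))
    (fun q => (q.1.1, z (q.1.1, q.2), q.1.2)) fun ω => by simp [hz]
  have s6 := ent_prod_le (hX.prodMk h₃₁) hY
  have s7 := ent_le_of_comp (hY.prodMk h1223) (V := fun ω => (Y ω, M₂₃ ω))
    (fun q => (q.1, q.2.2)) fun _ => rfl
  have e1 := ent_swap h₁₂ h₃₁
  unfold coinfo at hJ
  linarith

end Core

/-! ### Protocols with finite expected communication -/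

section Finite

lemma LinkTranscript.take_succ (m : LinkTranscript) (t : ℕ) : m.take (t + 1) = m.take t ++ [m t] := by
  simp [LinkTranscript.take, List.range_succ]

variable {Ω α : Type*} [MeasurableSpace Ω] {μ : Measure Ω} [IsProbabilityMeasure μ]

lemma entropy_const (c : α) : entropy μ (fun _ => c) = 0 := by
  refine ENNReal.tsum_eq_zero.2 fun u => ?_
  by_cases h : c = u <;> simp [h]

/-- The expected number of bits is at least the entropy of a transcript. -/
lemma entropy_take_le_lintegral {M : Ω → LinkTranscript} (hM : IsDiscrete μ M)
    (C : LinkHist → Set Msg × Set Msg) (hC : ∀ h, PrefixFree (C h).1 ∧ PrefixFree (C h).2)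
    (hmem : ∀ᵐ ω ∂μ, ∀ t, M ω t ∈ (C ((M ω).take t)).1 ×ˢ (C ((M ω).take t)).2) (T : ℕ) :
    entropy μ (fun ω => (M ω).take T) ≤ ∫⁻ ω, totalLength (M ω) ∂μ := by
  have h : ∀ T, entropy μ (fun ω => (M ω).take T) ≤
      ∑ t ∈ Finset.range T, ∫⁻ ω, (((M ω t).1.length + (M ω t).2.length : ℕ) : ℝ≥0∞) ∂μ := by
    intro T
    induction T with
    | zero => exact (entropy_const ([] : LinkHist)).trans_le zero_le
    | succ T ih =>
      -- The codes of round `T` are determined by the history of the link, so the expected length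
      -- bounds the entropy of the round given this history; the chain rule adds the rounds up.
      have h1 := condEntropy_le_lintegral_length (hM.comp fun m => m T) (hM.comp fun m => m.take T) C hC
        (hmem.mono fun ω h => h T)
      simp_rw [LinkTranscript.take_succ]
      rw [Finset.sum_range_succ]
      refine (entropy_comp_le ((hM.comp fun m => m T).prodMk (hM.comp fun m => m.take T))
        fun x => x.2 ++ [x.1]).trans ?_
      rw [entropy_prod (hM.comp fun m => m T) (hM.comp fun m => m.take T)]
      exact add_le_add ih h1
  refine (h T).trans ?_
  rw [← lintegral_finsetSum' _ fun t _ => (hM.comp fun m => m t).aemeasurable_comp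
    fun w => ((w.1.length + w.2.length : ℕ) : ℝ≥0∞)]
  exact lintegral_mono fun ω => ENNReal.sum_le_tsum _

end Finite

end

end SecureComp

namespace SecureComp

set_option linter.unusedSectionVars false

noncomputable section

namespace BlockProtocol

/-! ### Conditional independence of the users given the histories -/

section Factorizations

variable {𝒳 𝒴 𝒵 : Type} {n : ℕ} (Q : BlockProtocol 𝒳 𝒴 𝒵 n)
  [MeasurableSpace 𝒳] [MeasurableSpace 𝒴]
  [Fintype 𝒳] [Fintype 𝒴] [MeasurableSingletonClass 𝒳] [MeasurableSingletonClass 𝒴]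
  (pX : Measure 𝒳) (pY : Measure 𝒴) [IsProbabilityMeasure pX] [IsProbabilityMeasure pY]

lemma hist_iff (t : ℕ) (ω : Q.Outcome) (a b c : LinkHist) :
    (Q.H12 t ω = a ∧ Q.H23 t ω = b ∧ Q.H31 t ω = c) ↔
      (ω.2.1 ∈ Q.alice.follows (Q.X ω) Prod.fst Prod.snd t a c ∧
      ω.2.2.1 ∈ Q.bob.follows (Q.Y ω) Prod.snd Prod.fst t a b ∧
      ω.2.2.2 ∈ Q.charlie.follows () Prod.snd Prod.fst t b c) := by
  rw [← PreProtocol.hist_eq_iff, Prod.ext_iff, Prod.ext_iff]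
  rfl

/-- The messages of Alice in round `t`, on the links 12 and 31. -/
lemma alice_next (t : ℕ) (ω : Q.Outcome) :
    Q.alice.next (Q.X ω) ω.2.1 (Q.H12 t ω) (Q.H31 t ω) = ((Q.M12 ω t).1, (Q.M31 ω t).2) := rfl

/-- The messages of Bob in round `t`, on the links 12 and 23. -/
lemma bob_next (t : ℕ) (ω : Q.Outcome) :
    Q.bob.next (Q.Y ω) ω.2.2.1 (Q.H12 t ω) (Q.H23 t ω) = ((Q.M12 ω t).2, (Q.M23 ω t).1) := rfl

/-- The messages of Charlie in round `t`, on the links 23 and 31. -/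
lemma charlie_next (t : ℕ) (ω : Q.Outcome) :
    Q.charlie.next () ω.2.2.2 (Q.H23 t ω) (Q.H31 t ω) = ((Q.M23 ω t).2, (Q.M31 ω t).1) := rfl

/-- Once all histories are fixed, the event splits into one condition per user. Alice's condition
involves only her input, her randomness and her links 12 and 31; the other two conditions do not
involve her input. -/
lemma factorizes_alice_input (t : ℕ) : Factorizes (Q.law (pX.prod pY)) Q.X
    (fun ω => (Q.Y ω, Q.H23 t ω)) (fun ω => (Q.H12 t ω, Q.H31 t ω)) := by
  refine ⟨fun x w => Q.aliceProb pX fun x' r => x' = x ∧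
      r ∈ Q.alice.follows x' Prod.fst Prod.snd t w.1 w.2,
    fun v w => (Q.bobProb pY fun y r => y = v.1 ∧ r ∈ Q.bob.follows y Prod.snd Prod.fst t w.1 v.2) *
      Q.charlie.μ.real {r | r ∈ Q.charlie.follows () Prod.snd Prod.fst t v.2 w.2},
    fun x v w => ?_⟩
  rw [← mul_assoc, ← law_real_rect]
  · congr 1
    ext ω
    have := Q.hist_iff t ω w.1 v.2 w.2
    simp only [Set.mem_ofPred_eq, Prod.ext_iff]
    tauto
  · exact fun x' => (MeasurableSet.const _).inter (Q.alice.measurableSet_follows _ _ _ _ _ _)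
  · exact fun x' => (MeasurableSet.const _).inter (Q.bob.measurableSet_follows _ _ _ _ _ _)
  · exact Q.charlie.measurableSet_follows _ _ _ _ _ _

lemma factorizes_bob_input (t : ℕ) : Factorizes (Q.law (pX.prod pY)) Q.Y
    (fun ω => (Q.X ω, Q.H31 t ω)) (fun ω => (Q.H12 t ω, Q.H23 t ω)) := by
  refine ⟨fun y w => Q.bobProb pY fun y' r => y' = y ∧
      r ∈ Q.bob.follows y' Prod.snd Prod.fst t w.1 w.2,
    fun v w => (Q.aliceProb pX fun x r => x = v.1 ∧
      r ∈ Q.alice.follows x Prod.fst Prod.snd t w.1 v.2) *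
      Q.charlie.μ.real {r | r ∈ Q.charlie.follows () Prod.snd Prod.fst t w.2 v.2},
    fun y v w => ?_⟩
  rw [← mul_assoc, mul_comm (Q.bobProb pY _), ← law_real_rect]
  · congr 1
    ext ω
    have := Q.hist_iff t ω w.1 w.2 v.2
    simp only [Set.mem_ofPred_eq, Prod.ext_iff]
    tauto
  · exact fun x' => (MeasurableSet.const _).inter (Q.alice.measurableSet_follows _ _ _ _ _ _)
  · exact fun x' => (MeasurableSet.const _).inter (Q.bob.measurableSet_follows _ _ _ _ _ _)
  · exact Q.charlie.measurableSet_follows _ _ _ _ _ _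

/-- For fixed histories, the truncated output is a condition on Charlie's randomness alone, and so
joins his factor. The truncation matters here: the product structure is available for finite
histories. -/
lemma factorizes_output (t : ℕ) : Factorizes (Q.law (pX.prod pY)) (Q.ZhatT t)
    (fun ω => ((Q.X ω, Q.Y ω), Q.H12 t ω)) (fun ω => (Q.H23 t ω, Q.H31 t ω)) := by
  refine ⟨fun z w => Q.charlie.μ.real {r | r ∈ Q.charlie.follows () Prod.snd Prod.fst t w.1 w.2 ∧
      Q.output r w.1.extend w.2.extend = z},
    fun v w => (Q.aliceProb pX fun x r => x = v.1.1 ∧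
      r ∈ Q.alice.follows x Prod.fst Prod.snd t v.2 w.2) *
      (Q.bobProb pY fun y r => y = v.1.2 ∧ r ∈ Q.bob.follows y Prod.snd Prod.fst t v.2 w.1),
    fun z v w => ?_⟩
  rw [mul_comm (Q.charlie.μ.real _), ← law_real_rect]
  · congr 1
    ext ω
    have := Q.hist_iff t ω v.2 w.1 w.2
    simp only [Set.mem_ofPred_eq, Prod.ext_iff, ZhatT]
    constructor
    · rintro ⟨hz, ⟨⟨hx, hy⟩, h1⟩, h2, h3⟩
      obtain ⟨ha, hb, hc⟩ := this.1 ⟨h1, h2, h3⟩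
      rw [h2, h3] at hz
      exact ⟨⟨hx, ha⟩, ⟨hy, hb⟩, hc, hz⟩
    · rintro ⟨⟨hx, ha⟩, ⟨hy, hb⟩, hc, hz⟩
      obtain ⟨h1, h2, h3⟩ := this.2 ⟨ha, hb, hc⟩
      rw [h2, h3]
      exact ⟨hz, ⟨⟨hx, hy⟩, h1⟩, rfl, rfl⟩
  · exact fun x' => (MeasurableSet.const _).inter (Q.alice.measurableSet_follows _ _ _ _ _ _)
  · exact fun x' => (MeasurableSet.const _).inter (Q.bob.measurableSet_follows _ _ _ _ _ _)
  · exact (Q.charlie.measurableSet_follows _ _ _ _ _ _).inter (Q.measurable_output _ _ _)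

lemma factorizes_alice_next (t : ℕ) : Factorizes (Q.law (pX.prod pY))
    (fun ω => ((Q.M12 ω t).1, (Q.M31 ω t).2)) (Q.H23 t) (fun ω => (Q.H12 t ω, Q.H31 t ω)) := by
  refine ⟨fun u w => Q.aliceProb pX fun x r => r ∈ Q.alice.follows x Prod.fst Prod.snd t w.1 w.2 ∧
      Q.alice.next x r w.1 w.2 = u,
    fun v w => (Q.bobProb pY fun y r => r ∈ Q.bob.follows y Prod.snd Prod.fst t w.1 v) *
      Q.charlie.μ.real {r | r ∈ Q.charlie.follows () Prod.snd Prod.fst t v w.2},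
    fun u v w => ?_⟩
  rw [← mul_assoc, ← law_real_rect]
  · congr 1
    ext ω
    have := Q.hist_iff t ω w.1 v w.2
    rw [Set.mem_ofPred_eq, Set.mem_ofPred_eq]
    dsimp only
    rw [← alice_next]
    simp only [Prod.ext_iff (y := w)]
    constructor
    · rintro ⟨hu, h2, h1, h3⟩
      obtain ⟨ha, hb, hc⟩ := this.1 ⟨h1, h2, h3⟩
      rw [h1, h3] at hu
      exact ⟨⟨ha, hu⟩, hb, hc⟩
    · rintro ⟨⟨ha, hu⟩, hb, hc⟩
      obtain ⟨h1, h2, h3⟩ := this.2 ⟨ha, hb, hc⟩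
      rw [h1, h3]
      exact ⟨hu, h2, rfl, rfl⟩
  · exact fun x' => (Q.alice.measurableSet_follows _ _ _ _ _ _).inter (Q.alice.measurable_next _ _ _ _)
  · exact fun x' => Q.bob.measurableSet_follows _ _ _ _ _ _
  · exact Q.charlie.measurableSet_follows _ _ _ _ _ _

/-- Bob is taken to speak after Alice within the round: her new messages are already on the links,
although his own do not depend on them. -/
lemma factorizes_bob_next (t : ℕ) : Factorizes (Q.law (pX.prod pY))
    (fun ω => ((Q.M12 ω t).2, (Q.M23 ω t).1)) (fun ω => (Q.H31 t ω, (Q.M31 ω t).2))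
    (fun ω => ((Q.H12 t ω, (Q.M12 ω t).1), Q.H23 t ω)) := by
  refine ⟨fun u w => Q.bobProb pY fun y r => r ∈ Q.bob.follows y Prod.snd Prod.fst t w.1.1 w.2 ∧
      Q.bob.next y r w.1.1 w.2 = u,
    fun v w => (Q.aliceProb pX fun x r => r ∈ Q.alice.follows x Prod.fst Prod.snd t w.1.1 v.1 ∧
      Q.alice.next x r w.1.1 v.1 = (w.1.2, v.2)) *
      Q.charlie.μ.real {r | r ∈ Q.charlie.follows () Prod.snd Prod.fst t w.2 v.1},
    fun u v w => ?_⟩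
  rw [← mul_assoc, mul_comm (Q.bobProb pY _), ← law_real_rect]
  · congr 1
    ext ω
    have := Q.hist_iff t ω w.1.1 w.2 v.1
    have ea := Q.alice_next t ω
    have eb := Q.bob_next t ω
    rw [Set.mem_ofPred_eq, Set.mem_ofPred_eq]
    dsimp only
    rw [← eb]
    simp only [Prod.ext_iff (y := w), Prod.ext_iff (y := w.1), Prod.ext_iff (y := v)]
    constructor
    · rintro ⟨hu, ⟨h3, hv⟩, ⟨h1, hw⟩, h2⟩
      obtain ⟨ha, hb, hc⟩ := this.1 ⟨h1, h2, h3⟩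
      rw [h1, h2] at hu
      rw [h1, h3, hw, hv] at ea
      exact ⟨⟨ha, ea⟩, ⟨hb, hu⟩, hc⟩
    · rintro ⟨⟨ha, hv⟩, ⟨hb, hu⟩, hc⟩
      obtain ⟨h1, h2, h3⟩ := this.2 ⟨ha, hb, hc⟩
      rw [h1, h3, hv, Prod.mk.injEq] at ea
      rw [h1, h2]
      exact ⟨hu, ⟨h3, ea.2.symm⟩, ⟨rfl, ea.1.symm⟩, rfl⟩
  · exact fun x' => (Q.alice.measurableSet_follows _ _ _ _ _ _).inter (Q.alice.measurable_next _ _ _ _)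
  · exact fun x' => (Q.bob.measurableSet_follows _ _ _ _ _ _).inter (Q.bob.measurable_next _ _ _ _)
  · exact Q.charlie.measurableSet_follows _ _ _ _ _ _

lemma factorizes_charlie_next (t : ℕ) : Factorizes (Q.law (pX.prod pY))
    (fun ω => ((Q.M23 ω t).2, (Q.M31 ω t).1))
    (fun ω => ((Q.H12 t ω, (Q.M12 ω t).1), (Q.M12 ω t).2))
    (fun ω => ((Q.H23 t ω, (Q.M23 ω t).1), (Q.H31 t ω, (Q.M31 ω t).2))) := by
  refine ⟨fun u w => Q.charlie.μ.real {r |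
      r ∈ Q.charlie.follows () Prod.snd Prod.fst t w.1.1 w.2.1 ∧
      Q.charlie.next () r w.1.1 w.2.1 = u},
    fun v w => (Q.aliceProb pX fun x r =>
      r ∈ Q.alice.follows x Prod.fst Prod.snd t v.1.1 w.2.1 ∧
      Q.alice.next x r v.1.1 w.2.1 = (v.1.2, w.2.2)) *
      (Q.bobProb pY fun y r => r ∈ Q.bob.follows y Prod.snd Prod.fst t v.1.1 w.1.1 ∧
      Q.bob.next y r v.1.1 w.1.1 = (v.2, w.1.2)),
    fun u v w => ?_⟩
  rw [mul_comm (Q.charlie.μ.real _), ← law_real_rect]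
  · congr 1
    ext ω
    have := Q.hist_iff t ω v.1.1 w.1.1 w.2.1
    have ea := Q.alice_next t ω
    have eb := Q.bob_next t ω
    rw [Set.mem_ofPred_eq, Set.mem_ofPred_eq]
    dsimp only
    rw [← charlie_next]
    simp only [Prod.ext_iff (y := w), Prod.ext_iff (y := w.1), Prod.ext_iff (y := w.2),
      Prod.ext_iff (y := v), Prod.ext_iff (y := v.1)]
    constructor
    · rintro ⟨hu, ⟨⟨h1, hv1⟩, hv2⟩, ⟨h2, hw1⟩, ⟨h3, hw2⟩⟩
      obtain ⟨ha, hb, hc⟩ := this.1 ⟨h1, h2, h3⟩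
      rw [h2, h3] at hu
      rw [h1, h3, hv1, hw2] at ea
      rw [h1, h2, hv2, hw1] at eb
      exact ⟨⟨ha, ea⟩, ⟨hb, eb⟩, hc, hu⟩
    · rintro ⟨⟨ha, hva⟩, ⟨hb, hvb⟩, hc, hu⟩
      obtain ⟨h1, h2, h3⟩ := this.2 ⟨ha, hb, hc⟩
      rw [h1, h3, hva, Prod.mk.injEq] at ea
      rw [h1, h2, hvb, Prod.mk.injEq] at eb
      rw [h2, h3]
      exact ⟨hu, ⟨⟨h1, ea.1.symm⟩, eb.1.symm⟩, ⟨rfl, eb.2.symm⟩, ⟨rfl, ea.2.symm⟩⟩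
  · exact fun x' => (Q.alice.measurableSet_follows _ _ _ _ _ _).inter (Q.alice.measurable_next _ _ _ _)
  · exact fun x' => (Q.bob.measurableSet_follows _ _ _ _ _ _).inter (Q.bob.measurable_next _ _ _ _)
  · exact (Q.charlie.measurableSet_follows _ _ _ _ _ _).inter (Q.charlie.measurable_next _ _ _ _)

lemma H12_succ (t : ℕ) (ω : Q.Outcome) : Q.H12 (t + 1) ω = Q.H12 t ω ++ [Q.M12 ω t] := by
  rw [H12_eq, H12_eq, LinkTranscript.take_succ]

lemma H23_succ (t : ℕ) (ω : Q.Outcome) : Q.H23 (t + 1) ω = Q.H23 t ω ++ [Q.M23 ω t] := by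
  rw [H23_eq, H23_eq, LinkTranscript.take_succ]

lemma H31_succ (t : ℕ) (ω : Q.Outcome) : Q.H31 (t + 1) ω = Q.H31 t ω ++ [Q.M31 ω t] := by
  rw [H31_eq, H31_eq, LinkTranscript.take_succ]

/-- Induction on the rounds. The simultaneous messages of a round are revealed in the order Alice,
Bob, Charlie, and each time the monotonicity lemma applies with the link not touched by the speaker
in the middle position. -/
lemma coinfo_nonneg (h₁₂ : ∀ t, FiniteEntropy (Q.law (pX.prod pY)) (Q.H12 t))
    (h₂₃ : ∀ t, FiniteEntropy (Q.law (pX.prod pY)) (Q.H23 t))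
    (h₃₁ : ∀ t, FiniteEntropy (Q.law (pX.prod pY)) (Q.H31 t)) (t : ℕ) :
    0 ≤ coinfo (Q.law (pX.prod pY)) (Q.H12 t) (Q.H23 t) (Q.H31 t) := by
  induction t with
  | zero =>
    have hc : ∀ {κ : Type} (c : κ), ent (Q.law (pX.prod pY)) (fun _ => c) = 0 := fun c => by
      rw [ent, entropy_const]; rfl
    have e1 : Q.H12 0 = fun _ => [] := rfl
    have e2 : Q.H23 0 = fun _ => [] := rfl
    have e3 : Q.H31 0 = fun _ => [] := rfl
    rw [coinfo, e1, e2, e3]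
    simp [hc]
  | succ t ih =>
    set μ := Q.law (pX.prod pY)
    have g₁₂ : FiniteEntropy μ (fun ω => Q.M12 ω t) := by
      have := (h₁₂ (t + 1)).comp fun h => h.getLastD ([], [])
      simpa [H12_succ] using this
    have g₂₃ : FiniteEntropy μ (fun ω => Q.M23 ω t) := by
      have := (h₂₃ (t + 1)).comp fun h => h.getLastD ([], [])
      simpa [H23_succ] using this
    have g₃₁ : FiniteEntropy μ (fun ω => Q.M31 ω t) := by
      have := (h₃₁ (t + 1)).comp fun h => h.getLastD ([], [])
      simpa [H31_succ] using this
    have a1 := g₁₂.comp Prod.fst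
    have a2 := g₃₁.comp Prod.snd
    have b1 := g₁₂.comp Prod.snd
    have b2 := g₂₃.comp Prod.fst
    have c1 := g₂₃.comp Prod.snd
    have c2 := g₃₁.comp Prod.fst
    have s1 := coinfo_le_of_factorizes (h₁₂ t) (h₂₃ t) (h₃₁ t) a1 a2 (Q.factorizes_alice_next pX pY t)
    have p12 := (h₁₂ t).prodMk a1
    have p31 := (h₃₁ t).prodMk a2
    have s2 := coinfo_le_of_factorizes p12 p31 (h₂₃ t) b1 b2 (Q.factorizes_bob_next pX pY t)
    have q12 := p12.prodMk b1
    have q23 := (h₂₃ t).prodMk b2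
    have s3 := coinfo_le_of_factorizes q23 q12 p31 c1 c2 (Q.factorizes_charlie_next pX pY t)
    have r23 := q23.prodMk c1
    have r31 := p31.prodMk c2
    rw [coinfo_swap_right p12 (h₂₃ t) p31] at s1
    rw [coinfo_rotate q12 p31 q23, coinfo_rotate p31 q23 q12] at s2
    have e : coinfo μ (fun ω => ((Q.H23 t ω, (Q.M23 ω t).1), (Q.M23 ω t).2))
        (fun ω => ((Q.H12 t ω, (Q.M12 ω t).1), (Q.M12 ω t).2))
        (fun ω => ((Q.H31 t ω, (Q.M31 ω t).2), (Q.M31 ω t).1)) =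
        coinfo μ (Q.H23 (t + 1)) (Q.H12 (t + 1)) (Q.H31 (t + 1)) :=
      coinfo_congr r23 q12 r31
        (fun x => x.1.1 ++ [(x.1.2, x.2)])
        (fun h => ((h.dropLast, (h.getLastD ([], [])).1), (h.getLastD ([], [])).2))
        (fun x => x.1.1 ++ [(x.1.2, x.2)])
        (fun h => ((h.dropLast, (h.getLastD ([], [])).1), (h.getLastD ([], [])).2))
        -- On link 31 Alice's message is the second component but was revealed first.
        (fun x => x.1.1 ++ [(x.2, x.1.2)])
        (fun h => ((h.dropLast, (h.getLastD ([], [])).2), (h.getLastD ([], [])).1))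
        (Q.H23_succ t) (fun ω => by simp [H23_succ]) (Q.H12_succ t) (fun ω => by simp [H12_succ])
        (Q.H31_succ t) (fun ω => by simp [H31_succ])
    rw [coinfo_rotate (h₁₂ (t + 1)) (h₂₃ (t + 1)) (h₃₁ (t + 1)),
      coinfo_swap_right (h₂₃ (t + 1)) (h₃₁ (t + 1)) (h₁₂ (t + 1)), ← e]
    linarith

end Factorizations

end BlockProtocol

end

end SecureComp

namespace SecureComp

set_option linter.unusedSectionVars false

noncomputable section

/-! ### From conditional mutual information to real-valued entropies -/

section Leakage

variable {Ω α β γ δ : Type*} [MeasurableSpace Ω] {μ : Measure Ω} [IsProbabilityMeasure μ]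

/-- A bound on the conditional mutual information of `U` and `V` is a bound for each function of
`U`. -/
lemma ent_sub_le_of_condMutualInfo [Finite β] [Finite γ] {U : Ω → α} {V : Ω → β} {W : Ω → γ}
    (hU : IsDiscrete μ U) (hV : IsDiscrete μ V) (hW : IsDiscrete μ W) {ε : ℝ≥0∞} (hε : ε ≠ ∞)
    (h : condMutualInfo μ U V W ≤ ε) {M : Ω → δ} (hM : FiniteEntropy μ M) (g : α → δ)
    (hg : ∀ ω, M ω = g (U ω)) :
    (ent μ (fun ω => (V ω, W ω)) - ent μ W) -
      (ent μ (fun ω => (V ω, M ω, W ω)) - ent μ (fun ω => (M ω, W ω))) ≤ ε.toReal := by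
  obtain rfl : M = fun ω => g (U ω) := funext hg
  have hV' := hV.finiteEntropy
  have hW' := hW.finiteEntropy
  have h1 : condEntropy μ V W ≤ condEntropy μ V (fun ω => (g (U ω), W ω)) + ε := by
    rw [condMutualInfo, tsub_le_iff_left] at h
    exact h.trans (add_le_add_left (condEntropy_le_comp_right hV (hU.prodMk hW)
      fun x => (g x.1, x.2)) _)
  have h2 := hV'.condEntropy_ne_top (hM.prodMk hW').1
  have h3 := ENNReal.toReal_mono (ENNReal.add_ne_top.2 ⟨h2, hε⟩) h1
  rw [ENNReal.toReal_add h2 hε, toReal_condEntropy hV' hW',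
    toReal_condEntropy hV' (hM.prodMk hW')] at h3
  linarith

/-- Perfect privacy of a pair implies perfect privacy of its first entry. -/
lemma condMutualInfo_fst_eq_zero [Finite β] [Finite δ] {U : Ω → α} {V : Ω → β} {V' : Ω → δ}
    {W : Ω → γ} (hU : IsDiscrete μ U) (hV : IsDiscrete μ V) (hV' : IsDiscrete μ V')
    (hW : IsDiscrete μ W) (h : condMutualInfo μ U (fun ω => (V ω, V' ω)) W = 0) :
    condMutualInfo μ U V W = 0 := by
  have hUW := hU.prodMk hW
  rw [condMutualInfo, tsub_eq_zero_iff_le] at h ⊢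
  have e1 : condEntropy μ (fun ω => (V ω, V' ω)) W = condEntropy μ (fun ω => (V' ω, V ω)) W :=
    condEntropy_comp_injective_left Prod.swap_injective (fun ω => (V' ω, V ω)) W
  have e2 : condEntropy μ (fun ω => (V ω, V' ω)) (fun ω => (U ω, W ω)) =
      condEntropy μ (fun ω => (V' ω, V ω)) (fun ω => (U ω, W ω)) :=
    condEntropy_comp_injective_left Prod.swap_injective (fun ω => (V' ω, V ω)) _
  rw [e1, e2, condEntropy_prod_left hV' hV hW, condEntropy_prod_left hV' hV hUW] at h
  have h1 : condEntropy μ V' (fun ω => (V ω, U ω, W ω)) ≤ condEntropy μ V' (fun ω => (V ω, W ω)) :=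
    condEntropy_le_comp_right hV' (hV.prodMk hUW) fun x => (x.1, x.2.2)
  have h2 : condEntropy μ V' (fun ω => (V ω, W ω)) ≠ ∞ :=
    hV'.finiteEntropy.condEntropy_ne_top (hV.prodMk hW)
  exact (ENNReal.add_le_add_iff_right h2).1 (h.trans (add_le_add_right h1 _))

end Leakage

namespace BlockProtocol

/-! ### Entropy of i.i.d. inputs and leakage about them -/

section Input

variable {𝒳 𝒴 𝒵 κ : Type} {n : ℕ} (Q : BlockProtocol 𝒳 𝒴 𝒵 n)
  [MeasurableSpace 𝒳] [MeasurableSpace 𝒴]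
  [Fintype 𝒳] [Fintype 𝒴] [MeasurableSingletonClass 𝒳] [MeasurableSingletonClass 𝒴]
  (P : Measure (𝒳 × 𝒴)) [IsProbabilityMeasure P]

lemma law_real_input (A : Set (Fin n → 𝒳 × 𝒴)) :
    (Q.law P).real {ω | ω.1 ∈ A} = (Measure.pi fun _ : Fin n => P).real A := by
  have : {ω : Q.Outcome | ω.1 ∈ A} = A ×ˢ Set.univ := by ext ω; simp
  rw [this, law, measureReal_prod_prod]
  simp

lemma law_real_block (φ : 𝒳 × 𝒴 → κ) (c : Fin n → κ) :
    (Q.law P).real {ω | (fun i => φ (ω.1 i)) = c} = ∏ i, P.real {p | φ p = c i} := by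
  have : {ω : Q.Outcome | (fun i => φ (ω.1 i)) = c} =
      {ω | ω.1 ∈ Set.pi Set.univ fun i => {p | φ p = c i}} := by
    ext ω; simp [funext_iff]
  rw [this, law_real_input, measureReal_def, Measure.pi_pi, ENNReal.toReal_prod]
  rfl

lemma law_real_entry (φ : 𝒳 × 𝒴 → κ) (i : Fin n) (a : κ) :
    (Q.law P).real {ω | φ (ω.1 i) = a} = P.real {p | φ p = a} := by
  have := Q.law_real_input P {v | φ (v i) = a}
  rw [show {ω : Q.Outcome | φ (ω.1 i) = a} = {ω | ω.1 ∈ {v : Fin n → 𝒳 × 𝒴 | φ (v i) = a}} from rfl,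
    this]
  have h := (measurePreserving_eval (fun _ : Fin n => P) i).measure_preimage
    (s := {p | φ p = a}) (Set.toFinite _).measurableSet.nullMeasurableSet
  rw [measureReal_def, measureReal_def, ← h]
  rfl

lemma isDiscrete_block (φ : 𝒳 × 𝒴 → κ) :
    IsDiscrete (Q.law P) (fun ω i => φ (ω.1 i)) :=
  (Q.isDiscrete_input P).comp fun v i => φ (v i)

lemma ent_entry (φ : 𝒳 × 𝒴 → κ) (i : Fin n) :
    ent (Q.law P) (fun ω => φ (ω.1 i)) = (entropy P φ).toReal := by
  simp only [ent, entropy, law_real_entry]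

variable [Fintype κ]

lemma ent_block (φ : 𝒳 × 𝒴 → κ) :
    ent (Q.law P) (fun ω i => φ (ω.1 i)) = ∑ i, ent (Q.law P) (fun ω => φ (ω.1 i)) :=
  ent_pi (Q.isDiscrete_block P φ) fun s => by
    rw [law_real_block]
    simp_rw [law_real_entry]

lemma ent_block_eq (φ : 𝒳 × 𝒴 → κ) :
    ent (Q.law P) (fun ω i => φ (ω.1 i)) = n * (entropy P φ).toReal := by
  rw [ent_block]
  simp [ent_entry]

/-- The information about the inputs which is revealed by `M` to somebody who knows the function
`φ` of each pair of inputs. -/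
def leak {δ : Type*} (M : Q.Outcome → δ) (φ : 𝒳 × 𝒴 → κ) : ℝ :=
  ent (Q.law P) (fun ω => ω.1) - ent (Q.law P) (fun ω => (ω.1, M ω)) -
    ent (Q.law P) (fun ω i => φ (ω.1 i)) + ent (Q.law P) (fun ω => ((fun i => φ (ω.1 i)), M ω))

/-- The information about the inputs which is revealed by `M`. -/
def info {δ : Type*} (M : Q.Outcome → δ) : ℝ :=
  ent (Q.law P) (fun ω => ω.1) + ent (Q.law P) M - ent (Q.law P) (fun ω => (ω.1, M ω))

variable {κ' : Type} [Fintype κ']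

/-- `δ` refers to a single pair of inputs, so the constant is the same for all block lengths. -/
lemma info_le {δ' : Type*} {M : Q.Outcome → δ'} (hM : FiniteEntropy (Q.law P) M)
    {φ : 𝒳 × 𝒴 → κ} {ψ : 𝒳 × 𝒴 → κ'} (h : ∀ i j, ∃ k, φ k = φ i ∧ ψ k = ψ j) {δ : ℝ} (hδ : 0 < δ)
    (hP : ∀ p, δ ≤ P.real {p}) :
    Q.info P M ≤ (1 + 32 / δ ^ 2) * (Q.leak P M φ + Q.leak P M ψ) := by
  classical
  exact mutualInfo_block_le h (Q.isDiscrete_input P) hM hδ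
    (fun i u => (hP u).trans_eq (Q.law_real_entry P id i u).symm)
    (Q.ent_block P id) (Q.ent_block P φ) (Q.ent_block P ψ)

variable {ε : ℝ≥0∞} {δ : Type*} {M : Q.Outcome → δ}

/-- Since `X` and `Y` make up the input, `leak` for the first projection is `I(M;Y|X)`, and `M` is a
function of what Alice sees. -/
lemma leak_le_of_alice (hM : FiniteEntropy (Q.law P) M) (g : LinkTranscript × LinkTranscript → δ)
    (hg : ∀ ω, M ω = g (Q.M12 ω, Q.M31 ω)) (hε : ε ≠ ∞)
    (h : condMutualInfo (Q.law P) (fun ω => (Q.M12 ω, Q.M31 ω)) Q.Y Q.X ≤ ε) :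
    Q.leak P M Prod.fst ≤ ε.toReal := by
  have hin := (Q.isDiscrete_input P).finiteEntropy
  have h1 := ent_sub_le_of_condMutualInfo ((Q.isDiscrete_M12 P).prodMk (Q.isDiscrete_M31 P))
    (Q.isDiscrete_Y P) (Q.isDiscrete_X P) hε h hM g hg
  have e1 := ent_congr hin (V := fun ω => (Q.Y ω, Q.X ω))
    (fun v => (fun i => (v i).2, fun i => (v i).1)) (fun q i => (q.2 i, q.1 i)) (fun _ => rfl)
    fun _ => rfl
  have e2 := ent_congr (hin.prodMk hM) (V := fun ω => (Q.Y ω, M ω, Q.X ω))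
    (fun v => (fun i => (v.1 i).2, v.2, fun i => (v.1 i).1)) (fun q => (fun i => (q.2.2 i, q.1 i), q.2.1))
    (fun _ => rfl) fun _ => rfl
  have e3 := ent_swap (Q.isDiscrete_X P).finiteEntropy hM
  unfold leak
  change _ - _ - ent (Q.law P) Q.X + ent (Q.law P) (fun ω => (Q.X ω, M ω)) ≤ _
  linarith

lemma leak_le_of_bob (hM : FiniteEntropy (Q.law P) M) (g : LinkTranscript × LinkTranscript → δ)
    (hg : ∀ ω, M ω = g (Q.M12 ω, Q.M23 ω)) (hε : ε ≠ ∞)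
    (h : condMutualInfo (Q.law P) (fun ω => (Q.M12 ω, Q.M23 ω)) Q.X Q.Y ≤ ε) :
    Q.leak P M Prod.snd ≤ ε.toReal := by
  have hin := (Q.isDiscrete_input P).finiteEntropy
  have h1 := ent_sub_le_of_condMutualInfo ((Q.isDiscrete_M12 P).prodMk (Q.isDiscrete_M23 P))
    (Q.isDiscrete_X P) (Q.isDiscrete_Y P) hε h hM g hg
  have e1 := ent_congr hin (V := fun ω => (Q.X ω, Q.Y ω))
    (fun v => (fun i => (v i).1, fun i => (v i).2)) (fun q i => (q.1 i, q.2 i)) (fun _ => rfl)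
    fun _ => rfl
  have e2 := ent_congr (hin.prodMk hM) (V := fun ω => (Q.X ω, M ω, Q.Y ω))
    (fun v => (fun i => (v.1 i).1, v.2, fun i => (v.1 i).2)) (fun q => (fun i => (q.1 i, q.2.2 i), q.2.1))
    (fun _ => rfl) fun _ => rfl
  have e3 := ent_swap (Q.isDiscrete_Y P).finiteEntropy hM
  unfold leak
  change _ - _ - ent (Q.law P) Q.Y + ent (Q.law P) (fun ω => (Q.Y ω, M ω)) ≤ _
  linarith

lemma leak_le_of_charlie [Finite 𝒵] {f : 𝒳 → 𝒴 → 𝒵} (hM : FiniteEntropy (Q.law P) M)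
    (g : LinkTranscript × LinkTranscript → δ)
    (hg : ∀ ω, M ω = g (Q.M23 ω, Q.M31 ω)) (hε : ε ≠ ∞)
    (h : condMutualInfo (Q.law P) (fun ω => (Q.M23 ω, Q.M31 ω)) (fun ω => (Q.X ω, Q.Y ω)) (Q.Z f) ≤ ε) :
    Q.leak P M (fun p => f p.1 p.2) ≤ ε.toReal := by
  have hin := (Q.isDiscrete_input P).finiteEntropy
  have h1 := ent_sub_le_of_condMutualInfo ((Q.isDiscrete_M23 P).prodMk (Q.isDiscrete_M31 P))
    ((Q.isDiscrete_X P).prodMk (Q.isDiscrete_Y P)) (Q.isDiscrete_Z P f) hε h hM g hg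
  have e1 := ent_congr hin (V := fun ω => ((Q.X ω, Q.Y ω), Q.Z f ω))
    (fun v => ((fun i => (v i).1, fun i => (v i).2), fun i => f (v i).1 (v i).2))
    (fun q i => (q.1.1 i, q.1.2 i)) (fun _ => rfl) fun _ => rfl
  have e2 := ent_congr (hin.prodMk hM) (V := fun ω => ((Q.X ω, Q.Y ω), M ω, Q.Z f ω))
    (fun v => ((fun i => (v.1 i).1, fun i => (v.1 i).2), v.2, fun i => f (v.1 i).1 (v.1 i).2))
    (fun q => (fun i => (q.1.1 i, q.1.2 i), q.2.1)) (fun _ => rfl) fun _ => rfl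
  have e3 := ent_swap (Q.isDiscrete_Z P f).finiteEntropy hM
  unfold leak
  change _ - _ - ent (Q.law P) (Q.Z f) + ent (Q.law P) (fun ω => (Q.Z f ω, M ω)) ≤ _
  linarith

end Input

/-! ### Expected number of bits and entropy of the histories -/

section Bits

variable {𝒳 𝒴 𝒵 : Type} {n : ℕ} (Q : BlockProtocol 𝒳 𝒴 𝒵 n)
  [MeasurableSpace 𝒳] [MeasurableSpace 𝒴]
  [Fintype 𝒳] [Fintype 𝒴] [MeasurableSingletonClass 𝒳] [MeasurableSingletonClass 𝒴]
  (P : Measure (𝒳 × 𝒴)) [IsProbabilityMeasure P]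

lemma entropy_H12_le (t : ℕ) :
    entropy (Q.law P) (Q.H12 t) ≤ ∫⁻ ω, totalLength (Q.M12 ω) ∂Q.law P := by
  rw [funext (Q.H12_eq t)]
  refine entropy_take_le_lintegral (Q.isDiscrete_M12 P) Q.code12 Q.prefixFree12 ?_ t
  refine Q.ae_law_of_forall P fun v => ?_
  filter_upwards [Q.mem_code12 (fun i => (v i).1) (fun i => (v i).2)] with r hr t
  have := hr t
  rwa [PreProtocol.hist_eq_take] at this

lemma entropy_H23_le (t : ℕ) :
    entropy (Q.law P) (Q.H23 t) ≤ ∫⁻ ω, totalLength (Q.M23 ω) ∂Q.law P := by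
  rw [funext (Q.H23_eq t)]
  refine entropy_take_le_lintegral (Q.isDiscrete_M23 P) Q.code23 Q.prefixFree23 ?_ t
  refine Q.ae_law_of_forall P fun v => ?_
  filter_upwards [Q.mem_code23 (fun i => (v i).1) (fun i => (v i).2)] with r hr t
  have := hr t
  rwa [PreProtocol.hist_eq_take] at this

lemma entropy_H31_le (t : ℕ) :
    entropy (Q.law P) (Q.H31 t) ≤ ∫⁻ ω, totalLength (Q.M31 ω) ∂Q.law P := by
  rw [funext (Q.H31_eq t)]
  refine entropy_take_le_lintegral (Q.isDiscrete_M31 P) Q.code31 Q.prefixFree31 ?_ t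
  refine Q.ae_law_of_forall P fun v => ?_
  filter_upwards [Q.mem_code31 (fun i => (v i).1) (fun i => (v i).2)] with r hr t
  have := hr t
  rwa [PreProtocol.hist_eq_take] at this

end Bits

/-! ### Entropy bounds for protocols computing a sum -/

section Sum

variable {F : Type} [Field F] [Fintype F] [MeasurableSpace F] [MeasurableSingletonClass F]
  {n : ℕ} (Q : BlockProtocol F F F n)
  (pX pY : Measure F) [IsProbabilityMeasure pX] [IsProbabilityMeasure pY]

/-- The bounds for the entropies of the histories, for a protocol which computes the sum with
probability of error less than `e`, if the histories of the links of Charlie are nearly independent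
of the inputs. -/
lemma exists_ent_hist_ge (h₁₂ : ∀ t, FiniteEntropy (Q.law (pX.prod pY)) (Q.H12 t))
    (h₂₃ : ∀ t, FiniteEntropy (Q.law (pX.prod pY)) (Q.H23 t))
    (h₃₁ : ∀ t, FiniteEntropy (Q.law (pX.prod pY)) (Q.H31 t)) {d e s : ℝ} (hd : 0 ≤ d)
    (hd₂₃ : ∀ t, Q.info (pX.prod pY) (Q.H23 t) ≤ d) (hd₃₁ : ∀ t, Q.info (pX.prod pY) (Q.H31 t) ≤ d)
    (he : (Q.law (pX.prod pY)).real {ω | Q.Zhat ω ≠ Q.Z (fun x y => x + y) ω} < e)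
    (hs0 : 0 < s) (hs1 : s < 1) :
    ∃ t, ∀ c ∈ ({ent (Q.law (pX.prod pY)) (Q.H12 t), ent (Q.law (pX.prod pY)) (Q.H23 t),
        ent (Q.law (pX.prod pY)) (Q.H31 t)} : Set ℝ),
      n * (entropy (pX.prod pY) (fun p : F × F => p.1 + p.2)).toReal - 2 * d -
        3 * (Real.logb 2 (1 / (1 - s)) + e * Real.logb 2 (Fintype.card F ^ n / s)) ≤ c := by
  set μ := Q.law (pX.prod pY)
  -- The strict inequality in `he` leaves room for the loss of truncating the protocol after `t`
  -- rounds.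
  obtain ⟨t, ht⟩ := Q.exists_ZhatT_ne_lt (pX.prod pY) _ he
  refine ⟨t, ?_⟩
  have hZ := Q.isDiscrete_Z (pX.prod pY) (fun x y : F => x + y)
  have hZ' := Q.isDiscrete_ZhatT (pX.prod pY) t
  have hX := (Q.isDiscrete_X (pX.prod pY)).finiteEntropy
  have hY := (Q.isDiscrete_Y (pX.prod pY)).finiteEntropy
  set φ := Real.logb 2 (1 / (1 - s)) + e * Real.logb 2 (Fintype.card F ^ n / s) with hφ
  have hN : (1 : ℝ) ≤ Fintype.card F := by exact_mod_cast Fintype.card_pos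
  have hl1 : 0 ≤ Real.logb 2 (Fintype.card F ^ n / s) := by
    refine Real.logb_nonneg one_lt_two ((one_le_div hs0).2 (hs1.le.trans (one_le_pow₀ hN)))
  have hl2 : 0 ≤ Real.logb 2 (1 / (1 - s)) :=
    Real.logb_nonneg one_lt_two ((one_le_div (by linarith)).2 (by linarith))
  have he0 : 0 ≤ e := measureReal_nonneg.trans he.le
  have hφ0 : 0 ≤ φ := add_nonneg hl2 (mul_nonneg he0 hl1)
  have hfano : ent μ (fun ω => (Q.Z (fun x y => x + y) ω, Q.ZhatT t ω)) - ent μ (Q.ZhatT t) ≤ φ := by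
    rw [← toReal_condEntropy hZ.finiteEntropy hZ'.finiteEntropy]
    refine ENNReal.toReal_le_of_le_ofReal hφ0 ((fano hZ hZ' hs0 hs1).trans ?_)
    apply ENNReal.ofReal_le_ofReal
    rw [hφ]
    simp only [Fintype.card_pi, Finset.prod_const, Finset.card_univ, Fintype.card_fin, Nat.cast_pow]
    have := mul_le_mul_of_nonneg_right ht.le hl1
    linarith
  have hin := (Q.isDiscrete_input (pX.prod pY)).finiteEntropy
  have e1 := ent_congr hin (V := fun ω => (Q.X ω, Q.Y ω))
    (fun v => (fun i => (v i).1, fun i => (v i).2)) (fun q i => (q.1 i, q.2 i)) (fun _ => rfl)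
    fun _ => rfl
  have e2 : ∀ M : Q.Outcome → LinkHist, FiniteEntropy μ M →
      ent μ (fun ω => (ω.1, M ω)) = ent μ (fun ω => ((Q.X ω, Q.Y ω), M ω)) := fun M hM =>
    ent_congr (hin.prodMk hM) (V := fun ω => ((Q.X ω, Q.Y ω), M ω))
      (fun v => ((fun i => (v.1 i).1, fun i => (v.1 i).2), v.2)) (fun q => (fun i => (q.1.1 i, q.1.2 i), q.2))
      (fun _ => rfl) fun _ => rfl
  have i23 := hd₂₃ t
  have i31 := hd₃₁ t
  unfold info at i23 i31
  rw [e1, e2 _ (h₂₃ t)] at i23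
  rw [e1, e2 _ (h₃₁ t)] at i31
  obtain ⟨b1, b2, b3⟩ := ent_links_ge (Z := Q.Z (fun x y => x + y)) (h₁₂ t) (h₂₃ t) (h₃₁ t) hX hY hZ'.finiteEntropy
    (fun q i => q.1 i + q.2 i) (fun z y i => z i - y i) (fun z x i => z i - x i)
    (fun _ => rfl) (fun ω => by funext i; simp [X, Y, Z]) (fun ω => by funext i; simp [X, Y, Z])
    (Q.factorizes_alice_input pX pY t) (Q.factorizes_bob_input pX pY t)
    (Q.factorizes_output pX pY t) (Q.coinfo_nonneg pX pY h₁₂ h₂₃ h₃₁ t) hfano i23 i31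
  have eZ : ent μ (Q.Z (fun x y => x + y)) =
      n * (entropy (pX.prod pY) (fun p : F × F => p.1 + p.2)).toReal :=
    Q.ent_block_eq (pX.prod pY) fun p : F × F => p.1 + p.2
  rw [eZ] at b1 b2 b3
  rintro c (rfl | rfl | rfl) <;> linarith

end Sum

end BlockProtocol

end

end SecureComp

namespace SecureComp

set_option linter.unusedSectionVars false

noncomputable section

/-! ### Independence and uniform distributions -/

section Independence

variable {Ω α β : Type*} [MeasurableSpace Ω] {μ : Measure Ω} [IsProbabilityMeasure μ]

lemma condEntropy_eq_entropy_of_indep {U : Ω → α} {V : Ω → β} (hU : IsDiscrete μ U)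
    (hV : IsDiscrete μ V)
    (h : ∀ u v, μ.real {ω | U ω = u ∧ V ω = v} = μ.real {ω | U ω = u} * μ.real {ω | V ω = v}) :
    condEntropy μ U V = entropy μ U := by
  rw [entropy_eq_condEntropy, ← condEntropy_prod_right_eq hU hV (isDiscrete_const ()),
    ← condEntropy_comp_injective_right (e := fun v : β => (v, ())) fun _ _ h => (Prod.ext_iff.1 h).1]
  intro u v w
  simp [h]

lemma entropy_uniform {α : Type*} [Fintype α] [Nonempty α] {U : Ω → α}
    (h : ∀ u, μ.real {ω | U ω = u} = (Fintype.card α : ℝ)⁻¹) :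
    (entropy μ U).toReal = Real.logb 2 (Fintype.card α) := by
  have hN : (Fintype.card α : ℝ) ≠ 0 := by exact_mod_cast Fintype.card_ne_zero
  have := ent_eq_sum (μ := μ) U
  rw [ent] at this
  rw [this]
  simp only [h, Real.negMulLog, Real.log_inv, Finset.sum_const, Finset.card_univ, nsmul_eq_mul,
    Real.logb]
  field_simp

/-- Strict Jensen inequality for `negMulLog` with equal weights. -/
lemma entropy_lt_of_not_uniform {α : Type*} [Fintype α] {U : Ω → α} (hU : IsDiscrete μ U)
    (h : ∃ u, μ.real {ω | U ω = u} ≠ (Fintype.card α : ℝ)⁻¹) :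
    (entropy μ U).toReal < Real.logb 2 (Fintype.card α) := by
  obtain ⟨u₀, hu₀⟩ := h
  have : Nonempty α := ⟨u₀⟩
  set p : α → ℝ := fun u => μ.real {ω | U ω = u} with hp
  have hN : (0 : ℝ) < Fintype.card α := by exact_mod_cast Fintype.card_pos
  have hsum : ∑ u, p u = 1 := by
    have := hU.hasSum_setOf (p := fun _ => True) (q := fun u ω => U ω = u) (μ := μ) (by simp)
      fun _ _ => by simp
    simpa using (hasSum_fintype _).unique this
  have hl2 : 0 < Real.log 2 := Real.log_pos one_lt_two
  have hne : ∃ j ∈ Finset.univ, ∃ k ∈ Finset.univ, p j ≠ p k := by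
    by_contra! hc
    apply hu₀
    have h1 : ∑ u, p u = Fintype.card α * p u₀ := by
      rw [Finset.sum_congr rfl fun u _ => hc u (Finset.mem_univ _) u₀ (Finset.mem_univ _)]
      simp
    rw [hsum] at h1
    exact eq_inv_of_mul_eq_one_right h1.symm
  have hJ := Real.strictConcaveOn_negMulLog.lt_map_sum (t := Finset.univ)
    (w := fun _ : α => (Fintype.card α : ℝ)⁻¹) (p := p) (fun _ _ => inv_pos.2 hN)
    (by simp [hN.ne']) (fun _ _ => measureReal_nonneg) hne
  simp only [smul_eq_mul] at hJ
  rw [← Finset.mul_sum, ← Finset.mul_sum, hsum, mul_one, Real.negMulLog, Real.log_inv,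
    neg_mul_neg, mul_lt_mul_iff_right₀ (inv_pos.2 hN)] at hJ
  have := ent_eq_sum (μ := μ) U
  rw [ent] at this
  rw [this, Real.logb]
  exact div_lt_div_of_pos_right hJ hl2

end Independence

namespace BlockProtocol

lemma ne_top_of_div_natCast {a : ℝ≥0∞} {n : ℕ} (h : a / n ≠ ∞) : a ≠ ∞ := by
  rintro rfl
  exact h (ENNReal.top_div_of_ne_top (ENNReal.natCast_ne_top n))

lemma toReal_le_mul_toReal_div {a b : ℝ≥0∞} {n : ℕ} (hn : n ≠ 0) (hab : a ≤ b) (h : b / n ≠ ∞) :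
    a.toReal ≤ n * (b / n).toReal := by
  have hn' : (n : ℝ) ≠ 0 := by exact_mod_cast hn
  rw [ENNReal.toReal_div, ENNReal.toReal_natCast, mul_div_cancel₀ _ hn']
  exact ENNReal.toReal_mono (ne_top_of_div_natCast h) hab

/-! ### From entropies of histories to rates; change of the input law -/

section Rates

variable {𝒳 𝒴 𝒵 : Type} {n : ℕ} (Q : BlockProtocol 𝒳 𝒴 𝒵 n)
  [MeasurableSpace 𝒳] [MeasurableSpace 𝒴]
  [Fintype 𝒳] [Fintype 𝒴] [MeasurableSingletonClass 𝒳] [MeasurableSingletonClass 𝒴]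
  (P : Measure (𝒳 × 𝒴)) [IsProbabilityMeasure P]

lemma finiteEntropy_hist (h : ∀ i, Q.rate P i ≠ ∞) (t : ℕ) :
    FiniteEntropy (Q.law P) (Q.H12 t) ∧ FiniteEntropy (Q.law P) (Q.H23 t) ∧
      FiniteEntropy (Q.law P) (Q.H31 t) :=
  ⟨⟨Q.isDiscrete_H12 P t, ((Q.entropy_H12_le P t).trans_lt
      (ne_top_of_div_natCast (h 0)).lt_top).ne⟩,
    ⟨Q.isDiscrete_H23 P t, ((Q.entropy_H23_le P t).trans_lt
      (ne_top_of_div_natCast (h 1)).lt_top).ne⟩,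
    ⟨Q.isDiscrete_H31 P t, ((Q.entropy_H31_le P t).trans_lt
      (ne_top_of_div_natCast (h 2)).lt_top).ne⟩⟩

/-- A common lower bound for the entropies of the histories is, up to the information about the
inputs which is revealed on link 31, a lower bound for the rates. -/
lemma le_rate (hn : n ≠ 0) (h : ∀ i, Q.rate P i ≠ ∞) {t : ℕ} {b d : ℝ} (hd0 : 0 ≤ d)
    (hd : Q.info P (Q.H31 t) ≤ d)
    (hb : ∀ c ∈ ({ent (Q.law P) (Q.H12 t), ent (Q.law P) (Q.H23 t),
      ent (Q.law P) (Q.H31 t)} : Set ℝ), b ≤ c) (i : Fin 4) :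
    b - d ≤ n * (Q.rate P i).toReal := by
  have b1 := hb (ent (Q.law P) (Q.H12 t)) (by simp)
  have b2 := hb (ent (Q.law P) (Q.H23 t)) (by simp)
  have b3 := hb (ent (Q.law P) (Q.H31 t)) (by simp)
  fin_cases i
  · have := toReal_le_mul_toReal_div hn (Q.entropy_H12_le P t) (h 0)
    exact (by linarith : b - d ≤ ent (Q.law P) (Q.H12 t)).trans this
  · have := toReal_le_mul_toReal_div hn (Q.entropy_H23_le P t) (h 1)
    exact (by linarith : b - d ≤ ent (Q.law P) (Q.H23 t)).trans this
  · have := toReal_le_mul_toReal_div hn (Q.entropy_H31_le P t) (h 2)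
    exact (by linarith : b - d ≤ ent (Q.law P) (Q.H31 t)).trans this
  -- The randomness is at least the conditional entropy of the history of link 31 given the inputs,
  -- which is its entropy minus `info`.
  · have hM := (Q.isDiscrete_M12 P).prodMk ((Q.isDiscrete_M23 P).prodMk (Q.isDiscrete_M31 P))
    have hin := Q.isDiscrete_input P
    have h31 := (Q.finiteEntropy_hist P h t).2.2
    have e1 : condEntropy (Q.law P) (fun ω => (Q.M12 ω, Q.M23 ω, Q.M31 ω))
        (fun ω => (Q.X ω, Q.Y ω)) =
        condEntropy (Q.law P) (fun ω => (Q.M12 ω, Q.M23 ω, Q.M31 ω)) (fun ω => ω.1) :=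
      condEntropy_comp_injective_right
        (e := fun v : Fin n → 𝒳 × 𝒴 => (fun i => (v i).1, fun i => (v i).2))
        (Equiv.arrowProdEquivProdArrow (Fin n) (fun _ => 𝒳) (fun _ => 𝒴)).injective _ _
    have e2 : condEntropy (Q.law P) (Q.H31 t) (fun ω => ω.1) ≤
        condEntropy (Q.law P) (fun ω => (Q.M12 ω, Q.M23 ω, Q.M31 ω)) (fun ω => (Q.X ω, Q.Y ω)) := by
      rw [e1, funext (Q.H31_eq t)]
      exact condEntropy_comp_left_le hM hin fun m => m.2.2.take t
    have e3 := toReal_le_mul_toReal_div hn e2 (h 3)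
    rw [toReal_condEntropy h31 hin.finiteEntropy, ent_swap h31 hin.finiteEntropy] at e3
    unfold info at hd
    exact (by linarith : b - d ≤ _).trans e3

/-- If the inputs have full support and `M` reveals nothing about them, then the law of `M` is the
same for all inputs. -/
lemma rand_real_eq {δ : Type*} {M : Q.Outcome → δ} (hM : FiniteEntropy (Q.law P) M)
    (hP : ∀ p, 0 < P.real {p}) (h : Q.info P M ≤ 0) (v : Fin n → 𝒳 × 𝒴) (m : δ) :
    Q.randMeasure.real {r | M (v, r) = m} = (Q.law P).real {ω | M ω = m} := by
  have hv : ∀ v : Fin n → 𝒳 × 𝒴, (Q.law P).real {ω | ω.1 = v} =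
      (Measure.pi fun _ : Fin n => P).real {v} := fun v => Q.law_real_input P {v}
  have hpos : ∀ v : Fin n → 𝒳 × 𝒴, 0 < (Measure.pi fun _ : Fin n => P).real {v} := fun v => by
    rw [pi_real_singleton]
    exact Finset.prod_pos fun i _ => hP _
  classical
  have h1 := indep_of_ent_eq (Q.isDiscrete_input P) hM (fun v => (hpos v).trans_eq (hv v).symm)
    (by unfold info at h; linarith) v m
  rw [hv] at h1
  have h2 : {ω : Q.Outcome | ω.1 = v ∧ M ω = m} = {v} ×ˢ {r | M (v, r) = m} := by
    ext ⟨w, r⟩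
    simp only [Set.mem_ofPred_eq, Set.mem_prod, Set.mem_singleton_iff]
    constructor <;> rintro ⟨rfl, h⟩ <;> exact ⟨rfl, h⟩
  rw [h2, law, measureReal_prod_prod] at h1
  exact mul_left_cancel₀ (hpos v).ne' h1

variable (P' : Measure (𝒳 × 𝒴)) [IsProbabilityMeasure P']

/-- What reveals nothing about inputs of full support has the same law for other laws of the
inputs, and reveals nothing about them. -/
lemma entropy_eq_of_info {δ : Type*} {M : Q.Outcome → δ} (hM : FiniteEntropy (Q.law P) M)
    (hM' : IsDiscrete (Q.law P') M)
    (hmeas : ∀ v m, MeasurableSet {r | M (v, r) = m}) (hP : ∀ p, 0 < P.real {p})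
    (h : Q.info P M ≤ 0) :
    FiniteEntropy (Q.law P') M ∧ ent (Q.law P') M = ent (Q.law P) M ∧ Q.info P' M ≤ 0 := by
  have h1 := Q.rand_real_eq P hM hP h
  have h2 : ∀ m, (Q.law P').real {ω | M ω = m} = (Q.law P).real {ω | M ω = m} := fun m => by
    rw [law_real_eq_sum]
    · simp only [Set.mem_ofPred_eq, h1]
      rw [← Finset.sum_mul]
      have : ∑ v, (Measure.pi fun _ : Fin n => P').real {v} = 1 := by simp
      rw [this, one_mul]
    · exact fun v => hmeas v m
  have h3 : entropy (Q.law P') M = entropy (Q.law P) M := by simp only [entropy, h2]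
  have hM2 : FiniteEntropy (Q.law P') M := ⟨hM', by rw [h3]; exact hM.2⟩
  have hin := Q.isDiscrete_input P'
  refine ⟨hM2, by rw [ent, ent, h3], ?_⟩
  have h4 : condEntropy (Q.law P') M (fun ω => ω.1) = entropy (Q.law P') M := by
    refine condEntropy_eq_entropy_of_indep hM' hin fun m v => ?_
    have e1 : {ω : Q.Outcome | M ω = m ∧ ω.1 = v} = {v} ×ˢ {r | M (v, r) = m} := by
      ext ⟨w, r⟩
      simp only [Set.mem_ofPred_eq, Set.mem_prod, Set.mem_singleton_iff]
      constructor
      · rintro ⟨h, rfl⟩; exact ⟨rfl, h⟩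
      · rintro ⟨rfl, h⟩; exact ⟨h, rfl⟩
    have e2 : (Q.law P').real {ω | ω.1 = v} = (Measure.pi fun _ : Fin n => P').real {v} :=
      Q.law_real_input P' {v}
    rw [e2, e1, law, measureReal_prod_prod, h1, ← h2, mul_comm]
    rfl
  have h5 := congrArg ENNReal.toReal h4
  rw [toReal_condEntropy hM2 hin.finiteEntropy, ent_swap hM2 hin.finiteEntropy] at h5
  unfold info
  change _ = ent (Q.law P') M at h5
  linarith

end Rates

/-! ### Rate bound for a protocol secure up to ε -/

section Sum

variable {F : Type} [Field F] [Fintype F] [MeasurableSpace F] [MeasurableSingletonClass F]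

lemma exists_le_prod_real_singleton {pX pY : Measure F} [IsProbabilityMeasure pX]
    [IsProbabilityMeasure pY] (hX : ∀ x, pX {x} ≠ 0) (hY : ∀ y, pY {y} ≠ 0) :
    ∃ δ : ℝ, 0 < δ ∧ ∀ p, δ ≤ (pX.prod pY).real {p} := by
  have hpos : ∀ p, 0 < (pX.prod pY).real {p} := fun p => by
    rw [← Prod.mk.eta (p := p), ← Set.singleton_prod_singleton, measureReal_prod_prod]
    exact mul_pos (ENNReal.toReal_pos (hX _) (measure_ne_top _ _))
      (ENNReal.toReal_pos (hY _) (measure_ne_top _ _))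
  obtain ⟨p₀, h⟩ := Finite.exists_min fun p => (pX.prod pY).real {p}
  exact ⟨_, hpos p₀, h⟩

/-- The bound for the rates of a protocol of block length `n` which is secure up to `ε`. -/
lemma le_rate_of_secureUpTo {pX pY : Measure F} [IsProbabilityMeasure pX]
    [IsProbabilityMeasure pY] {n : ℕ} (Q : BlockProtocol F F F n) {δ : ℝ} (hδ : 0 < δ)
    (hP : ∀ p, δ ≤ (pX.prod pY).real {p}) (hn : n ≠ 0) (h : ∀ i, Q.rate (pX.prod pY) i ≠ ∞) {ε : ℝ}
    (hε : 0 < ε) (hQ : Q.SecureUpTo (pX.prod pY) (fun x y => x + y) (ENNReal.ofReal ε))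
    (i : Fin 4) :
    n * (entropy (pX.prod pY) (fun p : F × F => p.1 + p.2)).toReal -
      6 * (1 + 32 / δ ^ 2) * ε - 3 * (1 + 2 * ε * (n * Real.logb 2 (Fintype.card F) + 1)) ≤
      n * (Q.rate (pX.prod pY) i).toReal := by
  obtain ⟨q0, q1, q2, q3⟩ := hQ
  have hfin := Q.finiteEntropy_hist (pX.prod pY) h
  have hεt : (ENNReal.ofReal ε).toReal = ε := ENNReal.toReal_ofReal hε.le
  have c0 : 0 < 1 + 32 / δ ^ 2 := by positivity
  have i23 : ∀ t, Q.info (pX.prod pY) (Q.H23 t) ≤ (1 + 32 / δ ^ 2) * (2 * ε) := fun t => by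
    have a1 := Q.leak_le_of_bob (pX.prod pY) (hfin t).2.1 (fun m => m.2.take t) (Q.H23_eq t)
      ENNReal.ofReal_ne_top q2
    have a2 := Q.leak_le_of_charlie (pX.prod pY) (hfin t).2.1 (fun m => m.1.take t) (Q.H23_eq t)
      ENNReal.ofReal_ne_top q3
    rw [hεt] at a1 a2
    refine (Q.info_le (pX.prod pY) (hfin t).2.1 (φ := Prod.snd) (ψ := fun p => p.1 + p.2)
      -- The pair with Bob's input taken from `i` and the sum taken from `j`.
      (fun i j => ⟨(j.1 + j.2 - i.2, i.2), rfl, by simp⟩) hδ hP).trans ?_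
    exact mul_le_mul_of_nonneg_left (by linarith) c0.le
  have i31 : ∀ t, Q.info (pX.prod pY) (Q.H31 t) ≤ (1 + 32 / δ ^ 2) * (2 * ε) := fun t => by
    have a1 := Q.leak_le_of_alice (pX.prod pY) (hfin t).2.2 (fun m => m.2.take t) (Q.H31_eq t)
      ENNReal.ofReal_ne_top q1
    have a2 := Q.leak_le_of_charlie (pX.prod pY) (hfin t).2.2 (fun m => m.2.take t) (Q.H31_eq t)
      ENNReal.ofReal_ne_top q3
    rw [hεt] at a1 a2
    refine (Q.info_le (pX.prod pY) (hfin t).2.2 (φ := Prod.fst) (ψ := fun p => p.1 + p.2)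
      (fun i j => ⟨(i.1, j.1 + j.2 - i.1), rfl, by simp⟩) hδ hP).trans ?_
    exact mul_le_mul_of_nonneg_left (by linarith) c0.le
  -- The factor 2 only serves to make the inequality strict.
  have herr : (Q.law (pX.prod pY)).real {ω | Q.Zhat ω ≠ Q.Z (fun x y => x + y) ω} < 2 * ε := by
    have := ENNReal.toReal_mono ENNReal.ofReal_ne_top q0
    rw [hεt] at this
    exact lt_of_le_of_lt this (by linarith)
  -- The choice `s = 1 / 2` costs an additive constant, which disappears after division by `n`.
  obtain ⟨t, ht⟩ := Q.exists_ent_hist_ge pX pY (fun t => (hfin t).1) (fun t => (hfin t).2.1)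
    (fun t => (hfin t).2.2) (by positivity) i23 i31 herr (s := 1 / 2) (by norm_num) (by norm_num)
  have hr := Q.le_rate (pX.prod pY) hn h (by positivity) (i31 t) ht i
  have hN : (Fintype.card F : ℝ) ≠ 0 := by exact_mod_cast Fintype.card_ne_zero
  have l1 : Real.logb 2 (1 / (1 - 1 / 2)) = 1 := by norm_num
  have l2 : Real.logb 2 ((Fintype.card F : ℝ) ^ n / (1 / 2)) =
      n * Real.logb 2 (Fintype.card F) + 1 := by
    rw [div_div_eq_mul_div, div_one, Real.logb_mul (pow_ne_zero _ hN) two_ne_zero, Real.logb_pow,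
      Real.logb_self_eq_one one_lt_two]
  rw [l1, l2] at hr
  linarith

end Sum

end BlockProtocol

/-! ### Converse for asymptotic security -/

section AsymptoticBound

variable {F : Type} [Field F] [Fintype F] [MeasurableSpace F] [MeasurableSingletonClass F]
  {pX pY : Measure F} [IsProbabilityMeasure pX] [IsProbabilityMeasure pY]

lemma entropy_le_of_achievableAS (hX : ∀ x, pX {x} ≠ 0) (hY : ∀ y, pY {y} ≠ 0) {q : Fin 4 → ℝ≥0}
    (hq : AchievableAS (pX.prod pY) (fun x y : F => x + y) q) (i : Fin 4) :
    entropy (pX.prod pY) (fun p : F × F => p.1 + p.2) ≤ q i := by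
  obtain ⟨Q, hlim, hsec⟩ := hq
  obtain ⟨δ, hδ, hP⟩ := BlockProtocol.exists_le_prod_real_singleton hX hY
  set HZ := entropy (pX.prod pY) (fun p : F × F => p.1 + p.2)
  have hHZ : HZ ≠ ∞ := entropy_ne_top_of_finite _
  set L := Real.logb 2 (Fintype.card F)
  set C := 1 + 32 / δ ^ 2 with hC
  have hC0 : 0 < C := by positivity
  have hL0 : 0 ≤ L := Real.logb_nonneg one_lt_two (by exact_mod_cast Fintype.card_pos)
  -- A secure block length `n ≥ 1 / ε` is used. In the constant `10`, one unit comes from the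
  -- convergence of the rates, three from the constant term `3 ≤ 3 n ε`, and six from the summand `6
  -- ε`.
  have key : ∀ ε : ℝ, 0 < ε → HZ.toReal ≤ q i + (10 + 6 * C + 6 * L) * ε := by
    intro ε hε
    have h1 : ∀ᶠ n in atTop, ∀ j, (Q n).rate (pX.prod pY) j ≠ ∞ := eventually_all.2 fun j =>
      ((hlim j).eventually (gt_mem_nhds ENNReal.coe_lt_top)).mono fun _ h => h.ne
    have h2 : ∀ᶠ n in atTop, ((Q n).rate (pX.prod pY) i).toReal < q i + ε :=
      ((ENNReal.tendsto_toReal ENNReal.coe_ne_top).comp (hlim i)).eventually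
        (gt_mem_nhds (by simpa using hε))
    have h3 : ∀ᶠ n : ℕ in atTop, 1 / ε ≤ n := tendsto_natCast_atTop_atTop.eventually_ge_atTop _
    obtain ⟨n, hs, h1, h2, h3, h4⟩ := ((hsec (ENNReal.ofReal ε) (ENNReal.ofReal_pos.2 hε)).and_eventually
      (h1.and (h2.and (h3.and (eventually_ge_atTop 1))))).exists
    have hb := BlockProtocol.le_rate_of_secureUpTo (Q n) hδ hP (by omega) h1 hε hs i
    have hn : (1 : ℝ) ≤ n := by exact_mod_cast h4
    rw [div_le_iff₀ hε] at h3
    have h5 : n * ((Q n).rate (pX.prod pY) i).toReal ≤ n * (q i + ε) :=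
      mul_le_mul_of_nonneg_left h2.le (by linarith)
    have h6 : n * HZ.toReal ≤ n * (q i + (10 + 6 * C + 6 * L) * ε) := by
      have h7 : C * ε ≤ n * (C * ε) := le_mul_of_one_le_left (by positivity) hn
      have h8 : ε ≤ n * ε := le_mul_of_one_le_left hε.le hn
      change n * HZ.toReal - 6 * C * ε - 3 * (1 + 2 * ε * (n * L + 1)) ≤ _ at hb
      nlinarith
    exact le_of_mul_le_mul_left h6 (by linarith)
  have hlim0 : Tendsto (fun ε : ℝ => q i + (10 + 6 * C + 6 * L) * ε) (𝓝[>] 0) (𝓝 (q i : ℝ)) := by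
    have : Tendsto (fun ε : ℝ => q i + (10 + 6 * C + 6 * L) * ε) (𝓝 0)
        (𝓝 (q i + (10 + 6 * C + 6 * L) * 0)) := by
      apply Continuous.tendsto
      fun_prop
    rw [mul_zero, add_zero] at this
    exact this.mono_left nhdsWithin_le_nhds
  have hfin : HZ.toReal ≤ q i :=
    ge_of_tendsto hlim0 (eventually_mem_nhdsWithin.mono fun ε hε => key ε hε)
  rw [← ENNReal.toReal_le_toReal hHZ ENNReal.coe_ne_top]
  exact hfin

theorem entropy_le_of_mem_regionAS (hX : ∀ x, pX {x} ≠ 0) (hY : ∀ y, pY {y} ≠ 0)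
    {q : Fin 4 → ℝ≥0} (hq : q ∈ regionAS (pX.prod pY) (fun x y : F => x + y)) (i : Fin 4) :
    entropy (pX.prod pY) (fun p : F × F => p.1 + p.2) ≤ q i := by
  have hcl : IsClosed {q : Fin 4 → ℝ≥0 | entropy (pX.prod pY) (fun p : F × F => p.1 + p.2) ≤ q i} :=
    isClosed_le continuous_const (ENNReal.continuous_coe.comp (continuous_apply i))
  exact closure_minimal (fun q hq => entropy_le_of_achievableAS hX hY hq i) hcl hq

end AsymptoticBound

end

end SecureComp

namespace SecureComp

set_option linter.unusedSectionVars false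

noncomputable section

/-! ### Perfect security: exact independence and change of the input law -/

namespace BlockProtocol

variable {F : Type} [Field F] [Fintype F] [MeasurableSpace F] [MeasurableSingletonClass F]
  {n : ℕ} (Q : BlockProtocol F F F n)
  {pX pY : Measure F} [IsProbabilityMeasure pX] [IsProbabilityMeasure pY]

lemma rate_le_ratePS (i : Fin 4) : Q.rate (pX.prod pY) i ≤ Q.ratePS (pX.prod pY) i := by
  fin_cases i
  · exact le_rfl
  · exact le_rfl
  · exact le_rfl
  · have hM := (Q.isDiscrete_M12 (pX.prod pY)).prodMk ((Q.isDiscrete_M23 (pX.prod pY)).prodMk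
      ((Q.isDiscrete_M31 (pX.prod pY)).prodMk (Q.isDiscrete_Zhat (pX.prod pY))))
    exact ENNReal.div_le_div_right (condEntropy_comp_left_le hM
      ((Q.isDiscrete_X (pX.prod pY)).prodMk (Q.isDiscrete_Y (pX.prod pY)))
      fun m => (m.1, m.2.1, m.2.2.1)) _

/-- In a perfectly secure protocol, no link reveals anything about the inputs. -/
lemma info_le_zero_of_perfectlySecure {δ : ℝ} (hδ : 0 < δ) (hP : ∀ p, δ ≤ (pX.prod pY).real {p})
    (h : ∀ i, Q.rate (pX.prod pY) i ≠ ∞)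
    (hQ : Q.PerfectlySecure (pX.prod pY) (fun x y => x + y)) (t : ℕ) :
    Q.info (pX.prod pY) (Q.H12 t) ≤ 0 ∧ Q.info (pX.prod pY) (Q.H23 t) ≤ 0 ∧
      Q.info (pX.prod pY) (Q.H31 t) ≤ 0 := by
  obtain ⟨q0, q1, q2, q3⟩ := hQ
  obtain ⟨h12, h23, h31⟩ := Q.finiteEntropy_hist (pX.prod pY) h t
  have d12 := Q.isDiscrete_M12 (pX.prod pY)
  have d23 := Q.isDiscrete_M23 (pX.prod pY)
  have d31 := Q.isDiscrete_M31 (pX.prod pY)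
  have dX := Q.isDiscrete_X (pX.prod pY)
  have dY := Q.isDiscrete_Y (pX.prod pY)
  have dZ := Q.isDiscrete_Zhat (pX.prod pY)
  have p1 := (condMutualInfo_fst_eq_zero (d12.prodMk d31) dY dZ dX q1).le
  have p2 := (condMutualInfo_fst_eq_zero (d12.prodMk d23) dX dZ dY q2).le
  have hZ : Q.Zhat =ᵐ[Q.law (pX.prod pY)] Q.Z fun x y => x + y := ae_iff.2 q0
  -- Perfect privacy conditions on Charlie's output, which is almost surely equal to the true sum.
  have p3 : condMutualInfo (Q.law (pX.prod pY)) (fun ω => (Q.M23 ω, Q.M31 ω))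
      (fun ω => (Q.X ω, Q.Y ω)) (Q.Z fun x y => x + y) ≤ 0 := by
    rw [← q3, condMutualInfo, condMutualInfo, condEntropy_congr (ae_eq_refl _) hZ,
      condEntropy_congr (ae_eq_refl _) (V := fun ω => ((Q.M23 ω, Q.M31 ω), Q.Zhat ω))
        (V' := fun ω => ((Q.M23 ω, Q.M31 ω), Q.Z (fun x y => x + y) ω))]
    filter_upwards [hZ] with ω hω
    rw [hω]
  have a12 := Q.leak_le_of_alice (pX.prod pY) h12 (fun m => m.1.take t) (Q.H12_eq t)
    ENNReal.zero_ne_top p1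
  have b12 := Q.leak_le_of_bob (pX.prod pY) h12 (fun m => m.1.take t) (Q.H12_eq t)
    ENNReal.zero_ne_top p2
  have b23 := Q.leak_le_of_bob (pX.prod pY) h23 (fun m => m.2.take t) (Q.H23_eq t)
    ENNReal.zero_ne_top p2
  have c23 := Q.leak_le_of_charlie (pX.prod pY) h23 (fun m => m.1.take t) (Q.H23_eq t)
    ENNReal.zero_ne_top p3
  have a31 := Q.leak_le_of_alice (pX.prod pY) h31 (fun m => m.2.take t) (Q.H31_eq t)
    ENNReal.zero_ne_top p1
  have c31 := Q.leak_le_of_charlie (pX.prod pY) h31 (fun m => m.2.take t) (Q.H31_eq t)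
    ENNReal.zero_ne_top p3
  rw [ENNReal.toReal_zero] at a12 b12 b23 c23 a31 c31
  have c0 : 0 ≤ 1 + 32 / δ ^ 2 := by positivity
  refine ⟨?_, ?_, ?_⟩
  · refine (Q.info_le (pX.prod pY) h12 (φ := Prod.fst) (ψ := Prod.snd)
      (fun i j => ⟨(i.1, j.2), rfl, rfl⟩) hδ hP).trans ?_
    exact mul_nonpos_of_nonneg_of_nonpos c0 (add_nonpos a12 b12)
  · refine (Q.info_le (pX.prod pY) h23 (φ := Prod.snd) (ψ := fun p => p.1 + p.2)
      (fun i j => ⟨(j.1 + j.2 - i.2, i.2), rfl, by simp⟩) hδ hP).trans ?_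
    exact mul_nonpos_of_nonneg_of_nonpos c0 (add_nonpos b23 c23)
  · refine (Q.info_le (pX.prod pY) h31 (φ := Prod.fst) (ψ := fun p => p.1 + p.2)
      (fun i j => ⟨(i.1, j.1 + j.2 - i.1), rfl, by simp⟩) hδ hP).trans ?_
    exact mul_nonpos_of_nonneg_of_nonpos c0 (add_nonpos a31 c31)

/-- Under full support a null event is null for each input separately, hence under every law of the
inputs. -/
lemma law_ne_eq_zero {P P' : Measure (F × F)} [IsProbabilityMeasure P] [IsProbabilityMeasure P']
    (hP : ∀ p, 0 < P.real {p}) {p : Q.Outcome → Prop} (h : Q.law P {ω | ¬ p ω} = 0) :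
    Q.law P' {ω | ¬ p ω} = 0 := by
  refine ae_iff.1 (Q.ae_law_of_forall P' fun v => ae_iff.2 ?_)
  have h1 : Q.law P ({v} ×ˢ {r | ¬ p (v, r)}) = 0 := by
    refine measure_mono_null ?_ h
    rintro ⟨w, r⟩ ⟨rfl, hr⟩
    exact hr
  rw [law, Measure.prod_prod, mul_eq_zero] at h1
  refine h1.resolve_left fun h2 => ?_
  have h3 := pi_real_singleton P v
  rw [measureReal_def, h2] at h3
  exact (Finset.prod_pos fun i _ => hP (v i)).ne h3

instance : IsProbabilityMeasure (PMF.uniformOfFintype F).toMeasure :=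
  PMF.toMeasure.isProbabilityMeasure _

/-- The input law to which perfectly secure protocols are transferred. It lacks full support, which
does no harm: independence of the histories from the inputs is established under the original law.
-/
lemma entropy_sum_uniform : (entropy ((PMF.uniformOfFintype F).toMeasure.prod (Measure.dirac 0))
    (fun p : F × F => p.1 + p.2)).toReal = Real.logb 2 (Fintype.card F) := by
  refine entropy_uniform fun z => ?_
  have hm : MeasurableSet {p : F × F | p.1 + p.2 = z} := (Set.toFinite _).measurableSet
  rw [Measure.prod_dirac, measureReal_def, Measure.map_apply (by fun_prop) hm]
  have : (fun x : F => (x, (0 : F))) ⁻¹' {p : F × F | p.1 + p.2 = z} = {z} := by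
    ext x; simp
  rw [this, PMF.toMeasure_apply_singleton _ _ (measurableSet_singleton z)]
  simp

/-- The histories have the same entropies under `pX.prod pY` as with `X` uniform and `Y = 0`, and
correctness also carries over. The lower bound `n H(Z)` for these entropies is applied under the
second law, where it equals `n log |F|`, and converted into rates under the first. -/
lemma logb_card_le_ratePS {δ : ℝ} (hδ : 0 < δ) (hP : ∀ p, δ ≤ (pX.prod pY).real {p}) (hn : n ≠ 0)
    (h : ∀ i, Q.ratePS (pX.prod pY) i ≠ ∞)
    (hQ : Q.PerfectlySecure (pX.prod pY) (fun x y => x + y)) (i : Fin 4) :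
    Real.logb 2 (Fintype.card F) ≤ (Q.ratePS (pX.prod pY) i).toReal := by
  have h' : ∀ i, Q.rate (pX.prod pY) i ≠ ∞ := fun i =>
    ((Q.rate_le_ratePS i).trans_lt (h i).lt_top).ne
  have hP0 : ∀ p, 0 < (pX.prod pY).real {p} := fun p => hδ.trans_le (hP p)
  have hfin := Q.finiteEntropy_hist (pX.prod pY) h'
  have hinf := Q.info_le_zero_of_perfectlySecure hδ hP h' hQ
  set pU : Measure F := (PMF.uniformOfFintype F).toMeasure
  set pD : Measure F := Measure.dirac 0
  have m : ∀ (t : ℕ) (v : Fin n → F × F) (a : LinkHist × LinkHist × LinkHist → LinkHist)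
      (b : LinkHist), MeasurableSet
        {r : Q.Rand | a (Q.hist (fun i => (v i).1) (fun i => (v i).2) r t) = b} := fun t v a b => by
    have : {r : Q.Rand | a (Q.hist (fun i => (v i).1) (fun i => (v i).2) r t) = b} =
        ⋃ c ∈ {c | a c = b}, {r | Q.hist (fun i => (v i).1) (fun i => (v i).2) r t = c} := by
      ext r; simp
    rw [this]
    exact MeasurableSet.biUnion (Set.to_countable _) fun c _ => Q.measurableSet_hist _ _ _ _
  have e12 := fun t => Q.entropy_eq_of_info (pX.prod pY) (pU.prod pD) (hfin t).1
    (Q.isDiscrete_H12 _ t) (fun v b => m t v (fun c => c.1) b) hP0 (hinf t).1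
  have e23 := fun t => Q.entropy_eq_of_info (pX.prod pY) (pU.prod pD) (hfin t).2.1
    (Q.isDiscrete_H23 _ t) (fun v b => m t v (fun c => c.2.1) b) hP0 (hinf t).2.1
  have e31 := fun t => Q.entropy_eq_of_info (pX.prod pY) (pU.prod pD) (hfin t).2.2
    (Q.isDiscrete_H31 _ t) (fun v b => m t v (fun c => c.2.2) b) hP0 (hinf t).2.2
  have herr : Q.law (pU.prod pD) {ω | Q.Zhat ω ≠ Q.Z (fun x y => x + y) ω} = 0 :=
    Q.law_ne_eq_zero hP0 hQ.1
  -- The probability of error is zero, but the bound for the histories asks for a strict upper bound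
  -- `e`.
  have key : ∀ s e : ℝ, 0 < s → s < 1 → 0 < e → n * Real.logb 2 (Fintype.card F) -
      3 * (Real.logb 2 (1 / (1 - s)) + e * Real.logb 2 (Fintype.card F ^ n / s)) ≤
        n * (Q.rate (pX.prod pY) i).toReal := fun s e hs0 hs1 he => by
    obtain ⟨t, ht⟩ := Q.exists_ent_hist_ge pU pD (fun t => (e12 t).1) (fun t => (e23 t).1)
      (fun t => (e31 t).1) le_rfl (fun t => (e23 t).2.2) (fun t => (e31 t).2.2) (e := e)
      (by rw [measureReal_def, herr]; exact he) hs0 hs1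
    rw [(e12 t).2.1, (e23 t).2.1, (e31 t).2.1, entropy_sum_uniform] at ht
    have := Q.le_rate (pX.prod pY) hn h' le_rfl (hinf t).2.2 ht i
    linarith
  -- First `e` tends to 0 with `s` fixed, then `s` tends to 0: the coefficient of `e` blows up with
  -- `1 / s`.
  have key2 : ∀ s : ℝ, 0 < s → s < 1 → n * Real.logb 2 (Fintype.card F) -
      3 * Real.logb 2 (1 / (1 - s)) ≤ n * (Q.rate (pX.prod pY) i).toReal := fun s hs0 hs1 => by
    have hc : Continuous fun e : ℝ => n * Real.logb 2 (Fintype.card F) -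
      3 * (Real.logb 2 (1 / (1 - s)) + e * Real.logb 2 (Fintype.card F ^ n / s)) := by fun_prop
    have hlim := (hc.tendsto 0).mono_left (nhdsWithin_le_nhds (s := Set.Ioi 0))
    rw [zero_mul, add_zero] at hlim
    exact le_of_tendsto hlim (eventually_mem_nhdsWithin.mono fun e he => key s e hs0 hs1 he)
  have hc : ContinuousAt (fun s : ℝ => n * Real.logb 2 (Fintype.card F) -
      3 * Real.logb 2 (1 / (1 - s))) 0 := by
    unfold Real.logb
    have : ContinuousAt (fun s : ℝ => Real.log (1 / (1 - s))) 0 := by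
      apply ContinuousAt.log
      · apply ContinuousAt.div <;> first | fun_prop | norm_num
      · norm_num
    fun_prop
  have hlim := hc.tendsto.mono_left (nhdsWithin_le_nhds (s := Set.Ioi 0))
  rw [sub_zero, div_one, Real.logb_one, mul_zero, sub_zero] at hlim
  have h1 := le_of_tendsto hlim (by
    filter_upwards [eventually_mem_nhdsWithin, nhdsWithin_le_nhds (gt_mem_nhds (zero_lt_one' ℝ))]
      with s hs0 hs1 using key2 s hs0 hs1)
  have hn' : (0 : ℝ) < n := by exact_mod_cast Nat.pos_of_ne_zero hn
  exact (le_of_mul_le_mul_left h1 hn').trans (ENNReal.toReal_mono (h i) (Q.rate_le_ratePS i))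

end BlockProtocol

/-! ### Converse for perfect security -/

section PerfectBound

variable {F : Type} [Field F] [Fintype F] [MeasurableSpace F] [MeasurableSingletonClass F]
  {pX pY : Measure F} [IsProbabilityMeasure pX] [IsProbabilityMeasure pY]

theorem logb_card_le_of_mem_regionPS (hX : ∀ x, pX {x} ≠ 0) (hY : ∀ y, pY {y} ≠ 0)
    {q : Fin 4 → ℝ≥0} (hq : q ∈ regionPS (pX.prod pY) (fun x y : F => x + y)) (i : Fin 4) :
    Real.logb 2 (Fintype.card F) ≤ q i := by
  have hcl : IsClosed {q : Fin 4 → ℝ≥0 | Real.logb 2 (Fintype.card F) ≤ q i} :=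
    isClosed_le continuous_const (NNReal.continuous_coe.comp (continuous_apply i))
  obtain ⟨δ, hδ, hP⟩ := BlockProtocol.exists_le_prod_real_singleton hX hY
  refine closure_minimal ?_ hcl hq
  rintro q ⟨n, hn, Q, hr, hQ⟩
  have := Q.logb_card_le_ratePS hδ hP (by omega) (fun i => by rw [hr]; exact ENNReal.coe_ne_top) hQ i
  rwa [hr] at this

theorem entropy_lt_logb_card
    (h : ∃ z, (pX.prod pY) {p : F × F | p.1 + p.2 = z} ≠ (Fintype.card F : ℝ≥0∞)⁻¹) :
    (entropy (pX.prod pY) (fun p : F × F => p.1 + p.2)).toReal < Real.logb 2 (Fintype.card F) := by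
  obtain ⟨z, hz⟩ := h
  refine entropy_lt_of_not_uniform (isDiscrete_of_countable fun z =>
    (Set.toFinite _).measurableSet.nullMeasurableSet) ⟨z, fun h => hz ?_⟩
  rw [← ENNReal.toReal_eq_toReal_iff' (measure_ne_top _ _) (by simp)]
  rw [ENNReal.toReal_inv, ENNReal.toReal_natCast]
  exact h

end PerfectBound

end

end SecureComp

namespace SecureComp

set_option linter.unusedSectionVars false

noncomputable section

/-! ### Transcripts of the Körner–Marton protocol -/

section KornerMartonTranscripts

/-- The transcript of a link which is used in a single round. -/
def singleRound (s : ℕ) (m : LinkRound) : LinkTranscript := fun t => if t = s then m else ([], [])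

lemma totalLength_singleRound (s : ℕ) (m : LinkRound) :
    totalLength (singleRound s m) = ((m.1.length + m.2.length : ℕ) : ℝ≥0∞) := by
  rw [totalLength, tsum_eq_single s]
  · simp [singleRound]
  · intro t ht
    simp [singleRound, ht]

variable {F : Type} [Field F] [Fintype F] {m n : ℕ} (A : Matrix (Fin m) (Fin n) F)
  (D : (Fin m → F) → (Fin n → F))

lemma kmPre_link12 (x y : Fin n → F) (r : (kmPre A D).Rand) :
    (kmPre A D).link12 x y r = singleRound 0 (encode (V := Fin m → F) r.1, []) := by
  funext t
  obtain ⟨h12, -, -⟩ := (kmPre A D).hist_length x y r t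
  unfold PreProtocol.link12 singleRound
  generalize (kmPre A D).hist x y r t = h at h12 ⊢
  rcases t with _ | _ | t <;> simp [PreProtocol.round, kmPre, kmAlice, kmBob, h12]

lemma kmPre_link23 (x y : Fin n → F) (r : (kmPre A D).Rand) :
    (kmPre A D).link23 x y r =
      singleRound 1 (encode (V := Fin m → F) (A *ᵥ y - (show Fin m → F from r.1)), []) := by
  funext t
  rcases t with _ | _ | t
  · rfl
  · have h := kmPre_link12 A D x y r
    have h0 : (kmPre A D).hist x y r 1 = ([(kmPre A D).link12 x y r 0],
      [(kmPre A D).link23 x y r 0], [(kmPre A D).link31 x y r 0]) := rfl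
    unfold PreProtocol.link23 singleRound
    rw [zero_add, h0, h]
    simp only [PreProtocol.round, kmPre, kmBob, kmCharlie, singleRound, List.length_singleton,
      if_true, List.headD_cons]
    exact congrArg (fun u => (encode (A *ᵥ y - u), ([] : Msg)))
      (decode_encode (V := Fin m → F) r.1)
  · obtain ⟨h12, -, -⟩ := (kmPre A D).hist_length x y r (t + 2)
    unfold PreProtocol.link23 singleRound
    generalize (kmPre A D).hist x y r (t + 2) = h at h12 ⊢
    simp [PreProtocol.round, kmPre, kmBob, kmCharlie, h12]

lemma kmPre_link31 (x y : Fin n → F) (r : (kmPre A D).Rand) :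
    (kmPre A D).link31 x y r =
      singleRound 1 ([], encode (V := Fin m → F) (A *ᵥ x + (show Fin m → F from r.1))) := by
  funext t
  obtain ⟨h12, -, -⟩ := (kmPre A D).hist_length x y r t
  unfold PreProtocol.link31 singleRound
  generalize (kmPre A D).hist x y r t = h at h12 ⊢
  rcases t with _ | _ | t <;> simp [PreProtocol.round, kmPre, kmAlice, kmCharlie, h12]

/-- Alice's key. -/
def kmKey (ω : (kmProtocol A D).Outcome) : Fin m → F := ω.2.1

lemma kmProtocol_M12 (ω : (kmProtocol A D).Outcome) :
    (kmProtocol A D).M12 ω = singleRound 0 (encode (kmKey A D ω), []) :=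
  kmPre_link12 A D _ _ _

lemma kmProtocol_M23 (ω : (kmProtocol A D).Outcome) :
    (kmProtocol A D).M23 ω =
      singleRound 1 (encode (A *ᵥ (kmProtocol A D).Y ω - kmKey A D ω), []) :=
  kmPre_link23 A D _ _ _

lemma kmProtocol_M31 (ω : (kmProtocol A D).Outcome) :
    (kmProtocol A D).M31 ω =
      singleRound 1 ([], encode (A *ᵥ (kmProtocol A D).X ω + kmKey A D ω)) :=
  kmPre_link31 A D _ _ _

lemma kmProtocol_Z (ω : (kmProtocol A D).Outcome) :
    (kmProtocol A D).Z (fun x y => x + y) ω = (kmProtocol A D).X ω + (kmProtocol A D).Y ω := rfl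

lemma kmProtocol_Zhat (ω : (kmProtocol A D).Outcome) :
    (kmProtocol A D).Zhat ω = D (A *ᵥ (kmProtocol A D).Z (fun x y => x + y) ω) := by
  change D (decode ((kmProtocol A D).M31 ω 1).2 + decode ((kmProtocol A D).M23 ω 1).1) = _
  rw [kmProtocol_M31, kmProtocol_M23, kmProtocol_Z, Matrix.mulVec_add]
  simp only [singleRound, if_true, decode_encode]
  congr 1
  abel

end KornerMartonTranscripts

/-! ### Privacy and randomness of the Körner–Marton protocol -/

section KornerMartonPrivacy

variable {F : Type} [Field F] [Fintype F] [MeasurableSpace F] [MeasurableSingletonClass F]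
  {m n : ℕ} (A : Matrix (Fin m) (Fin n) F) (D : (Fin m → F) → (Fin n → F))
  (P : Measure (F × F)) [IsProbabilityMeasure P]

/-- The key, shifted by a function of the inputs, is uniformly distributed and independent of the
inputs. -/
lemma kmProtocol_real_key (κ : (Fin n → F × F) → Fin m → F) (S : Set (Fin n → F × F))
    (k : Fin m → F) :
    ((kmProtocol A D).law P).real {ω | ω.1 ∈ S ∧ κ ω.1 + kmKey A D ω = k} =
      ((kmProtocol A D).law P).real {ω | ω.1 ∈ S} * (Fintype.card (Fin m → F) : ℝ)⁻¹ := by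
  classical
  set K : (Fin n → F × F) → Set (kmProtocol A D).alice.Ω := fun v =>
    if v ∈ S then (show Set (kmProtocol A D).alice.Ω from ({k - κ v} : Set (Fin m → F))) else ∅
  have hK1 : ∀ v ∈ S, K v = ({k - κ v} : Set (Fin m → F)) := fun v h => if_pos h
  have hK0 : ∀ v ∉ S, K v = ∅ := fun v h => if_neg h
  have hs : ∀ v : Fin n → F × F, {r : (kmProtocol A D).Rand | (v, r) ∈
      {ω : (kmProtocol A D).Outcome | ω.1 ∈ S ∧ κ ω.1 + kmKey A D ω = k}} =
      K v ×ˢ Set.univ := fun v => by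
    have h1 : ∀ r : Fin m → F, κ v + r = k ↔ r = k - κ v := fun r => by
      rw [eq_sub_iff_add_eq, add_comm]
    ext r
    by_cases h : v ∈ S
    · rw [hK1 v h]
      exact ⟨fun hr => ⟨(h1 r.1).1 hr.2, trivial⟩, fun hr => ⟨h, (h1 r.1).2 hr.1⟩⟩
    · rw [hK0 v h]
      exact ⟨fun hr => (h hr.1).elim, fun hr => hr.1.elim⟩
  have hms : ∀ s : Set (kmProtocol A D).alice.Ω, MeasurableSet s := fun _ => trivial
  rw [(kmProtocol A D).law_real_eq_sum P, (kmProtocol A D).law_real_eq_sum P, Finset.sum_mul]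
  · refine Finset.sum_congr rfl fun v _ => ?_
    rw [hs v, PreProtocol.randMeasure, measureReal_prod_prod, mul_assoc]
    congr 1
    by_cases h : v ∈ S
    · have e : {r : (kmProtocol A D).Rand | (v, r) ∈ {ω : (kmProtocol A D).Outcome | ω.1 ∈ S}} =
          Set.univ := Set.eq_univ_of_forall fun _ => h
      rw [e, probReal_univ, probReal_univ, mul_one, one_mul, hK1 v h]
      change (@PMF.toMeasure (Fin m → F) ⊤ (PMF.uniformOfFintype (Fin m → F))).real {k - κ v} = _
      rw [measureReal_def, @PMF.toMeasure_apply_singleton _ ⊤ _ _ trivial]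
      simp
    · have e : {r : (kmProtocol A D).Rand | (v, r) ∈ {ω : (kmProtocol A D).Outcome | ω.1 ∈ S}} =
          ∅ := Set.eq_empty_of_forall_notMem fun _ => h
      rw [e, hK0 v h, measureReal_empty, measureReal_empty, zero_mul, zero_mul]
  · exact fun v => MeasurableSet.const (v ∈ S)
  · intro v
    rw [hs v]
    exact (hms _).prod MeasurableSet.univ

lemma isDiscrete_kmKey (κ : (Fin n → F × F) → Fin m → F) :
    IsDiscrete ((kmProtocol A D).law P) (fun ω => κ ω.1 + kmKey A D ω) :=
  isDiscrete_of_countable fun k => by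
    refine ((kmProtocol A D).measurableSet_of_section fun v => ?_).nullMeasurableSet
    have e : {r : (kmProtocol A D).Rand | (v, r) ∈
        {ω : (kmProtocol A D).Outcome | κ ω.1 + kmKey A D ω = k}} =
        {r : Fin m → F | κ v + r = k} ×ˢ Set.univ := by
      ext r
      exact ⟨fun h => ⟨h, trivial⟩, fun h => h.1⟩
    rw [e]
    exact MeasurableSet.prod (α := (kmProtocol A D).alice.Ω) trivial MeasurableSet.univ

/-- A function of `ψ` of the inputs and of the shifted key reveals nothing else about the
inputs. -/
lemma condMutualInfo_kmProtocol_eq_zero {α β δ : Type*} [Finite α]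
    {M : (kmProtocol A D).Outcome → δ} (κ : (Fin n → F × F) → Fin m → F)
    (φ : (Fin n → F × F) → α) (ψ : (Fin n → F × F) → β) (g : (Fin m → F) × β → δ)
    (hg : ∀ ω, M ω = g (κ ω.1 + kmKey A D ω, ψ ω.1)) :
    condMutualInfo ((kmProtocol A D).law P) M (fun ω => φ ω.1) (fun ω => ψ ω.1) = 0 := by
  have hin := (kmProtocol A D).isDiscrete_input P
  have hK := isDiscrete_kmKey A D P κ
  rw [condMutualInfo, tsub_eq_zero_iff_le, funext hg]
  have h := condEntropy_le_comp_right (hin.comp φ) (hK.prodMk (hin.comp ψ))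
    fun x => (g x, x.2)
  refine le_trans (le_of_eq ?_) h
  refine (condEntropy_prod_right_eq (hin.comp φ) hK (hin.comp ψ) fun u k w => ?_).symm
  have e1 : {ω : (kmProtocol A D).Outcome | φ ω.1 = u ∧ κ ω.1 + kmKey A D ω = k ∧ ψ ω.1 = w} =
      {ω | ω.1 ∈ {v | φ v = u ∧ ψ v = w} ∧ κ ω.1 + kmKey A D ω = k} := by
    ext ω
    simp only [Set.mem_ofPred_eq]
    tauto
  have e2 : {ω : (kmProtocol A D).Outcome | κ ω.1 + kmKey A D ω = k ∧ ψ ω.1 = w} =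
      {ω | ω.1 ∈ {v | ψ v = w} ∧ κ ω.1 + kmKey A D ω = k} := by
    ext ω
    simp only [Set.mem_ofPred_eq]
    tauto
  rw [e1, e2, kmProtocol_real_key, kmProtocol_real_key]
  change _ * _ * ((kmProtocol A D).law P).real {ω | ψ ω.1 = w} =
    ((kmProtocol A D).law P).real {ω | φ ω.1 = u ∧ ψ ω.1 = w} * _
  simp only [Set.mem_ofPred_eq]
  ring

/-- The protocol is as secure as it is reliable. -/
lemma kmProtocol_secureUpTo {δ : ℝ≥0∞}
    (h : ((kmProtocol A D).law P) {ω | (kmProtocol A D).Zhat ω ≠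
      (kmProtocol A D).Z (fun x y => x + y) ω} ≤ δ) :
    (kmProtocol A D).SecureUpTo P (fun x y => x + y) δ := by
  refine ⟨h, ?_, ?_, ?_⟩
  · refine (condMutualInfo_kmProtocol_eq_zero A D P (fun _ => 0) (fun v i => (v i).2)
      (fun v i => (v i).1) (fun x => (singleRound 0 (encode x.1, []),
        singleRound 1 ([], encode (A *ᵥ x.2 + x.1)))) fun ω => ?_).trans_le zero_le
    rw [kmProtocol_M12, kmProtocol_M31, zero_add]
    rfl
  · refine (condMutualInfo_kmProtocol_eq_zero A D P (fun _ => 0) (fun v i => (v i).1)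
      (fun v i => (v i).2) (fun x => (singleRound 0 (encode x.1, []),
        singleRound 1 (encode (A *ᵥ x.2 - x.1), []))) fun ω => ?_).trans_le zero_le
    rw [kmProtocol_M12, kmProtocol_M23, zero_add]
    rfl
  -- Charlie sees the shifted key `A X + K` on link 31, and link 23 carries `A Z - (A X + K)`, a
  -- function of it and of `Z`.
  · refine (condMutualInfo_kmProtocol_eq_zero A D P (fun v => A *ᵥ (fun i => (v i).1 : Fin n → F))
      (fun v => ((fun i => (v i).1), (fun i => (v i).2)))
      (fun v i => (v i).1 + (v i).2) (fun x => (singleRound 1 (encode (A *ᵥ x.2 - x.1), []),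
        singleRound 1 ([], encode x.1))) fun ω => ?_).trans_le zero_le
    rw [kmProtocol_M23, kmProtocol_M31]
    have e : (fun i => (ω.1 i).1 + (ω.1 i).2) = (kmProtocol A D).X ω + (kmProtocol A D).Y ω := rfl
    have e' : (fun i => (ω.1 i).1) = (kmProtocol A D).X ω := rfl
    rw [e, e', Matrix.mulVec_add, add_sub_add_left_eq_sub]

/-- Given the inputs, the transcripts and the key determine each other, and the key is uniform and
independent of the inputs. -/
lemma kmProtocol_condEntropy :
    condEntropy ((kmProtocol A D).law P)
      (fun ω => ((kmProtocol A D).M12 ω, (kmProtocol A D).M23 ω, (kmProtocol A D).M31 ω))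
      (fun ω => ((kmProtocol A D).X ω, (kmProtocol A D).Y ω)) =
      ENNReal.ofReal (m * Real.logb 2 (Fintype.card F)) := by
  have hin := (kmProtocol A D).isDiscrete_input P
  have hXY := ((kmProtocol A D).isDiscrete_X P).prodMk ((kmProtocol A D).isDiscrete_Y P)
  have hK : IsDiscrete ((kmProtocol A D).law P) (kmKey A D) := by
    simpa using isDiscrete_kmKey A D P fun _ => 0
  have hr : ∀ (S : Set (Fin n → F × F)) (k : Fin m → F),
      ((kmProtocol A D).law P).real {ω | ω.1 ∈ S ∧ kmKey A D ω = k} =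
      ((kmProtocol A D).law P).real {ω | ω.1 ∈ S} * (Fintype.card (Fin m → F) : ℝ)⁻¹ := fun S k => by
    simpa using kmProtocol_real_key A D P (fun _ => 0) S k
  have hr1 : ∀ k, ((kmProtocol A D).law P).real {ω | kmKey A D ω = k} =
      (Fintype.card (Fin m → F) : ℝ)⁻¹ := fun k => by
    simpa using hr Set.univ k
  have hM : ∀ ω, ((kmProtocol A D).M12 ω, (kmProtocol A D).M23 ω, (kmProtocol A D).M31 ω) =
      (fun x : (Fin m → F) × (Fin n → F) × (Fin n → F) => (singleRound 0 (encode x.1, []),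
        singleRound 1 (encode (A *ᵥ x.2.2 - x.1), []), singleRound 1 ([], encode (A *ᵥ x.2.1 + x.1))))
        (kmKey A D ω, (kmProtocol A D).X ω, (kmProtocol A D).Y ω) := fun ω => by
    rw [kmProtocol_M12, kmProtocol_M23, kmProtocol_M31]
  have hfin : FiniteEntropy ((kmProtocol A D).law P)
      (fun ω => (kmKey A D ω, (kmProtocol A D).X ω, (kmProtocol A D).Y ω)) :=
    (hK.prodMk hXY).finiteEntropy
  have hMf : FiniteEntropy ((kmProtocol A D).law P)
      (fun ω => ((kmProtocol A D).M12 ω, (kmProtocol A D).M23 ω, (kmProtocol A D).M31 ω)) := by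
    rw [funext hM]
    exact hfin.comp fun x => (singleRound 0 (encode x.1, []),
      singleRound 1 (encode (A *ᵥ x.2.2 - x.1), []), singleRound 1 ([], encode (A *ᵥ x.2.1 + x.1)))
  have h1 : condEntropy ((kmProtocol A D).law P) (kmKey A D)
      (fun ω => ((kmProtocol A D).X ω, (kmProtocol A D).Y ω)) =
      entropy ((kmProtocol A D).law P) (kmKey A D) := by
    refine condEntropy_eq_entropy_of_indep hK hXY fun k v => ?_
    rw [hr1, mul_comm]
    have := hr {w | ((fun i => (w i).1), (fun i => (w i).2)) = v} k
    simp only [and_comm] at this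
    exact this
  rw [← ENNReal.ofReal_toReal (hMf.condEntropy_ne_top hXY)]
  congr 1
  rw [toReal_condEntropy hMf hXY.finiteEntropy]
  have h2 := congrArg ENNReal.toReal h1
  rw [toReal_condEntropy hK.finiteEntropy hXY.finiteEntropy, entropy_uniform hr1, Fintype.card_pi] at h2
  simp only [Finset.prod_const, Finset.card_univ, Fintype.card_fin, Nat.cast_pow, Real.logb_pow] at h2
  rw [← h2]
  congr 1
  exact ent_congr (hMf.prodMk hXY.finiteEntropy)
    (fun x => (decode (x.1.1 0).1, x.2)) (fun x => ((singleRound 0 (encode x.1, []),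
        singleRound 1 (encode (A *ᵥ x.2.2 - x.1), []), singleRound 1 ([], encode (A *ᵥ x.2.1 + x.1))), x.2))
    (fun ω => by simp [kmProtocol_M12, singleRound, decode_encode]) fun ω => by rw [hM]

/-- The bit rates have the first form and the randomness has the second. They differ only by the
rounding to whole bits, so one limit argument covers both. -/
lemma kmProtocol_rate (i : Fin 4) :
    (kmProtocol A D).rate P i = (bitLength (Fin m → F) : ℝ≥0∞) / n ∨
      (kmProtocol A D).rate P i = ENNReal.ofReal (m * Real.logb 2 (Fintype.card F)) / n := by
  have h : ∀ c : ℝ≥0∞, ∫⁻ _, c ∂(kmProtocol A D).law P = c := fun c => by simp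
  fin_cases i
  · left
    change (∫⁻ ω, totalLength ((kmProtocol A D).M12 ω) ∂(kmProtocol A D).law P) / n = _
    simp only [kmProtocol_M12, totalLength_singleRound, encode_length, List.length_nil, add_zero, h]
  · left
    change (∫⁻ ω, totalLength ((kmProtocol A D).M23 ω) ∂(kmProtocol A D).law P) / n = _
    simp only [kmProtocol_M23, totalLength_singleRound, encode_length, List.length_nil, add_zero, h]
  · left
    change (∫⁻ ω, totalLength ((kmProtocol A D).M31 ω) ∂(kmProtocol A D).law P) / n = _
    simp only [kmProtocol_M31, totalLength_singleRound, encode_length, List.length_nil, zero_add, h]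
  · right
    exact congrArg (· / (n : ℝ≥0∞)) (kmProtocol_condEntropy A D P)

end KornerMartonPrivacy

end

end SecureComp

namespace SecureComp

set_option linter.unusedSectionVars false

noncomputable section

/-! ### Random linear codes -/

section RandomCoding

variable {F : Type} [Field F] [Fintype F] {m n : ℕ}

/-- A nonzero vector lies in the kernel of a fraction `1 / |F| ^ m` of the matrices. -/
lemma card_mulVec_eq_zero [DecidableEq F] {v : Fin n → F} (hv : v ≠ 0) :
    (Finset.univ.filter fun A : Matrix (Fin m) (Fin n) F => A *ᵥ v = 0).card *
      Fintype.card (Fin m → F) = Fintype.card (Matrix (Fin m) (Fin n) F) := by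
  obtain ⟨j, hj⟩ := Function.ne_iff.1 hv
  let f : Matrix (Fin m) (Fin n) F →+ (Fin m → F) :=
    { toFun := fun A => A *ᵥ v
      map_zero' := Matrix.zero_mulVec v
      map_add' := fun A B => Matrix.add_mulVec A B v }
  have hf : ∀ u, u ∈ Set.range f := fun u => by
    -- Only the column `j`, where `v j ≠ 0`, is used. Thus `A ↦ A *ᵥ v` is onto, and its fibres have
    -- equal size.
    refine ⟨Matrix.of fun i k => if k = j then u i * (v j)⁻¹ else 0, ?_⟩
    funext i
    have hj' : v j ≠ 0 := hj
    change (Matrix.of fun i k => if k = j then u i * (v j)⁻¹ else 0).mulVec v i = u i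
    simp [Matrix.mulVec, dotProduct, hj']
  have h : ∀ u, (Finset.univ.filter fun A => f A = u).card =
      (Finset.univ.filter fun A => f A = 0).card := fun u =>
    AddMonoidHom.card_fiber_eq_of_mem_range f (hf u) (hf 0)
  have h1 := Finset.card_eq_sum_card_fiberwise (f := f) (s := Finset.univ) (t := Finset.univ)
    fun _ _ => Finset.mem_coe.2 (Finset.mem_univ _)
  simp only [h, Finset.sum_const, Finset.card_univ, smul_eq_mul] at h1
  rw [h1, mul_comm]
  rfl

/-- Linear codes: if most of the weight lies on a set which is small compared with `|F| ^ m`, then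
some `m × n`-matrix compresses with small error. -/
lemma exists_matrix_decoder (w : (Fin n → F) → ℝ) (hw : ∀ c, 0 ≤ w c) (hw1 : ∑ c, w c = 1)
    (T : Finset (Fin n → F)) [DecidableEq F] :
    ∃ (A : Matrix (Fin m) (Fin n) F) (D : (Fin m → F) → (Fin n → F)),
      ∑ c with D (A *ᵥ c) ≠ c, w c ≤
        ∑ c with c ∉ T, w c + T.card / (Fintype.card (Fin m → F) : ℝ) := by
  classical
  set N : ℝ := ((Fintype.card (Fin m → F) : ℕ) : ℝ) with hN
  have hN0 : 0 < N := by rw [hN]; exact_mod_cast Fintype.card_pos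
  -- The weighted number of collisions inside `T`. Its average over all matrices is small because
  -- `c' - c ≠ 0` lies in the kernel for a fraction `1 / N` of them; some matrix does no worse than
  -- the average.
  set coll : Matrix (Fin m) (Fin n) F → ℝ := fun A =>
    ∑ c ∈ T, ∑ c' ∈ T.erase c, if A *ᵥ (c' - c) = 0 then w c else 0 with hcoll
  have havg : ∑ A, coll A ≤ ∑ A : Matrix (Fin m) (Fin n) F, T.card / N := by
    have h1 : ∑ A, coll A = ∑ c ∈ T, ∑ c' ∈ T.erase c,
        w c * (Fintype.card (Matrix (Fin m) (Fin n) F) / N) := by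
      rw [hcoll, Finset.sum_comm]
      refine Finset.sum_congr rfl fun c _ => ?_
      rw [Finset.sum_comm]
      refine Finset.sum_congr rfl fun c' hc' => ?_
      have hne : c' - c ≠ 0 := sub_ne_zero.2 (Finset.ne_of_mem_erase hc')
      have h2 := card_mulVec_eq_zero (m := m) hne
      rw [← h2, ← Finset.sum_filter, Finset.sum_const, nsmul_eq_mul, Nat.cast_mul, ← hN,
        mul_div_cancel_right₀ _ hN0.ne', mul_comm]
    rw [h1]
    have h3 : ∀ c ∈ T, ∑ c' ∈ T.erase c, w c * (Fintype.card (Matrix (Fin m) (Fin n) F) / N) ≤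
        w c * (T.card * (Fintype.card (Matrix (Fin m) (Fin n) F) / N)) := fun c _ => by
      rw [Finset.sum_const, nsmul_eq_mul, mul_left_comm]
      refine mul_le_mul_of_nonneg_left (mul_le_mul_of_nonneg_right ?_ (by positivity)) (hw c)
      exact_mod_cast Finset.card_le_card (Finset.erase_subset _ _)
    refine (Finset.sum_le_sum h3).trans ?_
    rw [← Finset.sum_mul, Finset.sum_const, Finset.card_univ, nsmul_eq_mul]
    have h4 : ∑ c ∈ T, w c ≤ 1 := by
      rw [← hw1]
      exact Finset.sum_le_sum_of_subset_of_nonneg (Finset.subset_univ _) fun c _ _ => hw c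
    calc _ ≤ 1 * (T.card * (Fintype.card (Matrix (Fin m) (Fin n) F) / N)) :=
          mul_le_mul_of_nonneg_right h4 (by positivity)
      _ = _ := by ring
  obtain ⟨A, -, hA⟩ := Finset.exists_le_of_sum_le (Finset.univ_nonempty) havg
  -- The decoder returns any element of `T` with the given image, so an error on `c ∈ T` exhibits a
  -- collision with `c`.
  refine ⟨A, fun u => if h : ∃ c ∈ T, A *ᵥ c = u then h.choose else 0, ?_⟩
  refine le_trans ?_ (add_le_add_right hA _)
  rw [hcoll]
  set E := Finset.univ.filter fun c : Fin n → F =>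
    (if h : ∃ c' ∈ T, A *ᵥ c' = A *ᵥ c then h.choose else 0) ≠ c with hE
  rw [← Finset.sum_filter_add_sum_filter_not E (fun c => c ∉ T)]
  refine add_le_add ?_ ?_
  · exact Finset.sum_le_sum_of_subset_of_nonneg
      (Finset.filter_subset_filter _ (Finset.subset_univ _)) fun c _ _ => hw c
  · have hsub : E.filter (fun c => ¬ c ∉ T) ⊆ T := fun c hc => by
      simpa using (Finset.mem_filter.1 hc).2
    refine le_trans (Finset.sum_le_sum fun c hc => ?_)
      (Finset.sum_le_sum_of_subset_of_nonneg hsub fun c _ _ => Finset.sum_nonneg fun c' _ => ?_)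
    · obtain ⟨hcE, hcT⟩ := Finset.mem_filter.1 hc
      rw [not_not] at hcT
      have hex : ∃ c' ∈ T, A *ᵥ c' = A *ᵥ c := ⟨c, hcT, rfl⟩
      have hne := (Finset.mem_filter.1 hcE).2
      rw [dif_pos hex] at hne
      have hmem : hex.choose ∈ T.erase c := Finset.mem_erase.2 ⟨hne, hex.choose_spec.1⟩
      have h0 : A *ᵥ (hex.choose - c) = 0 := by
        rw [Matrix.mulVec_sub, hex.choose_spec.2, sub_self]
      refine le_trans ?_ (Finset.single_le_sum (f := fun c' => if A *ᵥ (c' - c) = 0 then w c else 0)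
        (fun c' _ => ?_) hmem)
      · simp only [h0, if_true, le_refl]
      · split_ifs
        exacts [hw c, le_rfl]
    · split_ifs
      exacts [hw c, le_rfl]

end RandomCoding

/-! ### Chernoff bound and the number of typical sequences -/

section TypicalSequences

variable {α : Type*} [Fintype α]

/-- The moment generating function of a variable of positive mean is less than 1 somewhere. -/
lemma exists_sum_mul_exp_lt_one {p a : α → ℝ} (hp1 : ∑ z, p z = 1) (h : 0 < ∑ z, p z * a z) :
    ∃ s : ℝ, 0 < s ∧ ∑ z, p z * Real.exp (-(s * a z)) < 1 := by
  -- The function equals 1 at `s = 0` with derivative minus the mean. If it were at least 1 for all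
  -- `s > 0`, its right slopes at 0 would be nonnegative.
  by_contra! hc
  have hd : HasDerivAt (fun s : ℝ => ∑ z, p z * Real.exp (-(s * a z)))
      (∑ z, p z * -a z) 0 := by
    refine HasDerivAt.fun_sum fun z _ => ?_
    have h1 : HasDerivAt (fun s : ℝ => -(s * a z)) (-a z) 0 := by
      simpa using ((hasDerivAt_id (0 : ℝ)).mul_const (a z)).fun_neg
    have h2 := h1.exp.const_mul (p z)
    simpa using h2
  have hlim := (hd.tendsto_slope).mono_left
    (nhdsWithin_mono (0 : ℝ) (fun s (hs : s ∈ Set.Ioi (0 : ℝ)) => ne_of_gt hs))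
  have hnn : 0 ≤ ∑ z, p z * -a z := by
    refine ge_of_tendsto hlim (eventually_mem_nhdsWithin.mono fun s (hs : 0 < s) => ?_)
    rw [slope_def_field]
    refine div_nonneg (sub_nonneg.2 ?_) (by linarith)
    simpa [hp1] using hc s hs
  simp only [mul_neg, Finset.sum_neg_distrib] at hnn
  linarith

variable {n : ℕ} [DecidableEq α]

lemma sum_prod_mul_exp (p a : α → ℝ) (s : ℝ) :
    ∑ c : Fin n → α, (∏ i, p (c i)) * Real.exp (-(s * ∑ i, a (c i))) =
      (∑ z, p z * Real.exp (-(s * a z))) ^ n := by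
  rw [Fintype.sum_pow]
  refine Finset.sum_congr rfl fun c _ => ?_
  rw [Finset.prod_mul_distrib, ← Real.exp_sum, Finset.mul_sum, Finset.sum_neg_distrib]

/-- Chernoff's bound: where `∑ a (c i)` is negative the factor `exp (-(s ∑ a (c i)))` is at least 1.
-/
lemma sum_atypical_le {p a : α → ℝ} (hp : ∀ z, 0 ≤ p z) {s : ℝ} (hs : 0 < s) :
    ∑ c : Fin n → α with ¬ 0 ≤ ∑ i, a (c i), ∏ i, p (c i) ≤
      (∑ z, p z * Real.exp (-(s * a z))) ^ n := by
  rw [← sum_prod_mul_exp]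
  have hnn : ∀ c : Fin n → α, 0 ≤ ∏ i, p (c i) := fun c => Finset.prod_nonneg fun i _ => hp _
  refine le_trans (Finset.sum_le_sum fun c hc => ?_)
    (Finset.sum_le_sum_of_subset_of_nonneg (Finset.filter_subset _ _)
      fun c _ _ => mul_nonneg (hnn c) (Real.exp_pos _).le)
  have h := not_le.1 (Finset.mem_filter.1 hc).2
  refine le_mul_of_one_le_right (hnn c) (Real.one_le_exp ?_)
  nlinarith

/-- The number of sequences of probability at least `exp (-n h)`. -/
lemma card_typical_le {p : α → ℝ} (hp : ∀ z, 0 < p z) (hp1 : ∑ z, p z = 1) (h : ℝ) :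
    ((Finset.univ.filter fun c : Fin n → α => 0 ≤ ∑ i, (Real.log (p (c i)) + h)).card : ℝ) ≤
      Real.exp (n * h) := by
  set T := Finset.univ.filter fun c : Fin n → α => 0 ≤ ∑ i, (Real.log (p (c i)) + h)
  have hsum : ∑ c : Fin n → α, ∏ i, p (c i) = 1 := by
    rw [← Fintype.sum_pow, hp1, one_pow]
  have h1 : ∑ c ∈ T, Real.exp (-(n * h)) ≤ 1 := by
    rw [← hsum]
    refine le_trans (Finset.sum_le_sum fun c hc => ?_)
      (Finset.sum_le_sum_of_subset_of_nonneg (Finset.subset_univ T)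
        fun c _ _ => Finset.prod_nonneg fun i _ => (hp _).le)
    have h2 := (Finset.mem_filter.1 hc).2
    rw [Finset.sum_add_distrib, Finset.sum_const, Finset.card_univ, Fintype.card_fin,
      nsmul_eq_mul] at h2
    have h3 : ∏ i, p (c i) = Real.exp (∑ i, Real.log (p (c i))) := by
      rw [Real.exp_sum]
      exact Finset.prod_congr rfl fun i _ => (Real.exp_log (hp _)).symm
    rw [h3]
    exact Real.exp_le_exp.2 (by linarith)
  rw [Finset.sum_const, nsmul_eq_mul, Real.exp_neg, ← div_eq_mul_inv,
    div_le_one (Real.exp_pos _)] at h1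
  exact h1

end TypicalSequences

/-! ### Linear source coding -/

section SourceCoding

variable {F : Type} [Field F] [Fintype F]

/-- Linear source coding: matrices with `mₙ` rows, where `mₙ log |F| ≥ n (h + η)` with `h` the
entropy (in nats) of `p` and `η > 0`, compress with exponentially small error. -/
lemma exists_linear_source_code [DecidableEq F] {p : F → ℝ} (hp : ∀ z, 0 < p z)
    (hp1 : ∑ z, p z = 1) {η : ℝ} (hη : 0 < η) (m : ℕ → ℕ)
    (hm : ∀ n, n * (∑ z, Real.negMulLog (p z) + η) ≤ m n * Real.log (Fintype.card F)) :
    ∃ (A : ∀ n, Matrix (Fin (m n)) (Fin n) F) (D : ∀ n, (Fin (m n) → F) → (Fin n → F)),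
      Tendsto (fun n => ∑ c : Fin n → F with D n (A n *ᵥ c) ≠ c, ∏ i, p (c i)) atTop (𝓝 0) := by
  -- The threshold is placed halfway in the slack: one `η / 2` makes the atypical sequences
  -- improbable, the other makes the typical ones few compared with `|F| ^ m`.
  set h := ∑ z, Real.negMulLog (p z) + η / 2 with hh
  have hN : (0 : ℝ) < Fintype.card F := by exact_mod_cast Fintype.card_pos
  obtain ⟨s, hs, hlt⟩ := exists_sum_mul_exp_lt_one (a := fun z => Real.log (p z) + h) hp1 (by
    have : ∑ z, p z * (Real.log (p z) + h) = h - ∑ z, Real.negMulLog (p z) := by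
      simp only [mul_add, Finset.sum_add_distrib, ← Finset.sum_mul, hp1, Real.negMulLog, neg_mul,
        Finset.sum_neg_distrib]
      ring
    rw [this]
    linarith)
  have hsum : ∀ n, ∑ c : Fin n → F, ∏ i, p (c i) = 1 := fun n => by
    rw [← Fintype.sum_pow, hp1, one_pow]
  choose A D hAD using fun n => exists_matrix_decoder (m := m n) (fun c : Fin n → F => ∏ i, p (c i))
    (fun c => Finset.prod_nonneg fun i _ => (hp _).le) (hsum n)
    (Finset.univ.filter fun c : Fin n → F => 0 ≤ ∑ i, (Real.log (p (c i)) + h))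
  refine ⟨A, D, ?_⟩
  set g := ∑ z, p z * Real.exp (-(s * (Real.log (p z) + h)))
  have hg0 : 0 ≤ g := Finset.sum_nonneg fun z _ => mul_nonneg (hp z).le (Real.exp_pos _).le
  have hlim : Tendsto (fun n : ℕ => g ^ n + Real.exp (-(η / 2)) ^ n) atTop (𝓝 0) := by
    have := (tendsto_pow_atTop_nhds_zero_of_lt_one hg0 hlt).add
      (tendsto_pow_atTop_nhds_zero_of_lt_one (Real.exp_pos (-(η / 2))).le
        (Real.exp_lt_one_iff.2 (by linarith)))
    simpa using this
  refine squeeze_zero (fun n => Finset.sum_nonneg fun c _ =>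
    Finset.prod_nonneg fun i _ => (hp _).le) (fun n => (hAD n).trans (add_le_add ?_ ?_)) hlim
  · have := sum_atypical_le (n := n) (p := p) (a := fun z => Real.log (p z) + h)
      (fun z => (hp z).le) hs
    simpa using this
  · have hc := card_typical_le (n := n) hp hp1 h
    have hNm : (Fintype.card (Fin (m n) → F) : ℝ) = Real.exp (m n * Real.log (Fintype.card F)) := by
      rw [Fintype.card_pi, Finset.prod_const, Finset.card_univ, Fintype.card_fin, Nat.cast_pow,
        Real.exp_nat_mul, Real.exp_log hN]
    rw [hNm]
    refine (div_le_div_of_nonneg_right hc (Real.exp_pos _).le).trans ?_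
    rw [← Real.exp_sub, ← Real.exp_nat_mul]
    refine Real.exp_le_exp.2 ?_
    have := hm n
    rw [hh]
    linarith

end SourceCoding

end

end SecureComp

namespace SecureComp

set_option linter.unusedSectionVars false

noncomputable section

/-! ### Rates and reliability of the Körner–Marton protocol -/

section KornerMartonRates

variable {F : Type} [Field F] [Fintype F] [MeasurableSpace F] [MeasurableSingletonClass F]

/-- The keys cancel in Charlie's sum, so an error is a function of `Z` alone, whose law is a
product. -/
lemma kmProtocol_real_error [DecidableEq F] {m n : ℕ} (A : Matrix (Fin m) (Fin n) F)
    (D : (Fin m → F) → (Fin n → F)) (P : Measure (F × F)) [IsProbabilityMeasure P] :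
    ((kmProtocol A D).law P).real {ω | (kmProtocol A D).Zhat ω ≠
      (kmProtocol A D).Z (fun x y => x + y) ω} =
      ∑ c : Fin n → F with D (A *ᵥ c) ≠ c, ∏ i, P.real {p | p.1 + p.2 = c i} := by
  have hZ := (kmProtocol A D).isDiscrete_Z P (fun x y : F => x + y)
  simp only [kmProtocol_Zhat]
  have h := hZ.hasSum_setOf (p := fun ω => D (A *ᵥ (kmProtocol A D).Z (fun x y => x + y) ω) ≠
      (kmProtocol A D).Z (fun x y => x + y) ω)
    (q := fun c ω => D (A *ᵥ c) ≠ c ∧ (kmProtocol A D).Z (fun x y => x + y) ω = c)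
    (hZ.nullMeasurableSet_preimage {c | D (A *ᵥ c) ≠ c})
    fun c ω => ⟨fun h => by rw [h.2]; exact ⟨h.1, rfl⟩, fun h => by rw [← h.2]; exact ⟨h.1, rfl⟩⟩
  rw [← (hasSum_fintype _).unique h, Finset.sum_filter]
  refine Finset.sum_congr rfl fun c _ => ?_
  split_ifs with hc
  · simp only [hc, ne_eq, not_false_eq_true, true_and]
    exact (kmProtocol A D).law_real_block P (fun p => p.1 + p.2) c
  · simp [hc]

lemma logb_pos_card : 0 < Real.logb 2 (Fintype.card F) :=
  Real.logb_pos one_lt_two (by exact_mod_cast Fintype.one_lt_card)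

lemma logb_le_bitLength {m : ℕ} :
    m * Real.logb 2 (Fintype.card F) ≤ bitLength (Fin m → F) ∧
      (bitLength (Fin m → F) : ℝ) ≤ m * Real.logb 2 (Fintype.card F) + 1 := by
  have h1 : (bitLength (Fin m → F) : ℝ) = (⌈m * Real.logb 2 (Fintype.card F)⌉₊ : ℝ) := by
    rw [bitLength, Fintype.card_pi, Finset.prod_const, Finset.card_univ, Fintype.card_fin,
      ← Real.logb_pow, ← Nat.cast_pow]
    have := Real.natCeil_logb_natCast 2 (Fintype.card F ^ m)
    rw [← this, Nat.cast_two]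
  rw [h1]
  exact ⟨Nat.le_ceil _, (Nat.ceil_lt_add_one
    (mul_nonneg (Nat.cast_nonneg _) logb_pos_card.le)).le⟩

/-- The rates of protocols with matrices of `⌈n R⌉` rows. -/
lemma tendsto_kmProtocol_rate (P : Measure (F × F)) [IsProbabilityMeasure P] {R : ℝ} (hR : 0 ≤ R)
    (A : ∀ n : ℕ, Matrix (Fin ⌈n * R⌉₊) (Fin n) F) (D : ∀ n : ℕ, (Fin ⌈n * R⌉₊ → F) → (Fin n → F))
    (i : Fin 4) :
    Tendsto (fun n => (kmProtocol (A n) (D n)).rate P i) atTop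
      (𝓝 (ENNReal.ofReal (R * Real.logb 2 (Fintype.card F)))) := by
  set L := Real.logb 2 (Fintype.card F)
  have h1 : Tendsto (fun n : ℕ => (⌈n * R⌉₊ : ℝ) * L / n) atTop (𝓝 (R * L)) := by
    have := ((tendsto_nat_ceil_mul_div_atTop hR).comp
      (tendsto_natCast_atTop_atTop (R := ℝ))).mul_const L
    refine this.congr fun n => ?_
    simp only [Function.comp_apply, mul_comm R]
    ring
  have h2 : Tendsto (fun n : ℕ => ((⌈n * R⌉₊ : ℝ) * L + 1) / n) atTop (𝓝 (R * L)) := by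
    have := h1.add tendsto_one_div_atTop_nhds_zero_nat
    rw [add_zero] at this
    exact this.congr fun n => (add_div _ _ _).symm
  have h1' := ENNReal.tendsto_ofReal h1
  have h2' := ENNReal.tendsto_ofReal h2
  have hd : ∀ (n : ℕ), 1 ≤ n → ∀ x : ℝ, ENNReal.ofReal x / n = ENNReal.ofReal (x / n) := fun n hn x => by
    rw [ENNReal.ofReal_div_of_pos (by exact_mod_cast hn), ENNReal.ofReal_natCast]
  refine tendsto_of_tendsto_of_tendsto_of_le_of_le' h1' h2' ?_ ?_
  · filter_upwards [eventually_ge_atTop 1] with n hn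
    rcases kmProtocol_rate (A n) (D n) P i with h | h
    · rw [h, ← ENNReal.ofReal_natCast (bitLength _), hd n hn]
      exact ENNReal.ofReal_le_ofReal
        (div_le_div_of_nonneg_right logb_le_bitLength.1 (Nat.cast_nonneg _))
    · rw [h, hd n hn]
  · filter_upwards [eventually_ge_atTop 1] with n hn
    rcases kmProtocol_rate (A n) (D n) P i with h | h
    · rw [h, ← ENNReal.ofReal_natCast (bitLength _), hd n hn]
      exact ENNReal.ofReal_le_ofReal
        (div_le_div_of_nonneg_right logb_le_bitLength.2 (Nat.cast_nonneg _))
    · rw [h, hd n hn]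
      exact ENNReal.ofReal_le_ofReal
        (div_le_div_of_nonneg_right (le_add_of_nonneg_right zero_le_one) (Nat.cast_nonneg _))

variable {pX pY : Measure F} [IsProbabilityMeasure pX] [IsProbabilityMeasure pY]

/-- The secure Körner–Marton protocols. -/
theorem exists_kmProtocol (hX : ∀ x, pX {x} ≠ 0) (hY : ∀ y, pY {y} ≠ 0) {HZ : ℝ≥0∞}
    (hHZ : HZ = entropy (pX.prod pY) (fun p : F × F => p.1 + p.2)) {ε : ℝ} (hε : 0 < ε) :
    ∃ A : ∀ n : ℕ, Matrix
        (Fin ⌈n * (HZ.toReal / Real.logb 2 (Fintype.card F) + ε)⌉₊) (Fin n) F,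
    ∃ D : ∀ n : ℕ,
        (Fin ⌈n * (HZ.toReal / Real.logb 2 (Fintype.card F) + ε)⌉₊ → F) → (Fin n → F),
      (∀ δ : ℝ≥0∞, 0 < δ → ∀ᶠ n in atTop,
        (kmProtocol (A n) (D n)).SecureUpTo (pX.prod pY) (fun x y => x + y) δ) ∧
      (∀ i, Tendsto (fun n => (kmProtocol (A n) (D n)).rate (pX.prod pY) i) atTop
        (𝓝 (HZ + ENNReal.ofReal (ε * Real.logb 2 (Fintype.card F))))) := by
  classical
  obtain ⟨δ₀, hδ₀, hP⟩ := BlockProtocol.exists_le_prod_real_singleton hX hY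
  have hL : 0 < Real.logb 2 (Fintype.card F) := logb_pos_card
  have hl2 : 0 < Real.log 2 := Real.log_pos one_lt_two
  have hlF : Real.log (Fintype.card F) = Real.logb 2 (Fintype.card F) * Real.log 2 := by
    rw [Real.logb, div_mul_cancel₀ _ hl2.ne']
  set L := Real.logb 2 (Fintype.card F)
  have hHZt : HZ ≠ ∞ := by rw [hHZ]; exact entropy_ne_top_of_finite _
  set p : F → ℝ := fun z => (pX.prod pY).real {p : F × F | p.1 + p.2 = z} with hp
  have hp0 : ∀ z, 0 < p z := fun z => (hδ₀.trans_le (hP (z, 0))).trans_le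
    (measureReal_mono (by simp))
  have hp1 : ∑ z, p z = 1 := by
    have hd : IsDiscrete (pX.prod pY) (fun p : F × F => p.1 + p.2) :=
      isDiscrete_of_countable fun z => (Set.toFinite _).measurableSet.nullMeasurableSet
    have := hd.hasSum_setOf (p := fun _ => True) (q := fun u ω => ω.1 + ω.2 = u)
      (μ := pX.prod pY) (by simp) fun _ _ => by simp
    simpa using (hasSum_fintype _).unique this
  have hH : ∑ z, Real.negMulLog (p z) = HZ.toReal * Real.log 2 := by
    have := ent_eq_sum (μ := pX.prod pY) (fun p : F × F => p.1 + p.2)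
    rw [ent, ← hHZ, eq_div_iff hl2.ne'] at this
    exact this.symm
  -- The surplus of `ε` rows per symbol, measured in nats, is `η = ε log |F|`.
  obtain ⟨A, D, hAD⟩ := exists_linear_source_code hp0 hp1 (η := ε * Real.log (Fintype.card F))
    (by rw [hlF]; positivity) (fun n => ⌈n * (HZ.toReal / L + ε)⌉₊) (fun n => by
      have h1 := Nat.le_ceil (n * (HZ.toReal / L + ε))
      refine le_trans (le_of_eq ?_) (mul_le_mul_of_nonneg_right h1 (by rw [hlF]; positivity))
      rw [hH, hlF]
      field_simp)
  refine ⟨A, D, fun δ hδ => ?_, fun i => ?_⟩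
  · have hlim := ENNReal.tendsto_ofReal hAD
    rw [ENNReal.ofReal_zero] at hlim
    filter_upwards [hlim.eventually (gt_mem_nhds hδ)] with n hn
    refine kmProtocol_secureUpTo (A n) (D n) (pX.prod pY) ?_
    rw [← ENNReal.ofReal_toReal (measure_ne_top _ _)]
    have := kmProtocol_real_error (A n) (D n) (pX.prod pY)
    rw [measureReal_def] at this
    rw [this]
    exact hn.le
  · have h := tendsto_kmProtocol_rate (pX.prod pY) (R := HZ.toReal / L + ε) (by positivity) A D i
    have e : ENNReal.ofReal ((HZ.toReal / L + ε) * L) = HZ + ENNReal.ofReal (ε * L) := by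
      rw [add_mul, div_mul_cancel₀ _ hL.ne', ENNReal.ofReal_add ENNReal.toReal_nonneg (by positivity),
        ENNReal.ofReal_toReal hHZt]
    rwa [← e]

/-- The protocols achieve all four rates `H(Z) + ε log |F|`; the closure in the definition of the
region absorbs `ε → 0`. -/
theorem entropy_mem_regionAS (hX : ∀ x, pX {x} ≠ 0) (hY : ∀ y, pY {y} ≠ 0) {HZ : ℝ≥0∞}
    (hHZ : HZ = entropy (pX.prod pY) (fun p : F × F => p.1 + p.2)) :
    (fun _ => HZ.toNNReal) ∈ regionAS (pX.prod pY) (fun x y : F => x + y) := by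
  have hHZt : HZ ≠ ∞ := by rw [hHZ]; exact entropy_ne_top_of_finite _
  set L := Real.logb 2 (Fintype.card F) with hL
  have hlim : Tendsto (fun ε : ℝ => (fun _ : Fin 4 => HZ.toNNReal + Real.toNNReal (ε * L)))
      (𝓝[>] 0) (𝓝 (fun _ => HZ.toNNReal)) := by
    have hc : Continuous (fun ε : ℝ => (fun _ : Fin 4 => HZ.toNNReal + Real.toNNReal (ε * L))) := by
      fun_prop
    have := (hc.tendsto 0).mono_left (nhdsWithin_le_nhds (s := Set.Ioi 0))
    simpa using this
  refine mem_closure_of_tendsto hlim (eventually_mem_nhdsWithin.mono fun ε hε => ?_)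
  obtain ⟨A, D, h1, h2⟩ := exists_kmProtocol hX hY hHZ hε
  refine ⟨fun n => kmProtocol (A n) (D n), fun i => ?_, fun δ hδ => (h1 δ hδ).frequently⟩
  have e : ((HZ.toNNReal + Real.toNNReal (ε * L) : ℝ≥0) : ℝ≥0∞) = HZ + ENNReal.ofReal (ε * L) := by
    rw [ENNReal.coe_add, ENNReal.coe_toNNReal hHZt, ENNReal.ofReal]
  exact (h2 i).trans_eq (congrArg 𝓝 e.symm)

end KornerMartonRates

end

end SecureComp

theorem mainTheorem11 {F : Type} [Field F] [Fintype F] [MeasurableSpace F]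
    [MeasurableSingletonClass F] (pX pY : MeasureTheory.Measure F)
    [MeasureTheory.IsProbabilityMeasure pX] [MeasureTheory.IsProbabilityMeasure pY]
    (hX : ∀ x, pX {x} ≠ 0) (hY : ∀ y, pY {y} ≠ 0)
    (HZ : ℝ≥0∞) (hHZ : HZ = SecureComp.entropy (pX.prod pY) (fun p : F × F => p.1 + p.2)) :
    (∀ q ∈ SecureComp.regionAS (pX.prod pY) (fun x y : F => x + y), ∀ i, HZ ≤ q i) ∧
    (∀ ε : ℝ, 0 < ε →
      ∃ A : ∀ n : ℕ, Matrix
          (Fin ⌈n * (HZ.toReal / Real.logb 2 (Fintype.card F) + ε)⌉₊) (Fin n) F,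
      ∃ D : ∀ n : ℕ,
          (Fin ⌈n * (HZ.toReal / Real.logb 2 (Fintype.card F) + ε)⌉₊ → F) → (Fin n → F),
        (∀ δ : ℝ≥0∞, 0 < δ → ∀ᶠ n in atTop,
          (SecureComp.kmProtocol (A n) (D n)).SecureUpTo (pX.prod pY) (fun x y => x + y) δ) ∧
        (∀ i, Tendsto (fun n => (SecureComp.kmProtocol (A n) (D n)).rate (pX.prod pY) i) atTop
          (𝓝 (HZ + ENNReal.ofReal (ε * Real.logb 2 (Fintype.card F)))))) ∧
    (fun _ => HZ.toNNReal) ∈ SecureComp.regionAS (pX.prod pY) (fun x y : F => x + y) ∧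
    (∀ q ∈ SecureComp.regionPS (pX.prod pY) (fun x y : F => x + y), ∀ i,
      Real.logb 2 (Fintype.card F) ≤ q i) ∧
    ((∃ z, (pX.prod pY) {p : F × F | p.1 + p.2 = z} ≠ (Fintype.card F : ℝ≥0∞)⁻¹) →
      (fun _ => HZ.toNNReal) ∉ SecureComp.regionPS (pX.prod pY) (fun x y : F => x + y)) := by
  refine ⟨fun q hq i => ?_, fun ε hε => SecureComp.exists_kmProtocol hX hY hHZ hε,
    SecureComp.entropy_mem_regionAS hX hY hHZ,
    fun q hq i => SecureComp.logb_card_le_of_mem_regionPS hX hY hq i, fun hz hmem => ?_⟩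
  · rw [hHZ]
    exact SecureComp.entropy_le_of_mem_regionAS hX hY hq i
  · have h1 := SecureComp.logb_card_le_of_mem_regionPS hX hY hmem 0
    have h2 := SecureComp.entropy_lt_logb_card hz
    rw [← hHZ] at h2
    exact absurd h2 (not_lt.2 h1)
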